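/- **Setting.** Let $\mathcal X,\mathcal Y$ be Euclidean spaces, $f,g:\mathcal X\times\mathcal Y\to\mathbb R$, $f$ differentiable, $g$ twice differentiable, $y^\star(x)=\arg\min_y g(x,y)$, $\mathcal L(x)=f(x,y^\star(x))$. Fix positive constants $L_f,B,M_g,L_g',L_g$ and let $0<\mu_g\le L_g$. Assume: $g(x,\cdot)$ is $L_g$-smooth and $\mu_g$-strongly convex for all $x$; $\nabla f$ is $L_f$-Lipschitz and $\|\partial_yf\|\le B$; $\partial_{xy}g$ and $\partial_{yy}g$ are $M_g$-Lipschitz (operator norm); $\|\partial_yg(x,y)-\partial_yg(x',y)\|\le L_g'\|x-x'\|$. Put $L=(L_f+\mu_g^{-2}L_g'M_gB+\mu_g^{-1}(L_g'L_f+M_gB))(1+\mu_g^{-1}L_g')$, which is a smoothness constant of $\mathcal L$, and assume that $\mathcal L$ is $\mu$-strongly convex, $0<\mu\le L$, with minimizer $x^\star$ and minimum $\mathcal L^\star$. Put $\kappa_{\mathcal L}=L/\mu$, $\kappa_g=L_g/\mu_g$. Moreover $f=\mathbb E_\xi\hat f(\cdot,\cdot,\xi)$, $g=\mathbb E_\xi\hat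 g(\cdot,\cdot,\xi)$, with $\hat f(\cdot,\cdot,\xi)$ differentiable and $\hat g(\cdot,\cdot,\xi)$ twice differentiable. For an i.i.d. batch $\mathcal D$ let $\hat f(x,y,\mathcal D)$, $\hat g(x,y,\mathcal D)$ be the averages over $\mathcal D$; the estimators $\nabla\hat f,\partial_y\hat g,\partial_{xy}\hat g,\partial_{yy}\hat g$ are unbiased, $\mathbb E\|\nabla\hat f-\nabla f\|^2\le\sigma_f^2/|\mathcal D|$, $\mathbb E\|\partial_y\hat g-\partial_yg\|^2\le\sigma_g^2/|\mathcal D|$, and $F_1=\partial_{xy}\hat g-\partial_{xy}g$, $F_2=\partial_{yy}\hat g-\partial_{yy}g$ satisfy $\|\mathbb E[F_1^\top F_1]\|_{op}\le\sigma_{g_{xy}}^2/|\mathcal D|$, $\|\mathbb E[F_2^\top F_2]\|_{op}\le\sigma_{g_{yy}}^2/|\mathcal D|$. Here $\partial_{xy}g(x,y)$ is a $\dim\mathcal X\times\dim\mathcal Y$ matrix. **Algorithm (AmIGO).** Given $x_0,y_{-1},z_{-1}$, at iteration $k\ge0$, with fresh independent batches throughout: $y_k$ is the result of $T$ steps $y\leftarrow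 y-\alpha\,\partial_y\hat g(x_k,y,\mathcal D_g)$ started at $y_{k-1}$; $(u_k,v_k)=\nabla\hat f(x_k,y_k,\mathcal D_f)$; $z_k$ is the result of $N$ steps $z\leftarrow z-\beta(\partial_{yy}\hat g(x_k,y_k,\mathcal D_{g_{yy}})z+v_k)$ started at $z_{k-1}$; $x_{k+1}=x_k-\gamma\big(u_k+\partial_{xy}\hat g(x_k,y_k,\mathcal D_{g_{xy}})z_k\big)$. The step sizes are $\alpha=1/L_g$, $\beta=1/(2L_g)$, $\gamma=1/L$. For $\eta_0\in[\mu,L]$ let $\eta_{k+1}=\eta_k+\delta_{k+1}(\mu-\eta_k)$, $\delta_k=\gamma\eta_k$, and $\hat x_0=x_0$, $\hat x_k=(1-\delta_k)\hat x_{k-1}+\delta_kx_k$. The complexity of $k$ iterations is $\mathcal C=k(T|\mathcal D_g|+N|\mathcal D_{g_{yy}}|+|\mathcal D_{g_{xy}}|+|\mathcal D_f|)$. Let $$E_0^{tot}=\tfrac{\eta_0}2\|x_0-x^\star\|^2+\delta_0(1-\alpha\mu_g)^{T/2}\|y_{-1}-y^\star(x_0)\|^2+\delta_0(1-\tfrac12\beta\mu_g)^{N/2}\,\mathbb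 E\|z_{-1}-z^\star(x_0,y_0)\|^2,$$ where $z^\star(x,y)=\arg\min_z\tfrac12z^\top\partial_{yy}g(x,y)z+z^\top\partial_yf(x,y)$, and let $E_0=E_0^{tot}+\mathcal L(x_0)-\mathcal L^\star$. **Corollary 2.** There is $c>0$ and, for every $c'\ge c$, a constant $C>0$, where $c$ depends only on $L_f,B,M_g,L_g',L_g$ and $C$ only on these and $c'$, such that the following holds for all problems, noises and initial values as above, all $\eta_0\in[\mu,L]$ and all $\epsilon\in(0,1]$. Put $\ell=1+\log(\kappa_g\kappa_{\mathcal L})$. Let $T,N\in[c\,\kappa_g\ell,\,c'\kappa_g\ell]$, and let the batch sizes be integers $\ge1$ of the orders $$|\mathcal D_g|\asymp\frac{\kappa_{\mathcal L}\kappa_g^2\sigma_g^2}{\epsilon},\quad|\mathcal D_{g_{xy}}|\asymp\frac{\sigma_{g_{xy}}^2}\epsilon,\quad|\mathcal D_f|\asymp\frac{\sigma_f^2}\epsilon,\quad|\mathcal D_{g_{yy}}|\asymp\sigma_{g_{yy}}^2\Big(\frac1\epsilon\vee\kappa_g\Big),$$ where $n\asymp q$ means $c\,q\le n\le c'(1\vee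 q)$. Then for some number $k$ of iterations $$\mathbb E[\mathcal L(\hat x_k)-\mathcal L^\star]+\frac\mu2\,\mathbb E\|x_k-x^\star\|^2\le\epsilon$$ (both expectations being finite) and $$\mathcal C\le C\,\ell\;\kappa_{\mathcal L}\,\big(S(\epsilon)\vee\epsilon\kappa_g\big)\,\frac1\epsilon\,\Big(1\vee\log\frac{E_0}{\epsilon}\Big),\qquad S(\epsilon)=\kappa_{\mathcal L}\kappa_g^3\sigma_g^2+\kappa_g(1\vee\epsilon\kappa_g)\sigma_{g_{yy}}^2+\sigma_{g_{xy}}^2+\sigma_f^2 .$$ (With the convention $\log 0=0$. In the stochastic case, when the variances are not all zero, $S(\epsilon)\ge\epsilon\kappa_g$ for all small $\epsilon$, and $\log(E_0/\epsilon)\ge1$ for all small $\epsilon$ if $E_0>0$. The bound then reads $O\big(\kappa_{\mathcal L}S(\epsilon)\,\epsilon^{-1}\log(E_0/\epsilon)\big)$ up to the logarithmic factor $\ell$.) -/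

import Mathlib

open MeasureTheory ProbabilityTheory Set

noncomputable section

namespace AmIGO

/-! ### Partial derivatives of a function of two variables -/

section Calculus

variable {X Y : Type*}
  [NormedAddCommGroup X] [InnerProductSpace ℝ X] [CompleteSpace X]
  [NormedAddCommGroup Y] [InnerProductSpace ℝ Y] [CompleteSpace Y]

/-- The partial gradient `∂ₓh(x, y)`. -/
def gradX (h : X → Y → ℝ) (x : X) (y : Y) : X := gradient (fun x' => h x' y) x

/-- The partial gradient `∂_y h(x, y)`. -/
def gradY (h : X → Y → ℝ) (x : X) (y : Y) : Y := gradient (fun y' => h x y') y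

/-- The gradient `∇h(x, y) = (∂ₓh(x, y), ∂_y h(x, y))` in the Euclidean product `X × Y`. -/
def grad (h : X → Y → ℝ) (x : X) (y : Y) : WithLp 2 (X × Y) :=
  WithLp.toLp 2 (gradX h x y, gradY h x y)

/-- The Hessian `∂_yy h(x, y)`: the derivative of `∂_y h` with respect to `y`. -/
def hessYY (h : X → Y → ℝ) (x : X) (y : Y) : Y →L[ℝ] Y :=
  fderiv ℝ (fun y' => gradY h x y') y

/-- The mixed derivative `∂_xy h(x, y)`, i.e. the derivative of `∂_y h` with respect to `x`, written
as the `dim X × dim Y` matrix that acts on vectors of `Y` and takes values in `X`. -/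
def hessXY (h : X → Y → ℝ) (x : X) (y : Y) : Y →L[ℝ] X :=
  ContinuousLinearMap.adjoint (fderiv ℝ (fun x' => gradY h x' y) x)

/-- The Euclidean distance `‖(x, y) - (x', y')‖` in the product space. -/
def pairDist (x : X) (y : Y) (x' : X) (y' : Y) : ℝ :=
  ‖(WithLp.toLp 2 (x, y) : WithLp 2 (X × Y)) - WithLp.toLp 2 (x', y')‖

/-! ### The bilevel problem -/

/-- The inner solution `y⋆(x) = argmin_y g(x, y)`. -/
def innerSol (g : X → Y → ℝ) (x : X) : Y :=
  Classical.epsilon fun y => IsMinOn (g x) univ y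

/-- The outer objective `𝓛(x) = f(x, y⋆(x))`. -/
def outerLoss (f g : X → Y → ℝ) (x : X) : ℝ := f x (innerSol g x)

/-- The outer solution `x⋆ = argmin_x 𝓛(x)`. -/
def outerSol (f g : X → Y → ℝ) : X :=
  Classical.epsilon fun x => IsMinOn (outerLoss f g) univ x

/-- The quadratic `Q(x, y, z) = ½ zᵀ ∂_yy g(x, y) z + zᵀ ∂_y f(x, y)`. -/
def quadObj (f g : X → Y → ℝ) (x : X) (y z : Y) : ℝ :=
  1 / 2 * inner ℝ z (hessYY g x y z) + inner ℝ z (gradY f x y)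

/-- The solution `z⋆(x, y) = argmin_z Q(x, y, z)` of the linear system. -/
def linSol (f g : X → Y → ℝ) (x : X) (y : Y) : Y :=
  Classical.epsilon fun z => IsMinOn (quadObj f g x y) univ z

/-- The deterministic assumptions on `f` and `g`. -/
structure BilevelAssumptions (f g : X → Y → ℝ) (Lf B Mg Lg' Lg μg : ℝ) : Prop where
  f_differentiable : Differentiable ℝ (fun p : X × Y => f p.1 p.2)
  g_differentiable : Differentiable ℝ (fun p : X × Y => g p.1 p.2)
  g_twice_differentiable : Differentiable ℝ (fderiv ℝ (fun p : X × Y => g p.1 p.2))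
  /-- `g(x, ·)` is `L_g`-smooth. -/
  g_smooth : ∀ x y y', ‖gradY g x y - gradY g x y'‖ ≤ Lg * ‖y - y'‖
  /-- `g(x, ·)` is `μ_g`-strongly convex. -/
  g_strongConvex : ∀ x, StrongConvexOn univ μg (g x)
  f_smooth : ∀ x y x' y', ‖grad f x y - grad f x' y'‖ ≤ Lf * pairDist x y x' y'
  f_bounded : ∀ x y, ‖gradY f x y‖ ≤ B
  g_xy_lipschitz : ∀ x y x' y', ‖hessXY g x y - hessXY g x' y'‖ ≤ Mg * pairDist x y x' y'
  g_yy_lipschitz : ∀ x y x' y', ‖hessYY g x y - hessYY g x' y'‖ ≤ Mg * pairDist x y x' y'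
  g_y_lipschitz : ∀ x x' y, ‖gradY g x y - gradY g x' y‖ ≤ Lg' * ‖x - x'‖

/-- The smoothness constant `L` of `𝓛`. -/
def smoothConst (Lf B Mg Lg' μg : ℝ) : ℝ :=
  (Lf + Lg' * Mg * B / μg ^ 2 + (Lg' * Lf + Mg * B) / μg) * (1 + Lg' / μg)

/-! ### Stochastic oracles -/

variable {Ξ : Type*}

/-- `ĥ(x, y, D) = |D|⁻¹ ∑_{ξ ∈ D} ĥ(x, y, ξ)` for a batch `D` of size `n`. -/
def batchAvg {n : ℕ} (h : Ξ → X → Y → ℝ) (D : Fin n → Ξ) : X → Y → ℝ :=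
  fun x y => (n : ℝ)⁻¹ * ∑ i, h (D i) x y

variable [MeasurableSpace Ξ] [MeasurableSpace X] [BorelSpace X] [MeasurableSpace Y] [BorelSpace Y]

/-- The stochastic functions `f̂(·, ·, ξ)` and `ĝ(·, ·, ξ)`, with `ξ` of law `P`, are as smooth as
`f` and `g`, have the means `f` and `g`, and their derivatives depend measurably on `(ξ, x, y)`. -/
structure StochasticModel (P : Measure Ξ) (f g : X → Y → ℝ) (fhat ghat : Ξ → X → Y → ℝ) :
    Prop where
  f_differentiable : ∀ ξ, Differentiable ℝ (fun p : X × Y => fhat ξ p.1 p.2)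
  g_differentiable : ∀ ξ, Differentiable ℝ (fun p : X × Y => ghat ξ p.1 p.2)
  g_twice_differentiable : ∀ ξ, Differentiable ℝ (fderiv ℝ (fun p : X × Y => ghat ξ p.1 p.2))
  f_integrable : ∀ x y, Integrable (fun ξ => fhat ξ x y) P
  f_mean : ∀ x y, ∫ ξ, fhat ξ x y ∂P = f x y
  g_integrable : ∀ x y, Integrable (fun ξ => ghat ξ x y) P
  g_mean : ∀ x y, ∫ ξ, ghat ξ x y ∂P = g x y
  measurable_f_x : Measurable fun p : Ξ × X × Y => gradX (fhat p.1) p.2.1 p.2.2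
  measurable_f_y : Measurable fun p : Ξ × X × Y => gradY (fhat p.1) p.2.1 p.2.2
  measurable_g_y : Measurable fun p : Ξ × X × Y => gradY (ghat p.1) p.2.1 p.2.2
  measurable_g_xy : Measurable fun p : Ξ × X × Y => hessXY (ghat p.1) p.2.1 p.2.2
  measurable_g_yy : Measurable fun p : Ξ × X × Y => hessYY (ghat p.1) p.2.1 p.2.2

/-- The law of a batch of `n` i.i.d. samples of law `P`. -/
abbrev batchLaw (P : Measure Ξ) (n : ℕ) : Measure (Fin n → Ξ) := Measure.pi fun _ => P

/-- The noise assumptions: for batches of any size `n ≥ 1`, the estimators of `∇f`, `∂_y g`,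
`∂_xy g` and `∂_yy g` are unbiased, with variances bounded by `σ² / n`. -/
structure NoiseAssumptions (P : Measure Ξ) (f g : X → Y → ℝ) (fhat ghat : Ξ → X → Y → ℝ)
    (σf σg σgxy σgyy : ℝ) : Prop where
  f_integrable : ∀ n : ℕ, 1 ≤ n → ∀ x y,
    Integrable (fun D : Fin n → Ξ => grad (batchAvg fhat D) x y) (batchLaw P n)
  f_unbiased : ∀ n : ℕ, 1 ≤ n → ∀ x y,
    ∫ D : Fin n → Ξ, grad (batchAvg fhat D) x y ∂(batchLaw P n) = grad f x y
  f_sq_integrable : ∀ n : ℕ, 1 ≤ n → ∀ x y,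
    Integrable (fun D : Fin n → Ξ => ‖grad (batchAvg fhat D) x y - grad f x y‖ ^ 2) (batchLaw P n)
  f_variance : ∀ n : ℕ, 1 ≤ n → ∀ x y,
    ∫ D : Fin n → Ξ, ‖grad (batchAvg fhat D) x y - grad f x y‖ ^ 2 ∂(batchLaw P n) ≤ σf ^ 2 / n
  g_integrable : ∀ n : ℕ, 1 ≤ n → ∀ x y,
    Integrable (fun D : Fin n → Ξ => gradY (batchAvg ghat D) x y) (batchLaw P n)
  g_unbiased : ∀ n : ℕ, 1 ≤ n → ∀ x y,
    ∫ D : Fin n → Ξ, gradY (batchAvg ghat D) x y ∂(batchLaw P n) = gradY g x y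
  g_sq_integrable : ∀ n : ℕ, 1 ≤ n → ∀ x y,
    Integrable (fun D : Fin n → Ξ => ‖gradY (batchAvg ghat D) x y - gradY g x y‖ ^ 2)
      (batchLaw P n)
  g_variance : ∀ n : ℕ, 1 ≤ n → ∀ x y,
    ∫ D : Fin n → Ξ, ‖gradY (batchAvg ghat D) x y - gradY g x y‖ ^ 2 ∂(batchLaw P n) ≤ σg ^ 2 / n
  gxy_integrable : ∀ n : ℕ, 1 ≤ n → ∀ x y,
    Integrable (fun D : Fin n → Ξ => hessXY (batchAvg ghat D) x y - hessXY g x y) (batchLaw P n)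
  gxy_unbiased : ∀ n : ℕ, 1 ≤ n → ∀ x y,
    ∫ D : Fin n → Ξ, (hessXY (batchAvg ghat D) x y - hessXY g x y) ∂(batchLaw P n) = 0
  gxy_sq_integrable : ∀ n : ℕ, 1 ≤ n → ∀ x y,
    Integrable (fun D : Fin n → Ξ =>
      (ContinuousLinearMap.adjoint (hessXY (batchAvg ghat D) x y - hessXY g x y)).comp
        (hessXY (batchAvg ghat D) x y - hessXY g x y)) (batchLaw P n)
  gxy_variance : ∀ n : ℕ, 1 ≤ n → ∀ x y,
    ‖∫ D : Fin n → Ξ,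
      (ContinuousLinearMap.adjoint (hessXY (batchAvg ghat D) x y - hessXY g x y)).comp
        (hessXY (batchAvg ghat D) x y - hessXY g x y) ∂(batchLaw P n)‖ ≤ σgxy ^ 2 / n
  gyy_integrable : ∀ n : ℕ, 1 ≤ n → ∀ x y,
    Integrable (fun D : Fin n → Ξ => hessYY (batchAvg ghat D) x y - hessYY g x y) (batchLaw P n)
  gyy_unbiased : ∀ n : ℕ, 1 ≤ n → ∀ x y,
    ∫ D : Fin n → Ξ, (hessYY (batchAvg ghat D) x y - hessYY g x y) ∂(batchLaw P n) = 0
  gyy_sq_integrable : ∀ n : ℕ, 1 ≤ n → ∀ x y,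
    Integrable (fun D : Fin n → Ξ =>
      (ContinuousLinearMap.adjoint (hessYY (batchAvg ghat D) x y - hessYY g x y)).comp
        (hessYY (batchAvg ghat D) x y - hessYY g x y)) (batchLaw P n)
  gyy_variance : ∀ n : ℕ, 1 ≤ n → ∀ x y,
    ‖∫ D : Fin n → Ξ,
      (ContinuousLinearMap.adjoint (hessYY (batchAvg ghat D) x y - hessYY g x y)).comp
        (hessYY (batchAvg ghat D) x y - hessYY g x y) ∂(batchLaw P n)‖ ≤ σgyy ^ 2 / n

end Calculus

/-! ### The algorithm -/

/-- Labels of the samples that are drawn: the `i`-th sample of the batch `D_f`, resp. `D_gxy`, of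
the outer iteration `k`, and of the batch `D_g`, resp. `D_gyy`, of the inner iteration `t` of the
outer iteration `k`. -/
inductive SampleIdx : Type
  | f (k i : ℕ)
  | gxy (k i : ℕ)
  | g (k t i : ℕ)
  | gyy (k t i : ℕ)

/-- The parameters of the algorithm: numbers of inner iterations, batch sizes, step sizes. -/
structure Params where
  T : ℕ
  N : ℕ
  nf : ℕ
  ng : ℕ
  ngxy : ℕ
  ngyy : ℕ
  α : ℝ
  β : ℝ
  γ : ℝ

section Algorithm

variable {X Y Ξ : Type*}
  [NormedAddCommGroup X] [InnerProductSpace ℝ X] [CompleteSpace X]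
  [NormedAddCommGroup Y] [InnerProductSpace ℝ Y] [CompleteSpace Y]

/-- The iterates `y^t` of the inner algorithm `𝒜` (stochastic gradient descent on `g(x, ·)`). -/
def algA (ghat : Ξ → X → Y → ℝ) {n : ℕ} (α : ℝ) (D : ℕ → Fin n → Ξ) (x : X) (y₀ : Y) : ℕ → Y
  | 0 => y₀
  | t + 1 => algA ghat α D x y₀ t - α • gradY (batchAvg ghat (D t)) x (algA ghat α D x y₀ t)

/-- The iterates `z^t` of the inner algorithm `ℬ` (stochastic gradient descent on `Q(x, y, ·)`, with
`v` in the place of `∂_y f(x, y)`). -/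
def algB (ghat : Ξ → X → Y → ℝ) {n : ℕ} (β : ℝ) (D : ℕ → Fin n → Ξ) (x : X) (y v z₀ : Y) : ℕ → Y
  | 0 => z₀
  | t + 1 => algB ghat β D x y v z₀ t -
      β • (hessYY (batchAvg ghat (D t)) x y (algB ghat β D x y v z₀ t) + v)

/-- One outer iteration, the `k`-th: from `(x_k, y_{k-1}, z_{k-1})` to `(x_{k+1}, y_k, z_k)`, where
`s` is the realisation of all samples. -/
def amigoStep (fhat ghat : Ξ → X → Y → ℝ) (p : Params) (s : SampleIdx → Ξ) (k : ℕ)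
    (w : X × Y × Y) : X × Y × Y :=
  let x := w.1
  let y := algA ghat p.α (fun t (i : Fin p.ng) => s (.g k t i)) x w.2.1 p.T
  let Df : Fin p.nf → Ξ := fun i => s (.f k i)
  let u := gradX (batchAvg fhat Df) x y
  let v := gradY (batchAvg fhat Df) x y
  let z := algB ghat p.β (fun t (i : Fin p.ngyy) => s (.gyy k t i)) x y v w.2.2 p.N
  let ψ := u + hessXY (batchAvg ghat fun i : Fin p.ngxy => s (.gxy k i)) x y z
  (x - p.γ • ψ, y, z)

/-- The state `(x_k, y_{k-1}, z_{k-1})` after `k` outer iterations, started at `w₀`. -/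
def amigo (fhat ghat : Ξ → X → Y → ℝ) (p : Params) (s : SampleIdx → Ξ) (w₀ : X × Y × Y) :
    ℕ → X × Y × Y
  | 0 => w₀
  | k + 1 => amigoStep fhat ghat p s k (amigo fhat ghat p s w₀ k)

end Algorithm

/-- The sequence `η_k` that fixes the averaging weights `δ_k = γ η_k`. It is the solution of
`η_{k+1} = η_k + δ_{k+1} (μ - η_k)`, see `eta_succ`. -/
def eta (μ γ η₀ : ℝ) : ℕ → ℝ
  | 0 => η₀
  | k + 1 => eta μ γ η₀ k / (1 + γ * (eta μ γ η₀ k - μ))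

theorem le_eta {μ γ η₀ : ℝ} (hγ : 0 ≤ γ) (hγμ : γ * μ ≤ 1) (h : μ ≤ η₀) (k : ℕ) :
    μ ≤ eta μ γ η₀ k := by
  induction k with
  | zero => exact h
  | succ k ih =>
    have h1 : 0 ≤ γ * (eta μ γ η₀ k - μ) := mul_nonneg hγ (sub_nonneg.2 ih)
    rw [eta, le_div_iff₀ (by linarith)]
    nlinarith [mul_nonneg (sub_nonneg.2 ih) (sub_nonneg.2 hγμ)]

theorem eta_succ {μ γ η₀ : ℝ} (hγ : 0 ≤ γ) (hγμ : γ * μ ≤ 1) (h : μ ≤ η₀) (k : ℕ) :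
    eta μ γ η₀ (k + 1) =
      eta μ γ η₀ k + γ * eta μ γ η₀ (k + 1) * (μ - eta μ γ η₀ k) := by
  have h1 : 0 ≤ γ * (eta μ γ η₀ k - μ) := mul_nonneg hγ (sub_nonneg.2 (le_eta hγ hγμ h k))
  have h2 : 1 + γ * (eta μ γ η₀ k - μ) ≠ 0 := by linarith
  have h3 : eta μ γ η₀ (k + 1) * (1 + γ * (eta μ γ η₀ k - μ)) = eta μ γ η₀ k := by
    rw [eta, div_mul_cancel₀ _ h2]
  linarith

/-- The averaged iterates `x̂₀ = x₀`, `x̂_k = (1 - δ_k) x̂_{k-1} + δ_k x_k`. -/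
def avgIterate {X : Type*} [AddCommGroup X] [Module ℝ X] (δ : ℕ → ℝ) (x : ℕ → X) : ℕ → X
  | 0 => x 0
  | k + 1 => (1 - δ (k + 1)) • avgIterate δ x k + δ (k + 1) • x (k + 1)

/-- The initial total energy
`(η₀ / 2) ‖x₀ - x⋆‖² + a₀ ‖y₋₁ - y⋆(x₀)‖² + b₀ 𝔼 ‖z₋₁ - z⋆(x₀, y₀)‖²`
with `a₀ = δ₀ (1 - α μ_g)^(T/2)`, `b₀ = δ₀ (1 - β μ_g / 2)^(N/2)` and `δ₀ = γ η₀`, for the samples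
`s` on the probability space `(Ω, Pr)` and the initial values `w₀ = (x₀, y₋₁, z₋₁)`. -/
def initialEnergy {X Y Ξ Ω : Type*}
    [NormedAddCommGroup X] [InnerProductSpace ℝ X] [CompleteSpace X]
    [NormedAddCommGroup Y] [InnerProductSpace ℝ Y] [CompleteSpace Y] [MeasurableSpace Ω]
    (Pr : Measure Ω) (f g : X → Y → ℝ) (fhat ghat : Ξ → X → Y → ℝ) (p : Params)
    (s : SampleIdx → Ω → Ξ) (μg η₀ : ℝ) (w₀ : X × Y × Y) : ℝ :=
  η₀ / 2 * ‖w₀.1 - outerSol f g‖ ^ 2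
    + p.γ * η₀ * √((1 - p.α * μg) ^ p.T) * ‖w₀.2.1 - innerSol g w₀.1‖ ^ 2
    + p.γ * η₀ * √((1 - p.β * μg / 2) ^ p.N) *
      ∫ ω, ‖w₀.2.2 - linSol f g w₀.1 (amigo fhat ghat p (fun i => s i ω) w₀ 1).2.1‖ ^ 2 ∂Pr

/-- The number of gradient evaluations, Jacobian- and Hessian-vector products of `k` iterations. -/
def complexity (p : Params) (k : ℕ) : ℝ :=
  (k : ℝ) * ((p.T : ℝ) * p.ng + (p.N : ℝ) * p.ngyy + p.ngxy + p.nf)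

/-- The integer `n` is a positive batch size of order `q`, up to the constants `c` and `c'`. -/
def IsOrder (c c' q : ℝ) (n : ℕ) : Prop := 1 ≤ n ∧ c * q ≤ n ∧ (n : ℝ) ≤ c' * max 1 q

end AmIGO

end

noncomputable section

namespace AmIGO

open Filter Topology

set_option linter.unusedSectionVars false

/-! ### Smooth and strongly convex functions -/

section Convex

variable {E : Type*} [NormedAddCommGroup E] [InnerProductSpace ℝ E] [CompleteSpace E]

/-! Write κ = L_g/μ_g and κ_L = L/μ. The proof is a Lyapunov argument for three coupled mean-square
errors: that of y (`Yo` before and `Y` after its inner run, measured from y⋆(x_k)), that of z (`Zo`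
and `Z`, measured from z⋆(x_k, y_k)), and the outer energy V_k = 𝔼[𝓛(x̂_k) − 𝓛⋆] + (η_k/2) 𝔼‖x_k −
x⋆‖².

Implicit differentiation gives ∇𝓛 as the value of ∂ₓf + ∂_xy g z at y⋆ and z⋆
(`hasGradientAt_outerLoss`). Evaluated at other y and z it is wrong by at most Ly‖y − y⋆‖ + Lg'‖z −
z⋆‖, with Ly = O(κ²) (`hyperGrad_sub_lossGrad_le`). The two inner runs contract the squared errors
by ρ_A = (1 − αμ_g)^T and ρ_B = (1 − βμ_g/2)^N, up to noise floors Ry and Rz (`inner_run`,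
`linear_run`).

The decisive point is to separate bias from variance. In a gradient step with error e, the error
enters as −⟨φ, e⟩ + γ‖e‖² with φ known before the step (`inexact_gradient_step_le`). In expectation
only the conditional mean b of e meets φ. It costs (4/μ) 𝔼‖b‖², whereas e itself costs only γ 𝔼‖e‖²,
cheaper by a factor of order κ_L. Since ℬ is affine in z and its batches are unbiased, the
conditional mean of z_k is the run with exact Hessian and gradient (`exactRun`), which has no noise
floor. Hence b sees only the error of y and ρ_B `Zo`, and |D_g| is the only batch size that must
carry κ_L. Conditional expectations are never formed: they are replaced by pairings with all square
integrable vectors measurable with respect to the past.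

The powers of κ are absorbed by L ≥ const/μ_g³, that is, γκ³ = O(1) (`smoothConst_ge`). The bias due
to y is then of order κ_L γ κ⁴ Ry = O(κ_L κ Ry), and the variance due to z of order γ Rz; the
prescribed batch sizes make both a small multiple of ε (`CoefficientBounds.noise_le`).

To close the loop, the warm-start errors of the next iteration are bounded crudely, by a polynomial
in κκ_L times the present energy (`inner_error_le`). The Lyapunov function is V + κ_L⁻¹(√ρ_A Yo +
√ρ_B Zo). Of ρ = √ρ·√ρ, one root is the weight and the other beats the polynomial, because T, N ≥
cκℓ makes it at most exp(−cℓ/8). The energy contracts by 1 − δ/4 ≤ 1 − 1/(4κ_L) towards ε/2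
(`energy_succ_le`), so O(κ_L (1 ∨ log(E₀/ε))) iterations suffice. It remains to multiply by the cost
of one iteration (`complexity_le`). -/

theorem hasDerivAt_line {h : E → ℝ} {G : E → E} (hG : ∀ x, HasGradientAt h (G x) x) (x d : E)
    (t : ℝ) : HasDerivAt (fun t : ℝ => h (x + t • d)) (inner ℝ (G (x + t • d)) d) t := by
  have h1 : HasDerivAt (fun t : ℝ => x + t • d) d t := by
    simpa using ((hasDerivAt_id t).smul_const d).const_add x
  exact ((hG (x + t • d)).hasFDerivAt.comp_hasDerivAt t h1).congr_deriv (by simp)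

/-- On the segment, the difference between h and its quadratic upper bound has a nonpositive
derivative by Cauchy–Schwarz. Monotonicity replaces integration of the gradient. -/
theorem le_of_lipschitz_gradient {h : E → ℝ} {G : E → E} {L : ℝ}
    (hG : ∀ x, HasGradientAt h (G x) x) (hL : ∀ x y, ‖G x - G y‖ ≤ L * ‖x - y‖) (x y : E) :
    h y ≤ h x + inner ℝ (G x) (y - x) + L / 2 * ‖y - x‖ ^ 2 := by
  set d := y - x with hd
  set φ : ℝ → ℝ := fun t => h (x + t • d) - t * inner ℝ (G x) d - L / 2 * ‖d‖ ^ 2 * t ^ 2 with hφ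
  have hder : ∀ t, HasDerivAt φ
      (inner ℝ (G (x + t • d)) d - inner ℝ (G x) d - L / 2 * ‖d‖ ^ 2 * (2 * t)) t := by
    intro t
    exact (((hasDerivAt_line hG x d t).sub
      ((hasDerivAt_id t).mul_const (inner ℝ (G x) d))).sub
      ((hasDerivAt_pow 2 t).const_mul (L / 2 * ‖d‖ ^ 2))).congr_deriv (by simp)
  have hanti : AntitoneOn φ (Icc 0 1) := by
    refine antitoneOn_of_deriv_nonpos (convex_Icc 0 1)
      (fun t _ => (hder t).continuousAt.continuousWithinAt)
      (fun t _ => (hder t).differentiableAt.differentiableWithinAt) ?_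
    intro t ht
    rw [interior_Icc] at ht
    rw [(hder t).deriv]
    have h1 : inner ℝ (G (x + t • d)) d - inner ℝ (G x) d ≤ L * (t * ‖d‖) * ‖d‖ := by
      rw [← inner_sub_left]
      refine (real_inner_le_norm _ _).trans (mul_le_mul_of_nonneg_right ?_ (norm_nonneg _))
      refine (hL _ _).trans_eq ?_
      rw [add_sub_cancel_left, norm_smul, Real.norm_of_nonneg ht.1.le]
    nlinarith
  have := hanti (left_mem_Icc.2 zero_le_one) (right_mem_Icc.2 zero_le_one) zero_le_one
  simp only [hφ, zero_smul, one_smul, add_zero, zero_mul, one_mul, one_pow, mul_one] at this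
  rw [hd, add_sub_cancel, ← hd] at this
  norm_num at this
  linarith

/-- Divide the strong convexity inequality on the segment from x to y by t and let t tend to 0 from
the right. A gradient is needed only at x. -/
theorem StrongConvexOn.le_of_hasGradientAt {h : E → ℝ} {m : ℝ} {x v : E}
    (hh : StrongConvexOn univ m h) (hG : HasGradientAt h v x) (y : E) :
    h x + inner ℝ v (y - x) + m / 2 * ‖y - x‖ ^ 2 ≤ h y := by
  have h1 : HasDerivAt (fun t : ℝ => h (x + t • (y - x))) (inner ℝ v (y - x)) 0 := by
    have h1 : HasDerivAt (fun t : ℝ => x + t • (y - x)) (y - x) 0 := by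
      simpa using ((hasDerivAt_id (0 : ℝ)).smul_const (y - x)).const_add x
    have hG' : HasFDerivAt h (InnerProductSpace.toDual ℝ E v) (x + (0 : ℝ) • (y - x)) := by
      simpa using hG.hasFDerivAt
    exact (hG'.comp_hasDerivAt (0 : ℝ) h1).congr_deriv (by simp)
  have h2 : Tendsto (fun t : ℝ => t⁻¹ * (h (x + t • (y - x)) - h x)) (𝓝[>] 0)
      (𝓝 (inner ℝ v (y - x))) := by
    have := h1.tendsto_slope_zero_right
    simpa using this
  have h3 : Tendsto (fun t : ℝ => h y - h x - (1 - t) * (m / 2 * ‖y - x‖ ^ 2)) (𝓝[>] 0)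
      (𝓝 (h y - h x - (1 - 0) * (m / 2 * ‖y - x‖ ^ 2))) := by
    have : Continuous (fun t : ℝ => h y - h x - (1 - t) * (m / 2 * ‖y - x‖ ^ 2)) := by fun_prop
    exact (this.tendsto 0).mono_left nhdsWithin_le_nhds
  have h4 := le_of_tendsto_of_tendsto h2 h3 (by
    have h5 : Ioo (0 : ℝ) 1 ∈ 𝓝[>] (0 : ℝ) := Ioo_mem_nhdsGT zero_lt_one
    filter_upwards [h5] with t ht
    have h6 := hh.2 (mem_univ x) (mem_univ y) (sub_nonneg.2 ht.2.le) ht.1.le (by ring)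
    have h7 : (1 - t) • x + t • y = x + t • (y - x) := by
      rw [sub_smul, smul_sub, one_smul]; abel
    rw [h7, norm_sub_rev x y] at h6
    simp only [smul_eq_mul] at h6
    rw [inv_mul_le_iff₀ ht.1]
    nlinarith)
  linarith

theorem StrongConvexOn.inner_gradient_sub_ge {h : E → ℝ} {G : E → E} {m : ℝ}
    (hh : StrongConvexOn univ m h) (hG : ∀ x, HasGradientAt h (G x) x) (x y : E) :
    m * ‖x - y‖ ^ 2 ≤ inner ℝ (G x - G y) (x - y) := by
  have h1 := StrongConvexOn.le_of_hasGradientAt hh (hG x) y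
  have h2 := StrongConvexOn.le_of_hasGradientAt hh (hG y) x
  rw [norm_sub_rev y x, ← neg_sub x y, inner_neg_right] at h1
  rw [inner_sub_left]
  linarith

/-- The quadratic lower bound at 0 dominates its linear term outside the ball of radius 2‖v‖/m, so h
≥ h 0 off a compact set. -/
theorem StrongConvexOn.exists_isMinOn [FiniteDimensional ℝ E] {h : E → ℝ} {m : ℝ} (hm : 0 < m)
    (hh : StrongConvexOn univ m h) {v : E} (hG : HasGradientAt h v 0) (hc : Continuous h) :
    ∃ x, IsMinOn h univ x := by
  have hev : ∀ᶠ y in cocompact E, h 0 ≤ h y := by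
    filter_upwards [(tendsto_norm_cocompact_atTop (E := E)).eventually_ge_atTop (2 * ‖v‖ / m)]
      with y hy
    have h1 := StrongConvexOn.le_of_hasGradientAt hh hG y
    rw [sub_zero] at h1
    have h2 := neg_le_of_abs_le (abs_real_inner_le_norm v y)
    rw [div_le_iff₀ hm] at hy
    nlinarith [norm_nonneg y]
  obtain ⟨x, hx⟩ := hc.exists_forall_le' 0 hev
  exact ⟨x, fun y _ => hx y⟩

/-- A gradient step of length `1 / L` contracts the squared distance to the minimizer. -/
theorem norm_gradient_step_sub_sq_le {h : E → ℝ} {G : E → E} {m L : ℝ} (hL0 : 0 < L)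
    (hh : StrongConvexOn univ m h) (hG : ∀ x, HasGradientAt h (G x) x)
    (hL : ∀ x y, ‖G x - G y‖ ≤ L * ‖x - y‖) {x₀ : E} (hx₀ : IsMinOn h univ x₀) (x : E) :
    ‖x - (1 / L) • G x - x₀‖ ^ 2 ≤ (1 - 1 / L * m) * ‖x - x₀‖ ^ 2 := by
  -- The value at the new point lies between h x₀ and h x − ‖G x‖²/(2L), and strong convexity at x
  -- bounds h x₀ from below. Together these bound ⟨G x, x − x₀⟩ so well that the terms in ‖G x‖²
  -- cancel exactly for the step 1/L.
  have h1 := le_of_lipschitz_gradient hG hL x (x - (1 / L) • G x)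
  have h2 : h x₀ ≤ h (x - (1 / L) • G x) := hx₀ (mem_univ _)
  have h3 := StrongConvexOn.le_of_hasGradientAt hh (hG x) x₀
  rw [sub_sub_cancel_left, inner_neg_right, norm_neg, norm_smul, inner_smul_right,
    real_inner_self_eq_norm_sq, Real.norm_of_nonneg (by positivity)] at h1
  have h4 : ‖x - (1 / L) • G x - x₀‖ ^ 2 = ‖x - x₀‖ ^ 2 + 2 * (1 / L) * inner ℝ (G x) (x₀ - x)
      + (1 / L) ^ 2 * ‖G x‖ ^ 2 := by
    rw [sub_right_comm, norm_sub_sq_real, norm_smul, inner_smul_right,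
      Real.norm_of_nonneg (by positivity), real_inner_comm, ← neg_sub x x₀, inner_neg_right]
    ring
  rw [norm_sub_rev x₀ x] at h3
  rw [h4]
  have h5 : L / 2 * (1 / L * ‖G x‖) ^ 2 = 1 / L * ‖G x‖ ^ 2 / 2 := by field_simp
  rw [h5] at h1
  have h6 : 0 < 1 / L := by positivity
  nlinarith

end Convex

/-! ### Symmetric operators between two bounds -/

section Operator

variable {E : Type*} [NormedAddCommGroup E] [InnerProductSpace ℝ E]

/-- A symmetric coercive operator bounded by `L`. -/
structure IsElliptic (A : E →L[ℝ] E) (m L : ℝ) : Prop where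
  symm : ∀ u v, inner ℝ (A u) v = inner ℝ u (A v)
  coercive : ∀ v, m * ‖v‖ ^ 2 ≤ inner ℝ (A v) v
  norm_le : ∀ v, ‖A v‖ ≤ L * ‖v‖

namespace IsElliptic

variable {A : E →L[ℝ] E} {m L : ℝ}

theorem norm_ge (hA : IsElliptic A m L) (v : E) : m * ‖v‖ ≤ ‖A v‖ := by
  rcases eq_or_ne v 0 with rfl | hv
  · simp
  have h0 : 0 < ‖v‖ := norm_pos_iff.2 hv
  have h1 := (hA.coercive v).trans (real_inner_le_norm _ _)
  refine le_of_mul_le_mul_right (a := ‖v‖) ?_ h0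
  linarith [sq ‖v‖, mul_assoc m ‖v‖ ‖v‖, h1]

/-- This is A² ≤ L A for a symmetric positive operator bounded by L: expand the nonnegative form ⟨A
w, w⟩ at w = v − A v / L. -/
theorem norm_sq_le (hA : IsElliptic A m L) (hm : 0 ≤ m) (hL : 0 < L) (v : E) :
    ‖A v‖ ^ 2 ≤ L * inner ℝ (A v) v := by
  have h1 : 0 ≤ inner ℝ (A (v - (1 / L) • A v)) (v - (1 / L) • A v) :=
    le_trans (by positivity) (hA.coercive _)
  have h2 : inner ℝ (A (A v)) (A v) ≤ L * ‖A v‖ ^ 2 := by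
    refine (real_inner_le_norm _ _).trans ?_
    nlinarith [hA.norm_le (A v), norm_nonneg (A v)]
  have h3 : inner ℝ (A (v - (1 / L) • A v)) (v - (1 / L) • A v)
      = inner ℝ (A v) v - 2 * (1 / L) * ‖A v‖ ^ 2 + (1 / L) ^ 2 * inner ℝ (A (A v)) (A v) := by
    simp only [map_sub, map_smul, inner_sub_left, inner_sub_right, inner_smul_left,
      inner_smul_right, real_inner_self_eq_norm_sq, hA.symm (A v) v]
    simp; ring
  rw [h3] at h1
  have h4 : (1 / L) ^ 2 * inner ℝ (A (A v)) (A v) ≤ 1 / L * ‖A v‖ ^ 2 := by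
    calc _ ≤ (1 / L) ^ 2 * (L * ‖A v‖ ^ 2) := by gcongr
      _ = _ := by field_simp
  have h5 : 1 / L * ‖A v‖ ^ 2 ≤ inner ℝ (A v) v := by linarith
  rw [one_div, inv_mul_le_iff₀ hL] at h5
  exact h5

/-- For β = 1/(2L) the term β²‖A v‖² eats only a quarter of the gain 2β⟨A v, v⟩, which leaves the
factor 3/2. The surplus over the rate βm/2 pays for the two noises of the stochastic run. -/
theorem norm_sub_smul_sq_le (hA : IsElliptic A m L) (hm : 0 ≤ m) (hL : 0 < L) (v : E) :
    ‖v - (1 / (2 * L)) • A v‖ ^ 2 ≤ (1 - 3 / 2 * (1 / (2 * L) * m)) * ‖v‖ ^ 2 := by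
  have h1 := hA.norm_sq_le hm hL v
  have h2 := hA.coercive v
  rw [norm_sub_sq_real, norm_smul, inner_smul_right, Real.norm_of_nonneg (by positivity),
    real_inner_comm]
  have h3 : (1 / (2 * L) * ‖A v‖) ^ 2 ≤ 1 / (2 * L) / 2 * inner ℝ (A v) v := by
    calc _ = (1 / (2 * L)) ^ 2 * ‖A v‖ ^ 2 := by ring
      _ ≤ (1 / (2 * L)) ^ 2 * (L * inner ℝ (A v) v) := by gcongr
      _ = _ := by field_simp
  have h4 : 0 < 1 / (2 * L) := by positivity
  nlinarith

theorem exists_solution [FiniteDimensional ℝ E] (hA : IsElliptic A m L) (hm : 0 < m) (v : E) :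
    ∃ z, A z + v = 0 := by
  have hinj : Function.Injective (A : E →ₗ[ℝ] E) := by
    refine (injective_iff_map_eq_zero _).2 fun a ha => ?_
    have h1 := hA.norm_ge a
    have h2 : A a = 0 := ha
    rw [h2, norm_zero] at h1
    have : ‖a‖ ≤ 0 := by nlinarith [norm_nonneg a]
    exact norm_le_zero_iff.1 this
  obtain ⟨z, hz⟩ := LinearMap.injective_iff_surjective.1 hinj (-v)
  refine ⟨z, ?_⟩
  have : A z = -v := hz
  rw [this, neg_add_cancel]

end IsElliptic

end Operator

/-! ### Partial derivatives -/

section Partial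

variable {X Y : Type*}
  [NormedAddCommGroup X] [InnerProductSpace ℝ X] [CompleteSpace X]
  [NormedAddCommGroup Y] [InnerProductSpace ℝ Y] [CompleteSpace Y]

/-- A function of two variables is twice differentiable. -/
structure TwiceDifferentiable (h : X → Y → ℝ) : Prop where
  one : Differentiable ℝ (fun p : X × Y => h p.1 p.2)
  two : Differentiable ℝ (fderiv ℝ (fun p : X × Y => h p.1 p.2))

variable {h : X → Y → ℝ}

theorem hasGradientAt_gradX (hd : Differentiable ℝ (fun p : X × Y => h p.1 p.2)) (x : X) (y : Y) :
    HasGradientAt (fun x' => h x' y) (gradX h x y) x := by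
  have h1 : Differentiable ℝ (fun x' : X => ((x', y) : X × Y)) := by fun_prop
  exact ((hd.comp h1) x).hasGradientAt

theorem hasGradientAt_gradY (hd : Differentiable ℝ (fun p : X × Y => h p.1 p.2)) (x : X) (y : Y) :
    HasGradientAt (h x) (gradY h x y) y := by
  have h1 : Differentiable ℝ (fun y' : Y => ((x, y') : X × Y)) := by fun_prop
  exact ((hd.comp h1) y).hasGradientAt

/-- The Riesz isomorphism of a real Hilbert space as a linear equivalence. -/
def riesz (Y : Type*) [NormedAddCommGroup Y] [InnerProductSpace ℝ Y] [CompleteSpace Y] :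
    Y ≃L[ℝ] StrongDual ℝ Y where
  toFun := InnerProductSpace.toDual ℝ Y
  invFun := (InnerProductSpace.toDual ℝ Y).symm
  left_inv := (InnerProductSpace.toDual ℝ Y).left_inv
  right_inv := (InnerProductSpace.toDual ℝ Y).right_inv
  map_add' := map_add _
  map_smul' c v := by simp
  continuous_toFun := (InnerProductSpace.toDual ℝ Y).continuous
  continuous_invFun := (InnerProductSpace.toDual ℝ Y).symm.continuous

theorem gradX_eq (hd : Differentiable ℝ (fun p : X × Y => h p.1 p.2)) (x : X) (y : Y) :
    gradX h x y = (InnerProductSpace.toDual ℝ X).symm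
      ((fderiv ℝ (fun p : X × Y => h p.1 p.2) (x, y)).comp (ContinuousLinearMap.inl ℝ X Y)) := by
  refine (hasFDerivAt_iff_hasGradientAt.1 ?_).gradient
  have h1 := HasFDerivAt.comp (g := fun p : X × Y => h p.1 p.2) x (hd (x, y)).hasFDerivAt
    (hasFDerivAt_prodMk_left (𝕜 := ℝ) x y)
  exact h1

theorem gradY_eq (hd : Differentiable ℝ (fun p : X × Y => h p.1 p.2)) (x : X) (y : Y) :
    gradY h x y = (InnerProductSpace.toDual ℝ Y).symm
      ((fderiv ℝ (fun p : X × Y => h p.1 p.2) (x, y)).comp (ContinuousLinearMap.inr ℝ X Y)) := by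
  refine (hasFDerivAt_iff_hasGradientAt.1 ?_).gradient
  have h1 := HasFDerivAt.comp (g := fun p : X × Y => h p.1 p.2) y (hd (x, y)).hasFDerivAt
    (hasFDerivAt_prodMk_right (𝕜 := ℝ) x y)
  exact h1

theorem hasFDerivAt_uncurry (hd : Differentiable ℝ (fun p : X × Y => h p.1 p.2)) (x : X) (y : Y) :
    HasFDerivAt (fun p : X × Y => h p.1 p.2)
      ((InnerProductSpace.toDual ℝ X (gradX h x y)).comp (ContinuousLinearMap.fst ℝ X Y) +
        (InnerProductSpace.toDual ℝ Y (gradY h x y)).comp (ContinuousLinearMap.snd ℝ X Y))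
      (x, y) := by
  convert (hd (x, y)).hasFDerivAt using 1
  rw [gradX_eq hd, gradY_eq hd, LinearIsometryEquiv.apply_symm_apply,
    LinearIsometryEquiv.apply_symm_apply]
  ext v <;> simp <;> exact map_zero _

namespace TwiceDifferentiable

theorem differentiable_gradY (hh : TwiceDifferentiable h) :
    Differentiable ℝ (fun p : X × Y => gradY h p.1 p.2) := by
  have h1 : (fun p : X × Y => gradY h p.1 p.2) = fun p =>
      (InnerProductSpace.toDual ℝ Y).symm
      ((fderiv ℝ (fun p : X × Y => h p.1 p.2) p).comp (ContinuousLinearMap.inr ℝ X Y)) := by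
    funext p; exact gradY_eq hh.one p.1 p.2
  rw [h1]
  have h2 := hh.two
  have h3 : Differentiable ℝ fun p : X × Y =>
      (fderiv ℝ (fun p : X × Y => h p.1 p.2) p).comp (ContinuousLinearMap.inr ℝ X Y) :=
    fun p => (h2 p).clm_comp (differentiableAt_const _)
  intro p
  have h4 : Differentiable ℝ (InnerProductSpace.toDual ℝ Y).symm :=
    (riesz Y).symm.differentiable
  exact (h4 _).comp p (h3 p)

theorem hasFDerivAt_gradY_right (hh : TwiceDifferentiable h) (x : X) (y : Y) :
    HasFDerivAt (fun y' => gradY h x y') (hessYY h x y) y := by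
  have h1 : Differentiable ℝ (fun y' : Y => ((x, y') : X × Y)) := by fun_prop
  exact ((hh.differentiable_gradY.comp h1) y).hasFDerivAt

theorem hasFDerivAt_gradY_left (hh : TwiceDifferentiable h) (x : X) (y : Y) :
    HasFDerivAt (fun x' => gradY h x' y) (ContinuousLinearMap.adjoint (hessXY h x y)) x := by
  have h1 : Differentiable ℝ (fun x' : X => ((x', y) : X × Y)) := by fun_prop
  rw [hessXY, ContinuousLinearMap.adjoint_adjoint]
  exact ((hh.differentiable_gradY.comp h1) x).hasFDerivAt

theorem hasFDerivAt_gradY (hh : TwiceDifferentiable h) (x : X) (y : Y) :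
    HasFDerivAt (fun p : X × Y => gradY h p.1 p.2)
      ((ContinuousLinearMap.adjoint (hessXY h x y)).comp (ContinuousLinearMap.fst ℝ X Y) +
        (hessYY h x y).comp (ContinuousLinearMap.snd ℝ X Y)) (x, y) := by
  have h0 := (hh.differentiable_gradY (x, y)).hasFDerivAt
  have h1' := HasFDerivAt.comp (g := fun p : X × Y => gradY h p.1 p.2) x h0
    (hasFDerivAt_prodMk_left (𝕜 := ℝ) x y)
  have h2' := HasFDerivAt.comp (g := fun p : X × Y => gradY h p.1 p.2) y h0
    (hasFDerivAt_prodMk_right (𝕜 := ℝ) x y)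
  have h1 := (hh.hasFDerivAt_gradY_left x y).unique h1'
  have h2 := (hh.hasFDerivAt_gradY_right x y).unique h2'
  rw [h1, h2]
  convert h0 using 1
  ext v <;> simp <;> exact map_zero _

/-- Symmetry of the second derivative, carried over by the Riesz isomorphism; no continuity of the
Hessian is needed. -/
theorem hessYY_symm (hh : TwiceDifferentiable h) (x : X) (y u v : Y) :
    inner ℝ (hessYY h x y u) v = inner ℝ u (hessYY h x y v) := by
  have h1 : ∀ y', HasFDerivAt (h x) (InnerProductSpace.toDual ℝ Y (gradY h x y')) y' :=
    fun y' => (hasGradientAt_gradY hh.one x y').hasFDerivAt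
  have h4 : HasFDerivAt (fun y' => InnerProductSpace.toDual ℝ Y (gradY h x y'))
      ((riesz Y : Y →L[ℝ] StrongDual ℝ Y).comp (hessYY h x y)) y :=
    (riesz Y).hasFDerivAt.comp y (hh.hasFDerivAt_gradY_right x y)
  have h5 := second_derivative_symmetric h1 h4 u v
  have h6 : inner ℝ (hessYY h x y u) v = inner ℝ (hessYY h x y v) u := h5
  rw [h6, real_inner_comm]

end TwiceDifferentiable

/-! ### Batch averages -/

variable {Ξ : Type*} {n : ℕ} {hhat : Ξ → X → Y → ℝ}

/-- These averaging formulas reduce the joint measurability of the batch estimators to that of the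
derivatives for a single sample. -/
theorem gradX_batchAvg (hd : ∀ ξ, Differentiable ℝ (fun p : X × Y => hhat ξ p.1 p.2))
    (D : Fin n → Ξ) (x : X) (y : Y) :
    gradX (batchAvg hhat D) x y = (n : ℝ)⁻¹ • ∑ i, gradX (hhat (D i)) x y := by
  refine HasGradientAt.gradient (hasGradientAt_iff_hasFDerivAt.2 ?_)
  rw [map_smul, map_sum]
  have h1 := HasFDerivAt.fun_sum (u := Finset.univ)
    (fun i _ => (hasGradientAt_gradX (hd (D i)) x y).hasFDerivAt)
  exact h1.const_smul ((n : ℝ)⁻¹)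

theorem gradY_batchAvg (hd : ∀ ξ, Differentiable ℝ (fun p : X × Y => hhat ξ p.1 p.2))
    (D : Fin n → Ξ) (x : X) (y : Y) :
    gradY (batchAvg hhat D) x y = (n : ℝ)⁻¹ • ∑ i, gradY (hhat (D i)) x y := by
  refine HasGradientAt.gradient (hasGradientAt_iff_hasFDerivAt.2 ?_)
  rw [map_smul, map_sum]
  have h1 := HasFDerivAt.fun_sum (u := Finset.univ)
    (fun i _ => (hasGradientAt_gradY (hd (D i)) x y).hasFDerivAt)
  exact h1.const_smul ((n : ℝ)⁻¹)

theorem hessYY_batchAvg (hd : ∀ ξ, TwiceDifferentiable (hhat ξ)) (D : Fin n → Ξ) (x : X) (y : Y) :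
    hessYY (batchAvg hhat D) x y = (n : ℝ)⁻¹ • ∑ i, hessYY (hhat (D i)) x y := by
  have h0 : (fun y' => gradY (batchAvg hhat D) x y') =
      fun y' => (n : ℝ)⁻¹ • ∑ i, gradY (hhat (D i)) x y' :=
    funext fun y' => gradY_batchAvg (fun ξ => (hd ξ).one) D x y'
  rw [hessYY, h0]
  refine HasFDerivAt.fderiv ?_
  have h1 := HasFDerivAt.fun_sum (u := Finset.univ)
    (fun i _ => (hd (D i)).hasFDerivAt_gradY_right x y)
  exact h1.const_smul ((n : ℝ)⁻¹)

theorem hessXY_batchAvg (hd : ∀ ξ, TwiceDifferentiable (hhat ξ)) (D : Fin n → Ξ) (x : X) (y : Y) :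
    hessXY (batchAvg hhat D) x y = (n : ℝ)⁻¹ • ∑ i, hessXY (hhat (D i)) x y := by
  have h0 : (fun x' => gradY (batchAvg hhat D) x' y) =
      fun x' => (n : ℝ)⁻¹ • ∑ i, gradY (hhat (D i)) x' y :=
    funext fun x' => gradY_batchAvg (fun ξ => (hd ξ).one) D x' y
  have h1 := HasFDerivAt.fun_sum (u := Finset.univ)
    (fun i _ => (hd (D i)).hasFDerivAt_gradY_left x y)
  have h2 := (h1.const_smul ((n : ℝ)⁻¹)).fderiv
  rw [hessXY, h0]
  have h3 : fderiv ℝ (fun x' => (n : ℝ)⁻¹ • ∑ i, gradY (hhat (D i)) x' y) x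
      = ContinuousLinearMap.adjoint ((n : ℝ)⁻¹ • ∑ i, hessXY (hhat (D i)) x y) := by
    rw [map_smulₛₗ, map_sum]
    simp only [conj_trivial]
    exact h2
  rw [h3, ContinuousLinearMap.adjoint_adjoint]

end Partial

/-! ### The bilevel problem -/

section Bilevel

variable {X Y : Type*}
  [NormedAddCommGroup X] [InnerProductSpace ℝ X] [CompleteSpace X]
  [NormedAddCommGroup Y] [InnerProductSpace ℝ Y] [CompleteSpace Y]

theorem norm_le_pair {a : X} {b : Y} : ‖a‖ ≤ ‖(WithLp.toLp 2 (a, b) : WithLp 2 (X × Y))‖ := by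
  rw [WithLp.prod_norm_eq_of_L2]
  exact Real.le_sqrt_of_sq_le (by simp)

theorem norm_le_pair' {a : X} {b : Y} : ‖b‖ ≤ ‖(WithLp.toLp 2 (a, b) : WithLp 2 (X × Y))‖ := by
  rw [WithLp.prod_norm_eq_of_L2]
  exact Real.le_sqrt_of_sq_le (by simp)

theorem pairDist_sq (x : X) (y : Y) (x' : X) (y' : Y) :
    pairDist x y x' y' ^ 2 = ‖x - x'‖ ^ 2 + ‖y - y'‖ ^ 2 := by
  rw [pairDist, WithLp.prod_norm_sq_eq_of_L2]; rfl

theorem pairDist_nonneg (x : X) (y : Y) (x' : X) (y' : Y) : 0 ≤ pairDist x y x' y' := norm_nonneg _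

theorem pairDist_le (x : X) (y : Y) (x' : X) (y' : Y) :
    pairDist x y x' y' ≤ ‖x - x'‖ + ‖y - y'‖ := by
  refine abs_le_of_sq_le_sq' ?_ (by positivity) |>.2
  rw [pairDist_sq]
  nlinarith [norm_nonneg (x - x'), norm_nonneg (y - y')]

theorem pairDist_same_left (x : X) (y y' : Y) : pairDist x y x y' = ‖y - y'‖ := by
  refine (pow_left_inj₀ (pairDist_nonneg _ _ _ _) (norm_nonneg _) two_ne_zero).1 ?_
  rw [pairDist_sq]; simp

/-- The estimate `∂ₓf(x, y) + ∂_xy g(x, y) z` of the gradient of the outer loss. -/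
def hyperGrad (f g : X → Y → ℝ) (x : X) (y z : Y) : X := gradX f x y + hessXY g x y z

/-- The gradient of the outer loss. -/
def lossGrad (f g : X → Y → ℝ) (x : X) : X :=
  hyperGrad f g x (innerSol g x) (linSol f g x (innerSol g x))

namespace BilevelAssumptions

variable {f g : X → Y → ℝ} {Lf B Mg Lg' Lg μg : ℝ}

theorem twice (H : BilevelAssumptions f g Lf B Mg Lg' Lg μg) : TwiceDifferentiable g :=
  ⟨H.g_differentiable, H.g_twice_differentiable⟩

theorem hasGradientAt_g (H : BilevelAssumptions f g Lf B Mg Lg' Lg μg) (x : X) (y : Y) :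
    HasGradientAt (g x) (gradY g x y) y := hasGradientAt_gradY H.g_differentiable x y

theorem gradX_lipschitz (H : BilevelAssumptions f g Lf B Mg Lg' Lg μg) (x : X) (y : Y) (x' : X)
    (y' : Y) : ‖gradX f x y - gradX f x' y'‖ ≤ Lf * pairDist x y x' y' :=
  (norm_le_pair (b := gradY f x y - gradY f x' y')).trans (H.f_smooth x y x' y')

theorem gradY_lipschitz (H : BilevelAssumptions f g Lf B Mg Lg' Lg μg) (x : X) (y : Y) (x' : X)
    (y' : Y) : ‖gradY f x y - gradY f x' y'‖ ≤ Lf * pairDist x y x' y' :=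
  (norm_le_pair' (a := gradX f x y - gradX f x' y')).trans (H.f_smooth x y x' y')

theorem monotone_gradY (H : BilevelAssumptions f g Lf B Mg Lg' Lg μg) (x : X) (y y' : Y) :
    μg * ‖y - y'‖ ^ 2 ≤ inner ℝ (gradY g x y - gradY g x y') (y - y') :=
  StrongConvexOn.inner_gradient_sub_ge (H.g_strongConvex x) (H.hasGradientAt_g x) y y'

theorem norm_hessYY_le (H : BilevelAssumptions f g Lf B Mg Lg' Lg μg) (hLg : 0 < Lg) (x : X)
    (y : Y) : ‖hessYY g x y‖ ≤ Lg := by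
  refine (H.twice.hasFDerivAt_gradY_right x y).le_of_lip' hLg.le (Eventually.of_forall ?_)
  intro y'
  exact H.g_smooth x y' y

theorem norm_hessXY_le (H : BilevelAssumptions f g Lf B Mg Lg' Lg μg) (hLg' : 0 < Lg') (x : X)
    (y : Y) : ‖hessXY g x y‖ ≤ Lg' := by
  have h1 : ‖ContinuousLinearMap.adjoint (hessXY g x y)‖ ≤ Lg' := by
    refine (H.twice.hasFDerivAt_gradY_left x y).le_of_lip' hLg'.le (Eventually.of_forall ?_)
    intro x'
    exact H.g_y_lipschitz x' x y
  rwa [LinearIsometryEquiv.norm_map] at h1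

theorem isElliptic_hessYY (H : BilevelAssumptions f g Lf B Mg Lg' Lg μg) (hLg : 0 < Lg) (x : X)
    (y : Y) : IsElliptic (hessYY g x y) μg Lg where
  symm := H.twice.hessYY_symm x y
  norm_le v := (hessYY g x y).le_of_opNorm_le (H.norm_hessYY_le hLg x y) v
  coercive v := by
    have h1 : HasDerivAt (fun t : ℝ => y + t • v) v 0 := by
      simpa using ((hasDerivAt_id (0 : ℝ)).smul_const v).const_add y
    have h2 : HasFDerivAt (fun y' => gradY g x y') (hessYY g x y) (y + (0 : ℝ) • v) := by
      simpa using H.twice.hasFDerivAt_gradY_right x y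
    have h3 : HasDerivAt (fun t : ℝ => gradY g x (y + t • v)) (hessYY g x y v) 0 :=
      h2.comp_hasDerivAt (0 : ℝ) h1
    have h4 := h3.tendsto_slope_zero_right
    simp only [zero_add, zero_smul, add_zero] at h4
    have h5 := h4.inner (tendsto_const_nhds (x := v)) (𝕜 := ℝ)
    refine ge_of_tendsto h5 ?_
    filter_upwards [self_mem_nhdsWithin] with t ht
    have ht : 0 < t := ht
    have h6 := H.monotone_gradY x (y + t • v) y
    rw [add_sub_cancel_left, norm_smul, inner_smul_right, Real.norm_of_nonneg ht.le] at h6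
    rw [inner_smul_left]
    have h7 : t * (μg * ‖v‖ ^ 2 * t) ≤ t * inner ℝ (gradY g x (y + t • v) - gradY g x y) v := by
      linarith
    have h8 := le_of_mul_le_mul_left h7 ht
    have : (starRingEnd ℝ) t⁻¹ = t⁻¹ := rfl
    rw [this, inv_mul_eq_div, le_div_iff₀ ht]
    exact h8

/-! #### The inner solution -/

theorem isMinOn_innerSol [FiniteDimensional ℝ Y] (H : BilevelAssumptions f g Lf B Mg Lg' Lg μg)
    (hμg : 0 < μg) (x : X) : IsMinOn (g x) univ (innerSol g x) := by
  refine Classical.epsilon_spec (p := fun y => IsMinOn (g x) univ y) ?_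
  refine StrongConvexOn.exists_isMinOn hμg (H.g_strongConvex x) (H.hasGradientAt_g x 0) ?_
  exact continuous_iff_continuousAt.2 fun y => (H.hasGradientAt_g x y).continuousAt

theorem gradY_innerSol [FiniteDimensional ℝ Y] (H : BilevelAssumptions f g Lf B Mg Lg' Lg μg)
    (hμg : 0 < μg) (x : X) : gradY g x (innerSol g x) = 0 := by
  have h1 := (H.isMinOn_innerSol hμg x).isLocalMin univ_mem
  have h2 := h1.hasFDerivAt_eq_zero (H.hasGradientAt_g x (innerSol g x)).hasFDerivAt
  simpa using h2

/-- Compare the strong monotonicity of ∂_y g(x, ·) between y⋆(x) and y⋆(x') with the change of ∂_y g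
in x at the fixed point y⋆(x'), where it vanishes for x'. -/
theorem innerSol_lipschitz [FiniteDimensional ℝ Y] (H : BilevelAssumptions f g Lf B Mg Lg' Lg μg)
    (hμg : 0 < μg) (x x' : X) : ‖innerSol g x - innerSol g x'‖ ≤ Lg' / μg * ‖x - x'‖ := by
  set d := innerSol g x - innerSol g x' with hd
  rcases eq_or_ne d 0 with h0 | h0
  -- The sign of `Lg'` is not among the hypotheses; it is read off from the Lipschitz bound at two
  -- distinct points.
  · rw [h0, norm_zero]
    by_cases hx : ‖x - x'‖ = 0
    · simp [hx]
    have h1 := (norm_nonneg _).trans (H.g_y_lipschitz x x' 0)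
    have h2 : 0 < ‖x - x'‖ := lt_of_le_of_ne (norm_nonneg _) (Ne.symm hx)
    have h3 : 0 ≤ Lg' := nonneg_of_mul_nonneg_left h1 h2
    positivity
  have hd0 : 0 < ‖d‖ := norm_pos_iff.2 h0
  have h1 := H.monotone_gradY x (innerSol g x) (innerSol g x')
  rw [H.gradY_innerSol hμg x, ← hd] at h1
  have h2 := H.g_y_lipschitz x' x (innerSol g x')
  rw [H.gradY_innerSol hμg x', norm_sub_rev x' x] at h2
  have h3 := h1.trans (real_inner_le_norm _ _)
  have h4 : (μg * ‖d‖) * ‖d‖ ≤ (Lg' * ‖x - x'‖) * ‖d‖ := by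
    nlinarith
  have h5 := le_of_mul_le_mul_right h4 hd0
  rw [div_mul_eq_mul_div, le_div_iff₀ hμg]
  linarith

theorem norm_inner_step_sq_le [FiniteDimensional ℝ Y]
    (H : BilevelAssumptions f g Lf B Mg Lg' Lg μg) (hμg : 0 < μg) (hLg : 0 < Lg) (x : X) (y : Y) :
    ‖y - (1 / Lg) • gradY g x y - innerSol g x‖ ^ 2
      ≤ (1 - 1 / Lg * μg) * ‖y - innerSol g x‖ ^ 2 :=
  norm_gradient_step_sub_sq_le hLg (H.g_strongConvex x) (H.hasGradientAt_g x) (H.g_smooth x)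
    (H.isMinOn_innerSol hμg x) y

/-- Implicit differentiation without the implicit function theorem. As y⋆ is already known to be
Lipschitz, the first-order expansion of ∂_y g along its graph has remainder o(‖x' − x‖). Both values
of ∂_y g vanish there, and ellipticity of A = ∂_yy g inverts the linear part, so that the derivative
is −A⁻¹C. -/
theorem hasFDerivAt_innerSol [FiniteDimensional ℝ Y]
    (H : BilevelAssumptions f g Lf B Mg Lg' Lg μg) (hμg : 0 < μg) (hLg : 0 < Lg) (x : X) :
    ∃ J : X →L[ℝ] Y, HasFDerivAt (innerSol g) J x ∧
      ∀ v, hessYY g x (innerSol g x) (J v) =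
        - ContinuousLinearMap.adjoint (hessXY g x (innerSol g x)) v := by
  set A := hessYY g x (innerSol g x) with hA
  set C := ContinuousLinearMap.adjoint (hessXY g x (innerSol g x)) with hC
  have hell : IsElliptic A μg Lg := H.isElliptic_hessYY hLg x _
  have hinj : Function.Injective (A : Y →ₗ[ℝ] Y) := by
    refine (injective_iff_map_eq_zero _).2 fun a ha => ?_
    have h1 := hell.norm_ge a
    have h2 : A a = 0 := ha
    rw [h2, norm_zero] at h1
    exact norm_le_zero_iff.1 (by nlinarith [norm_nonneg a])
  set e := LinearEquiv.ofInjectiveEndo (A : Y →ₗ[ℝ] Y) hinj with he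
  have hAe : ∀ v, A (e.symm v) = v := fun v => e.apply_symm_apply v
  set R : Y →L[ℝ] Y := LinearMap.toContinuousLinearMap (e.symm : Y →ₗ[ℝ] Y) with hR
  have hAR : ∀ v, A (R v) = v := hAe
  refine ⟨-(R.comp C), ?_, fun v => by simp [hAR]⟩
  have h0 := H.twice.hasFDerivAt_gradY x (innerSol g x)
  rw [hasFDerivAt_iff_isLittleO] at h0 ⊢
  have hlip : (fun x' => ((x', innerSol g x') : X × Y) - (x, innerSol g x)) =O[𝓝 x]
      fun x' => x' - x := by
    refine Asymptotics.IsBigO.of_bound (max 1 (Lg' / μg)) (Eventually.of_forall fun x' => ?_)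
    rw [Prod.mk_sub_mk, Prod.norm_mk]
    refine max_le ?_ ?_
    · exact le_mul_of_one_le_left (norm_nonneg _) (le_max_left _ _)
    · exact (H.innerSol_lipschitz hμg x' x).trans (by gcongr; exact le_max_right _ _)
  have hcont : Tendsto (fun x' => ((x', innerSol g x') : X × Y)) (𝓝 x) (𝓝 (x, innerSol g x)) := by
    rw [← tendsto_sub_nhds_zero_iff]
    refine hlip.trans_tendsto ?_
    have : Tendsto (fun x' : X => x' - x) (𝓝 x) (𝓝 (x - x)) := tendsto_id.sub_const x
    simpa using this
  have h1 := (h0.comp_tendsto hcont).trans_isBigO hlip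
  refine (Asymptotics.IsBigO.of_bound μg⁻¹ (Eventually.of_forall fun x' => ?_)).trans_isLittleO h1
  simp only [Function.comp_apply, H.gradY_innerSol hμg, Prod.mk_sub_mk,
    add_apply, ContinuousLinearMap.comp_apply, ContinuousLinearMap.coe_fst',
    ContinuousLinearMap.coe_snd', ← hA, ← hC, sub_zero, zero_sub]
  have h2 : A (innerSol g x' - innerSol g x - (-R.comp C) (x' - x))
      = C (x' - x) + A (innerSol g x' - innerSol g x) := by
    simp [hAR, map_sub]; abel
  have h3 := hell.norm_ge (innerSol g x' - innerSol g x - (-R.comp C) (x' - x))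
  rw [h2] at h3
  rw [norm_neg, inv_mul_eq_div, le_div_iff₀ hμg]
  linarith

/-! #### The linear system -/

/-- Completing the square at a solution z gives Q(w) = Q(z) + ½⟨A(w − z), w − z⟩. By coercivity z is
the only minimizer, hence the chosen one. -/
theorem linSol_eq_of_solution (H : BilevelAssumptions f g Lf B Mg Lg' Lg μg) (hμg : 0 < μg)
    (hLg : 0 < Lg) {x : X} {y z : Y} (hz : hessYY g x y z + gradY f x y = 0) :
    linSol f g x y = z := by
  have hell := H.isElliptic_hessYY hLg x y
  have key : ∀ w, quadObj f g x y w = quadObj f g x y z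
      + 1 / 2 * inner ℝ (hessYY g x y (w - z)) (w - z) := by
    intro w
    have hv : gradY f x y = - hessYY g x y z := by rw [eq_neg_iff_add_eq_zero, add_comm]; exact hz
    simp only [quadObj, hv, inner_neg_right, map_sub, inner_sub_left, inner_sub_right]
    rw [real_inner_comm w (hessYY g x y w), real_inner_comm z (hessYY g x y w),
      real_inner_comm w (hessYY g x y z), real_inner_comm z (hessYY g x y z)]
    have := hell.symm w z
    rw [real_inner_comm z (hessYY g x y w)] at *
    linarith [real_inner_comm z (hessYY g x y w)]
  have hmin : IsMinOn (quadObj f g x y) univ z := fun w _ => by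
    have h1 := hell.coercive (w - z)
    have h2 : 0 ≤ μg * ‖w - z‖ ^ 2 := by positivity
    have := key w
    simp only [mem_ofPred_eq]
    linarith
  have hspec : IsMinOn (quadObj f g x y) univ (linSol f g x y) :=
    Classical.epsilon_spec (p := fun z => IsMinOn (quadObj f g x y) univ z) ⟨z, hmin⟩
  have h1 : quadObj f g x y (linSol f g x y) ≤ quadObj f g x y z := hspec (mem_univ z)
  rw [key] at h1
  have h2 := hell.coercive (linSol f g x y - z)
  have h3 : μg * ‖linSol f g x y - z‖ ^ 2 ≤ 0 := by linarith
  have h4 : ‖linSol f g x y - z‖ ^ 2 ≤ 0 := by nlinarith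
  have h5 : ‖linSol f g x y - z‖ = 0 := by nlinarith [norm_nonneg (linSol f g x y - z)]
  exact sub_eq_zero.1 (norm_eq_zero.1 h5)

variable [FiniteDimensional ℝ Y]

theorem hessYY_linSol (H : BilevelAssumptions f g Lf B Mg Lg' Lg μg) (hμg : 0 < μg)
    (hLg : 0 < Lg) (x : X) (y : Y) : hessYY g x y (linSol f g x y) + gradY f x y = 0 := by
  obtain ⟨z, hz⟩ := (H.isElliptic_hessYY hLg x y).exists_solution hμg (gradY f x y)
  rwa [H.linSol_eq_of_solution hμg hLg hz]

theorem norm_linSol_le (H : BilevelAssumptions f g Lf B Mg Lg' Lg μg) (hμg : 0 < μg)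
    (hLg : 0 < Lg) (x : X) (y : Y) : ‖linSol f g x y‖ ≤ B / μg := by
  have h1 := (H.isElliptic_hessYY hLg x y).norm_ge (linSol f g x y)
  rw [eq_neg_of_add_eq_zero_left (H.hessYY_linSol hμg hLg x y), norm_neg] at h1
  rw [le_div_iff₀ hμg]
  linarith [H.f_bounded x y]

/-- Subtracting the two linear systems gives A(z − z') = −(∂_y f − ∂_y f') − (A − A')z'. Only ‖z'‖ ≤
B/μ_g and the lower bound for A enter. -/
theorem linSol_lipschitz (H : BilevelAssumptions f g Lf B Mg Lg' Lg μg) (hμg : 0 < μg)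
    (hLg : 0 < Lg) (hMg : 0 < Mg) (x : X) (y : Y) (x' : X) (y' : Y) :
    ‖linSol f g x y - linSol f g x' y'‖
      ≤ (Lf / μg + Mg * B / μg ^ 2) * pairDist x y x' y' := by
  set z := linSol f g x y
  set z' := linSol f g x' y'
  have h1 := (H.isElliptic_hessYY hLg x y).norm_ge (z - z')
  have h2 : hessYY g x y (z - z') = -(gradY f x y - gradY f x' y')
      - (hessYY g x y - hessYY g x' y') z' := by
    rw [map_sub, sub_apply,
      eq_neg_of_add_eq_zero_left (H.hessYY_linSol hμg hLg x y),
      eq_neg_of_add_eq_zero_left (H.hessYY_linSol hμg hLg x' y')]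
    abel
  have h3 : ‖hessYY g x y (z - z')‖ ≤ Lf * pairDist x y x' y'
      + Mg * pairDist x y x' y' * (B / μg) := by
    rw [h2]
    refine (norm_sub_le _ _).trans (add_le_add ?_ ?_)
    · rw [norm_neg]; exact H.gradY_lipschitz x y x' y'
    · refine (ContinuousLinearMap.le_opNorm _ _).trans ?_
      exact mul_le_mul (H.g_yy_lipschitz x y x' y') (H.norm_linSol_le hμg hLg x' y')
        (norm_nonneg _) (mul_nonneg hMg.le (pairDist_nonneg _ _ _ _))
  have h4 : ‖z - z'‖ ≤ (Lf * pairDist x y x' y' + Mg * pairDist x y x' y' * (B / μg)) / μg := by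
    rw [le_div_iff₀ hμg]; linarith
  refine h4.trans_eq ?_
  field_simp

/-- The intermediate point z⋆(x, y) separates the error of z in its own linear system from the
displacement of the solution of that system. Only the first is controlled by ℬ; the second is a
Lipschitz term in (x, y). -/
theorem hyperGrad_sub_le (H : BilevelAssumptions f g Lf B Mg Lg' Lg μg) (hμg : 0 < μg)
    (hLg : 0 < Lg) (hMg : 0 < Mg) (hLg' : 0 < Lg') (x : X) (y z : Y) (x' : X) (y' : Y) :
    ‖hyperGrad f g x y z - hyperGrad f g x' y' (linSol f g x' y')‖ ≤
      (Lf + Mg * B / μg + Lg' * (Lf / μg + Mg * B / μg ^ 2)) * pairDist x y x' y'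
        + Lg' * ‖z - linSol f g x y‖ := by
  set z' := linSol f g x' y'
  have h1 : hyperGrad f g x y z - hyperGrad f g x' y' z' = (gradX f x y - gradX f x' y')
      + (hessXY g x y - hessXY g x' y') z' + hessXY g x y (linSol f g x y - z')
      + hessXY g x y (z - linSol f g x y) := by
    simp only [hyperGrad, map_sub, sub_apply]; abel
  rw [h1]
  have h2 := H.gradX_lipschitz x y x' y'
  have h3 : ‖(hessXY g x y - hessXY g x' y') z'‖ ≤ Mg * pairDist x y x' y' * (B / μg) := by
    refine (ContinuousLinearMap.le_opNorm _ _).trans ?_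
    exact mul_le_mul (H.g_xy_lipschitz x y x' y') (H.norm_linSol_le hμg hLg x' y')
        (norm_nonneg _) (mul_nonneg hMg.le (pairDist_nonneg _ _ _ _))
  have h4 : ∀ w, ‖hessXY g x y w‖ ≤ Lg' * ‖w‖ := fun w =>
    (hessXY g x y).le_of_opNorm_le (H.norm_hessXY_le hLg' x y) w
  have h5 := (h4 (linSol f g x y - z')).trans
    (mul_le_mul_of_nonneg_left (H.linSol_lipschitz hμg hLg hMg x y x' y') hLg'.le)
  have h6 := h4 (z - linSol f g x y)
  refine (norm_add_le _ _).trans ?_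
  refine (add_le_add (norm_add₃_le) le_rfl).trans ?_
  refine (add_le_add (add_le_add (add_le_add h2 h3) h5) h6).trans_eq ?_
  ring

theorem hyperGrad_sub_lossGrad_le (H : BilevelAssumptions f g Lf B Mg Lg' Lg μg) (hμg : 0 < μg)
    (hLg : 0 < Lg) (hMg : 0 < Mg) (hLg' : 0 < Lg') (x : X) (y z : Y) :
    ‖hyperGrad f g x y z - lossGrad f g x‖ ≤
      (Lf + Mg * B / μg + Lg' * (Lf / μg + Mg * B / μg ^ 2)) * ‖y - innerSol g x‖
        + Lg' * ‖z - linSol f g x y‖ := by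
  have h1 := H.hyperGrad_sub_le hμg hLg hMg hLg' x y z x (innerSol g x)
  rwa [pairDist_same_left] at h1

/-- With exact z only the Lipschitz term in (x, y) survives; the factor 1 + L_g'/μ_g of L is the
Lipschitz constant of the graph of y⋆. -/
theorem lossGrad_lipschitz (H : BilevelAssumptions f g Lf B Mg Lg' Lg μg) (hμg : 0 < μg)
    (hLg : 0 < Lg) (hMg : 0 < Mg) (hLg' : 0 < Lg') (hLf : 0 < Lf) (hB : 0 < B) (x x' : X) :
    ‖lossGrad f g x - lossGrad f g x'‖ ≤ smoothConst Lf B Mg Lg' μg * ‖x - x'‖ := by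
  have h1 := H.hyperGrad_sub_le hμg hLg hMg hLg' x (innerSol g x)
    (linSol f g x (innerSol g x)) x' (innerSol g x')
  rw [sub_self, norm_zero, mul_zero, add_zero] at h1
  refine h1.trans ?_
  have h2 : pairDist x (innerSol g x) x' (innerSol g x') ≤ (1 + Lg' / μg) * ‖x - x'‖ := by
    refine (pairDist_le _ _ _ _).trans ?_
    have := H.innerSol_lipschitz hμg x x'
    linarith
  refine (mul_le_mul_of_nonneg_left h2 (by positivity)).trans_eq ?_
  rw [smoothConst]
  field_simp
  ring

/-- The chain rule leaves ⟨∂_y f, J v⟩ with J the derivative of y⋆. Substituting ∂_y f = −A z⋆,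
moving A to J v by symmetry and using A J = −C turns it into ⟨∂_xy g z⋆, v⟩, without inverting A. -/
theorem hasGradientAt_outerLoss
    (H : BilevelAssumptions f g Lf B Mg Lg' Lg μg) (hμg : 0 < μg) (hLg : 0 < Lg) (x : X) :
    HasGradientAt (outerLoss f g) (lossGrad f g x) x := by
  obtain ⟨J, hJ, hJ'⟩ := H.hasFDerivAt_innerSol hμg hLg x
  have h1 := hasFDerivAt_uncurry H.f_differentiable x (innerSol g x)
  have h2 : HasFDerivAt (fun x' => ((x', innerSol g x') : X × Y))
    ((ContinuousLinearMap.id ℝ X).prod J) x := (hasFDerivAt_id x).prodMk hJ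
  have h3 := HasFDerivAt.comp x h1 h2
  rw [hasGradientAt_iff_hasFDerivAt]
  refine h3.congr_fderiv ?_
  ext v
  have h4 : gradY f x (innerSol g x) =
      - hessYY g x (innerSol g x) (linSol f g x (innerSol g x)) := by
    rw [eq_neg_iff_add_eq_zero, add_comm]; exact H.hessYY_linSol hμg hLg x _
  have h5 := H.twice.hessYY_symm x (innerSol g x) (linSol f g x (innerSol g x)) (J v)
  rw [hJ', inner_neg_right, ContinuousLinearMap.adjoint_inner_right] at h5
  simp [lossGrad, hyperGrad, h4, h5]

theorem isMinOn_outerSol [FiniteDimensional ℝ X]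
    (H : BilevelAssumptions f g Lf B Mg Lg' Lg μg) (hμg : 0 < μg) (hLg : 0 < Lg) {μ : ℝ}
    (hμ : 0 < μ) (hsc : StrongConvexOn univ μ (outerLoss f g)) :
    IsMinOn (outerLoss f g) univ (outerSol f g) := by
  refine Classical.epsilon_spec (p := fun x => IsMinOn (outerLoss f g) univ x) ?_
  refine StrongConvexOn.exists_isMinOn hμ hsc (H.hasGradientAt_outerLoss hμg hLg 0) ?_
  exact continuous_iff_continuousAt.2 fun y => (H.hasGradientAt_outerLoss hμg hLg y).continuousAt

theorem lossGrad_outerSol [FiniteDimensional ℝ X]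
    (H : BilevelAssumptions f g Lf B Mg Lg' Lg μg) (hμg : 0 < μg) (hLg : 0 < Lg) {μ : ℝ}
    (hμ : 0 < μ) (hsc : StrongConvexOn univ μ (outerLoss f g)) :
    lossGrad f g (outerSol f g) = 0 := by
  have h1 := (H.isMinOn_outerSol hμg hLg hμ hsc).isLocalMin univ_mem
  have h2 := h1.hasFDerivAt_eq_zero (H.hasGradientAt_outerLoss hμg hLg _).hasFDerivAt
  simpa using h2

end BilevelAssumptions

end Bilevel

/-! ### Independence of a fresh batch from the past -/

/-- The time at which a sample is drawn: outer iteration, phase of the iteration, inner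
iteration. -/
def SampleIdx.time : SampleIdx → ℕ ×ₗ ℕ ×ₗ ℕ
  | .g k t _ => toLex (k, toLex (0, t))
  | .f k _ => toLex (k, toLex (1, 0))
  | .gyy k t _ => toLex (k, toLex (2, t))
  | .gxy k _ => toLex (k, toLex (3, 0))

/-- The instant of inner iteration `t` in phase `j` of the outer iteration `k`. -/
abbrev instant (k j t : ℕ) : ℕ ×ₗ ℕ ×ₗ ℕ := toLex (k, toLex (j, t))

section Past

variable {Ω Ξ : Type*} [mΞ : MeasurableSpace Ξ]

/-- The σ-algebra generated by the samples drawn before time `a`. -/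
@[reducible] def past (s : SampleIdx → Ω → Ξ) (a : ℕ ×ₗ ℕ ×ₗ ℕ) : MeasurableSpace Ω :=
  ⨆ i ∈ {i : SampleIdx | i.time < a}, MeasurableSpace.comap (s i) mΞ

theorem past_mono (s : SampleIdx → Ω → Ξ) {a b : ℕ ×ₗ ℕ ×ₗ ℕ} (hab : a ≤ b) :
    past s a ≤ past s b :=
  biSup_mono fun _ hi => lt_of_lt_of_le hi hab

theorem measurable_sample (s : SampleIdx → Ω → Ξ) {a : ℕ ×ₗ ℕ ×ₗ ℕ} {i : SampleIdx}
    (hi : i.time < a) : Measurable[past s a] (s i) := by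
  have h1 : MeasurableSpace.comap (s i) mΞ ≤ past s a :=
    le_iSup₂_of_le i hi le_rfl
  exact (comap_measurable (s i)).mono h1 le_rfl

theorem measurable_batch (s : SampleIdx → Ω → Ξ) {a b : ℕ ×ₗ ℕ ×ₗ ℕ} {n : ℕ}
    {idx : Fin n → SampleIdx} (hidx : ∀ i, (idx i).time = a) (hab : a < b) :
    Measurable[past s b] (fun ω i => s (idx i) ω) := by
  refine @measurable_pi_lambda _ _ _ (past s b) _ _ fun i => ?_
  exact measurable_sample s (by rw [hidx]; exact hab)

variable [mΩ : MeasurableSpace Ω] {P : Measure Ξ} [IsProbabilityMeasure P] {Pr : Measure Ω}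
  [IsProbabilityMeasure Pr] {s : SampleIdx → Ω → Ξ}

theorem past_le (hs : ∀ i, Measurable (s i)) (a : ℕ ×ₗ ℕ ×ₗ ℕ) : past s a ≤ mΩ :=
  iSup₂_le fun i _ => (hs i).comap_le

variable {E : Type*} [MeasurableSpace E]

/-- The past uses labels with time strictly before a, the batch only labels with time exactly a. The
two index sets are disjoint, hence independent; distinct labels within the batch give the product
law. -/
theorem map_past_prod_batch (hind : iIndepFun s Pr) (hs : ∀ i, MeasurePreserving (s i) Pr P)
    {a : ℕ ×ₗ ℕ ×ₗ ℕ} {W : Ω → E} (hW : Measurable[past s a] W) {n : ℕ}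
    {idx : Fin n → SampleIdx} (hinj : Function.Injective idx) (hidx : ∀ i, (idx i).time = a) :
    Pr.map (fun ω => (W ω, fun i => s (idx i) ω)) = (Pr.map W).prod (batchLaw P n) := by
  have hm : ∀ i, Measurable (s i) := fun i => (hs i).measurable
  have hW' : Measurable W := hW.mono (past_le hm a) le_rfl
  have hD : Measurable (fun ω i => s (idx i) ω) := measurable_pi_lambda _ fun i => hm _
  have hindep : IndepFun W (fun ω i => s (idx i) ω) Pr := by
    have h1 : Indep (past s a) (⨆ i ∈ range idx, MeasurableSpace.comap (s i) mΞ) Pr := by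
      refine indep_iSup_of_disjoint (fun i => (hm i).comap_le) hind.iIndep ?_
      rw [Set.disjoint_left]
      rintro _ hi ⟨j, rfl⟩
      have hi : (idx j).time < a := hi
      rw [hidx] at hi
      exact lt_irrefl _ hi
    rw [IndepFun_iff_Indep]
    refine indep_of_indep_of_le_left (indep_of_indep_of_le_right h1 ?_) hW.comap_le
    refine Measurable.comap_le ?_
    refine @measurable_pi_lambda _ _ _ (⨆ i ∈ range idx, MeasurableSpace.comap (s i) mΞ) _ _
      fun i => ?_
    exact (comap_measurable (s (idx i))).mono (le_iSup₂_of_le (idx i) ⟨i, rfl⟩ le_rfl) le_rfl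
  rw [hindep.map_prod_eq_prod_map_map hW'.aemeasurable hD.aemeasurable]
  congr 1
  have h2 := (iIndepFun_iff_map_fun_eq_pi_map (fun i => (hm (idx i)).aemeasurable)).1
    (hind.precomp hinj)
  refine h2.trans ?_
  simp only [(hs _).map_eq]

/-- Integrals of nonnegative functions of the past and of a fresh batch can be bounded batch-wise
first. -/
theorem integrable_and_integral_le_of_batch (hind : iIndepFun s Pr)
    (hs : ∀ i, MeasurePreserving (s i) Pr P)
    {a : ℕ ×ₗ ℕ ×ₗ ℕ} {W : Ω → E} (hW : Measurable[past s a] W) {n : ℕ}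
    {idx : Fin n → SampleIdx} (hinj : Function.Injective idx) (hidx : ∀ i, (idx i).time = a)
    {h : E × (Fin n → Ξ) → ℝ} (hh : Measurable h) (h0 : ∀ p, 0 ≤ h p) {b : E → ℝ}
    (hint : ∀ w, Integrable (fun d => h (w, d)) (batchLaw P n))
    (hle : ∀ w, ∫ d, h (w, d) ∂(batchLaw P n) ≤ b w)
    (hb : Measurable b) (hbi : Integrable (fun ω => b (W ω)) Pr) :
    Integrable (fun ω => h (W ω, fun i => s (idx i) ω)) Pr ∧
      ∫ ω, h (W ω, fun i => s (idx i) ω) ∂Pr ≤ ∫ ω, b (W ω) ∂Pr := by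
  have hm : ∀ i, Measurable (s i) := fun i => (hs i).measurable
  have hW' : Measurable W := hW.mono (past_le hm a) le_rfl
  have hD : Measurable (fun ω i => s (idx i) ω) := measurable_pi_lambda _ fun i => hm _
  have hWD : Measurable (fun ω => (W ω, fun i => s (idx i) ω)) := hW'.prodMk hD
  have hmap := map_past_prod_batch hind hs hW hinj hidx
  have hbm : Integrable b (Pr.map W) :=
    (integrable_map_measure hb.aestronglyMeasurable hW'.aemeasurable).2 hbi
  -- Nonnegativity makes the inner integral of the norm equal to that of h, which b dominates; this
  -- is the integrability criterion on the product.
  have hI : Integrable h ((Pr.map W).prod (batchLaw P n)) := by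
    rw [integrable_prod_iff hh.aestronglyMeasurable]
    refine ⟨Eventually.of_forall hint, hbm.mono' ?_ (Eventually.of_forall fun w => ?_)⟩
    · exact (hh.norm.stronglyMeasurable.integral_prod_right').aestronglyMeasurable
    · rw [Real.norm_of_nonneg (integral_nonneg fun d => norm_nonneg _)]
      simp only [Real.norm_of_nonneg (h0 _)]
      exact hle w
  constructor
  · rw [← hmap] at hI
    exact (integrable_map_measure hh.aestronglyMeasurable hWD.aemeasurable).1 hI
  · rw [← integral_map (φ := fun ω => (W ω, fun i => s (idx i) ω)) hWD.aemeasurable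
      hh.aestronglyMeasurable, hmap, integral_prod _ hI,
      ← integral_map (φ := W) hW'.aemeasurable hb.aestronglyMeasurable]
    exact integral_mono hI.integral_prod_left hbm hle

/-- Functions of the past and of a fresh batch with vanishing batch-wise means have mean zero. -/
theorem integral_eq_zero_of_batch (hind : iIndepFun s Pr)
    (hs : ∀ i, MeasurePreserving (s i) Pr P)
    {a : ℕ ×ₗ ℕ ×ₗ ℕ} {W : Ω → E} (hW : Measurable[past s a] W) {n : ℕ}
    {idx : Fin n → SampleIdx} (hinj : Function.Injective idx) (hidx : ∀ i, (idx i).time = a)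
    {h : E × (Fin n → Ξ) → ℝ} (hh : Measurable h)
    (hzero : ∀ w, ∫ d, h (w, d) ∂(batchLaw P n) = 0)
    (hi : Integrable (fun ω => h (W ω, fun i => s (idx i) ω)) Pr) :
    ∫ ω, h (W ω, fun i => s (idx i) ω) ∂Pr = 0 := by
  have hm : ∀ i, Measurable (s i) := fun i => (hs i).measurable
  have hW' : Measurable W := hW.mono (past_le hm a) le_rfl
  have hD : Measurable (fun ω i => s (idx i) ω) := measurable_pi_lambda _ fun i => hm _
  have hWD : Measurable (fun ω => (W ω, fun i => s (idx i) ω)) := hW'.prodMk hD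
  have hmap := map_past_prod_batch hind hs hW hinj hidx
  have hI : Integrable h ((Pr.map W).prod (batchLaw P n)) := by
    rw [← hmap]
    exact (integrable_map_measure hh.aestronglyMeasurable hWD.aemeasurable).2 hi
  rw [← integral_map (φ := fun ω => (W ω, fun i => s (idx i) ω)) hWD.aemeasurable
      hh.aestronglyMeasurable, hmap, integral_prod _ hI]
  simp [hzero]

end Past

/-! ### Square integrable random vectors -/

section L2

variable {Ω E F : Type*} [MeasurableSpace Ω] {Pr : Measure Ω}
  [NormedAddCommGroup E] [InnerProductSpace ℝ E] [NormedAddCommGroup F] [InnerProductSpace ℝ F]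

/-- The second moment of a random vector. -/
def sqMean (Pr : Measure Ω) (U : Ω → E) : ℝ := ∫ ω, ‖U ω‖ ^ 2 ∂Pr

theorem sqMean_nonneg (U : Ω → E) : 0 ≤ sqMean Pr U := integral_nonneg fun _ => by positivity

theorem integrable_norm_sq {U : Ω → E} (hU : MemLp U 2 Pr) :
    Integrable (fun ω => ‖U ω‖ ^ 2) Pr :=
  (memLp_two_iff_integrable_sq_norm hU.1).1 hU

theorem integrable_inner_of_memLp {U V : Ω → E} (hU : MemLp U 2 Pr) (hV : MemLp V 2 Pr) :
    Integrable (fun ω => inner ℝ (U ω) (V ω)) Pr := by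
  refine Integrable.mono' ((integrable_norm_sq hU).add (integrable_norm_sq hV))
    (hU.1.inner hV.1) (Eventually.of_forall fun ω => ?_)
  refine (norm_inner_le_norm _ _).trans ?_
  simp only [Pi.add_apply]
  nlinarith [sq_nonneg (‖U ω‖ - ‖V ω‖), sq_nonneg ‖U ω‖, sq_nonneg ‖V ω‖]

theorem sqMean_le_of_le {U : Ω → E} (hU : MemLp U 2 Pr) {b : Ω → ℝ} (hb : Integrable b Pr)
    (h : ∀ ω, ‖U ω‖ ^ 2 ≤ b ω) : sqMean Pr U ≤ ∫ ω, b ω ∂Pr :=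
  integral_mono (integrable_norm_sq hU) hb h

theorem sqMean_mono {U : Ω → E} {V : Ω → F} (hU : MemLp U 2 Pr) (hV : MemLp V 2 Pr) {c : ℝ}
    (h : ∀ ω, ‖U ω‖ ^ 2 ≤ c * ‖V ω‖ ^ 2) : sqMean Pr U ≤ c * sqMean Pr V := by
  refine (sqMean_le_of_le hU ((integrable_norm_sq hV).const_mul c) h).trans_eq ?_
  rw [integral_const_mul]; rfl

theorem memLp_of_norm_le {U : Ω → E} {V : Ω → F} (hU : AEStronglyMeasurable U Pr)
    (hV : MemLp V 2 Pr) {c : ℝ} (h : ∀ ω, ‖U ω‖ ≤ c * ‖V ω‖) : MemLp U 2 Pr :=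
  hV.of_le_mul hU (Eventually.of_forall h)

theorem sq_add_le_two (a b : ℝ) : (a + b) ^ 2 ≤ 2 * a ^ 2 + 2 * b ^ 2 := by
  nlinarith [sq_nonneg (a - b)]

theorem norm_add_sq_le_two (a b : E) : ‖a + b‖ ^ 2 ≤ 2 * ‖a‖ ^ 2 + 2 * ‖b‖ ^ 2 :=
  (pow_le_pow_left₀ (norm_nonneg _) (norm_add_le a b) 2).trans (sq_add_le_two _ _)

theorem norm_add₃_sq_le_three (a b c : E) :
    ‖a + b + c‖ ^ 2 ≤ 3 * ‖a‖ ^ 2 + 3 * ‖b‖ ^ 2 + 3 * ‖c‖ ^ 2 := by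
  refine (pow_le_pow_left₀ (norm_nonneg _) (norm_add₃_le (a := a) (b := b) (c := c)) 2).trans ?_
  nlinarith [sq_nonneg (‖a‖ - ‖b‖), sq_nonneg (‖a‖ - ‖c‖), sq_nonneg (‖b‖ - ‖c‖)]

theorem norm_add_sq_le_young {θ : ℝ} (hθ : 0 < θ) (a b : E) :
    ‖a + b‖ ^ 2 ≤ (1 + θ) * ‖a‖ ^ 2 + (1 + 1 / θ) * ‖b‖ ^ 2 := by
  refine (pow_le_pow_left₀ (norm_nonneg _) (norm_add_le a b) 2).trans ?_
  have h1 : 2 * (‖a‖ * ‖b‖) ≤ θ * ‖a‖ ^ 2 + 1 / θ * ‖b‖ ^ 2 := by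
    have h2 : 0 ≤ (θ * ‖a‖ - ‖b‖) ^ 2 / θ := by positivity
    have h3 : (θ * ‖a‖ - ‖b‖) ^ 2 / θ = θ * ‖a‖ ^ 2 - 2 * (‖a‖ * ‖b‖) + 1 / θ * ‖b‖ ^ 2 := by
      field_simp
      ring
    linarith
  nlinarith

theorem sqMean_add_le {U V : Ω → E} (hU : MemLp U 2 Pr) (hV : MemLp V 2 Pr) :
    sqMean Pr (fun ω => U ω + V ω) ≤ 2 * sqMean Pr U + 2 * sqMean Pr V := by
  refine (sqMean_le_of_le (hU.add hV) (((integrable_norm_sq hU).const_mul 2).add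
    ((integrable_norm_sq hV).const_mul 2)) (fun ω => norm_add_sq_le_two _ _)).trans_eq ?_
  rw [integral_add' ((integrable_norm_sq hU).const_mul 2) ((integrable_norm_sq hV).const_mul 2),
    integral_const_mul, integral_const_mul]
  rfl

theorem sqMean_add₃_le {U V W : Ω → E} (hU : MemLp U 2 Pr) (hV : MemLp V 2 Pr)
    (hW : MemLp W 2 Pr) :
    sqMean Pr (fun ω => U ω + V ω + W ω)
      ≤ 3 * sqMean Pr U + 3 * sqMean Pr V + 3 * sqMean Pr W := by
  have h1 := (integrable_norm_sq hU).const_mul 3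
  have h2 := (integrable_norm_sq hV).const_mul 3
  have h3 := (integrable_norm_sq hW).const_mul 3
  refine (sqMean_le_of_le ((hU.add hV).add hW) ((h1.add h2).add h3)
    (fun ω => norm_add₃_sq_le_three _ _ _)).trans_eq ?_
  rw [integral_add' (h1.add h2) h3, integral_add' h1 h2,
    integral_const_mul, integral_const_mul, integral_const_mul]
  rfl

/-- Joint measurability of the evaluation of operators. -/
theorem measurable_clm_apply [FiniteDimensional ℝ E] [FiniteDimensional ℝ F] [MeasurableSpace E]
    [BorelSpace E] [MeasurableSpace F] [BorelSpace F] {α : Type*} {m : MeasurableSpace α}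
    {A : α → E →L[ℝ] F} {z : α → E} (hA : Measurable A) (hz : Measurable z) :
    Measurable fun ω => A ω (z ω) := by
  have h1 : Continuous fun p : (E →L[ℝ] F) × E => p.1 p.2 := isBoundedBilinearMap_apply.continuous
  exact h1.measurable.comp (hA.prodMk hz)

end L2

/-! ### Centered noise -/

section Noise

variable {Ω Ξ : Type*} [mΞ : MeasurableSpace Ξ] [mΩ : MeasurableSpace Ω] {P : Measure Ξ}
  [IsProbabilityMeasure P] {Pr : Measure Ω}
  [IsProbabilityMeasure Pr] {s : SampleIdx → Ω → Ξ} {E : Type*} [MeasurableSpace E]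
  {V : Type*} [NormedAddCommGroup V] [InnerProductSpace ℝ V] [FiniteDimensional ℝ V]
  [MeasurableSpace V] [BorelSpace V]

/-- A random vector `ζ(w, D)` that is centered for every `w`, with second moment at most `b(w)`. -/
structure IsCentered (P : Measure Ξ) (n : ℕ) (ζ : E × (Fin n → Ξ) → V) (b : E → ℝ) : Prop where
  measurable : Measurable ζ
  integrable : ∀ w, Integrable (fun d => ζ (w, d)) (batchLaw P n)
  mean_zero : ∀ w, ∫ d, ζ (w, d) ∂(batchLaw P n) = 0
  sq_integrable : ∀ w, Integrable (fun d => ‖ζ (w, d)‖ ^ 2) (batchLaw P n)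
  sq_le : ∀ w, ∫ d, ‖ζ (w, d)‖ ^ 2 ∂(batchLaw P n) ≤ b w
  measurable_bound : Measurable b

/-- The samples are independent with law `P`. -/
structure IsSampling (P : Measure Ξ) (Pr : Measure Ω) (s : SampleIdx → Ω → Ξ) : Prop where
  indep : iIndepFun s Pr
  law : ∀ i, MeasurePreserving (s i) Pr P

theorem IsSampling.measurable (hS : IsSampling P Pr s) (i : SampleIdx) : Measurable (s i) :=
  (hS.law i).measurable

theorem IsSampling.past_le (hS : IsSampling P Pr s) (a : ℕ ×ₗ ℕ ×ₗ ℕ) : past s a ≤ mΩ :=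
  AmIGO.past_le hS.measurable a

namespace IsCentered

variable {n : ℕ} {ζ : E × (Fin n → Ξ) → V} {b : E → ℝ} {a : ℕ ×ₗ ℕ ×ₗ ℕ} {W : Ω → E}
  {idx : Fin n → SampleIdx}

theorem memLp_and_sqMean_le (hζ : IsCentered P n ζ b) (hS : IsSampling P Pr s)
    (hW : Measurable[past s a] W)
    (hinj : Function.Injective idx) (hidx : ∀ i, (idx i).time = a)
    (hb : Integrable (fun ω => b (W ω)) Pr) :
    MemLp (fun ω => ζ (W ω, fun i => s (idx i) ω)) 2 Pr ∧
      sqMean Pr (fun ω => ζ (W ω, fun i => s (idx i) ω)) ≤ ∫ ω, b (W ω) ∂Pr := by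
  have hW' : Measurable W := hW.mono (hS.past_le a) le_rfl
  have hD : Measurable (fun ω i => s (idx i) ω) := measurable_pi_lambda _ fun i => hS.measurable _
  have h1 := integrable_and_integral_le_of_batch hS.indep hS.law hW hinj hidx
    (h := fun p => ‖ζ p‖ ^ 2) (hζ.measurable.norm.pow_const 2) (fun p => by positivity)
    hζ.sq_integrable hζ.sq_le hζ.measurable_bound hb
  exact ⟨(memLp_two_iff_integrable_sq_norm
    (hζ.measurable.comp (hW'.prodMk hD)).aestronglyMeasurable).2 h1.1, h1.2⟩

theorem integral_inner_eq_zero (hζ : IsCentered P n ζ b) (hS : IsSampling P Pr s)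
    (hW : Measurable[past s a] W)
    (hinj : Function.Injective idx) (hidx : ∀ i, (idx i).time = a)
    (hb : Integrable (fun ω => b (W ω)) Pr) {φ : Ω → V} (hφ : Measurable[past s a] φ)
    (hφ2 : MemLp φ 2 Pr) :
    ∫ ω, inner ℝ (φ ω) (ζ (W ω, fun i => s (idx i) ω)) ∂Pr = 0 := by
  have h1 := (hζ.memLp_and_sqMean_le hS hW hinj hidx hb).1
  -- φ is carried along as part of the past variable. For each fixed value of that variable it is a
  -- constant vector, against which the noise integrates to zero.
  have hφW : Measurable[past s a] (fun ω => (φ ω, W ω)) := hφ.prodMk hW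
  refine integral_eq_zero_of_batch hS.indep hS.law hφW hinj hidx
    (h := fun p : (V × E) × (Fin n → Ξ) => inner ℝ p.1.1 (ζ (p.1.2, p.2))) ?_ ?_
    (integrable_inner_of_memLp hφ2 h1)
  · have h2 : Measurable fun p : (V × E) × (Fin n → Ξ) => ζ (p.1.2, p.2) :=
      hζ.measurable.comp (by fun_prop)
    exact Measurable.inner (by fun_prop) h2
  · intro w
    have h3 := integral_inner (𝕜 := ℝ) (hζ.integrable w.2) w.1
    simp only
    rw [h3, hζ.mean_zero, inner_zero_right]

/-- Pythagoras for a vector known from the past and fresh centered noise. -/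
theorem memLp_and_sqMean_sub_smul_le (hζ : IsCentered P n ζ b) (hS : IsSampling P Pr s)
    (hW : Measurable[past s a] W)
    (hinj : Function.Injective idx) (hidx : ∀ i, (idx i).time = a)
    (hb : Integrable (fun ω => b (W ω)) Pr) {φ : Ω → V} (hφ : Measurable[past s a] φ)
    (hφ2 : MemLp φ 2 Pr) (c : ℝ) :
    MemLp (fun ω => φ ω - c • ζ (W ω, fun i => s (idx i) ω)) 2 Pr ∧
    sqMean Pr (fun ω => φ ω - c • ζ (W ω, fun i => s (idx i) ω))
      ≤ sqMean Pr φ + c ^ 2 * ∫ ω, b (W ω) ∂Pr := by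
  obtain ⟨h1, h2⟩ := hζ.memLp_and_sqMean_le hS hW hinj hidx hb
  have h3 := hζ.integral_inner_eq_zero hS hW hinj hidx hb hφ hφ2
  refine ⟨hφ2.sub (h1.const_smul c), ?_⟩
  have h4 : ∀ ω, ‖φ ω - c • ζ (W ω, fun i => s (idx i) ω)‖ ^ 2
      = ‖φ ω‖ ^ 2 + (-2 * c) * inner ℝ (φ ω) (ζ (W ω, fun i => s (idx i) ω))
        + c ^ 2 * ‖ζ (W ω, fun i => s (idx i) ω)‖ ^ 2 := by
    intro ω
    rw [norm_sub_sq_real, inner_smul_right, norm_smul, mul_pow, Real.norm_eq_abs, sq_abs]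
    ring
  have i1 := integrable_norm_sq hφ2
  have i2 := (integrable_inner_of_memLp hφ2 h1).const_mul (-2 * c)
  have i3 := (integrable_norm_sq h1).const_mul (c ^ 2)
  have h5 : sqMean Pr (fun ω => φ ω - c • ζ (W ω, fun i => s (idx i) ω))
      = sqMean Pr φ + c ^ 2 * sqMean Pr (fun ω => ζ (W ω, fun i => s (idx i) ω)) := by
    have e := integral_add (i1.add i2) i3
    rw [integral_add' i1 i2, integral_const_mul, integral_const_mul, h3, mul_zero, add_zero] at e
    exact (integral_congr_ae (ae_of_all _ h4)).trans e
  rw [h5]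
  gcongr

end IsCentered

/-- A centered random operator whose covariance has norm at most `c` acts on vectors as centered
noise. -/
theorem operator_noise {α : Type*} [MeasurableSpace α] {Q : Measure α}
    {V' : Type*} [NormedAddCommGroup V'] [InnerProductSpace ℝ V'] [FiniteDimensional ℝ V']
    [CompleteSpace V] [CompleteSpace V']
    {A : α → V →L[ℝ] V'} (hA : Integrable A Q) (hA0 : ∫ d, A d ∂Q = 0) {c : ℝ}
    (hA2 : Integrable (fun d => (ContinuousLinearMap.adjoint (A d)).comp (A d)) Q)
    (hc : ‖∫ d, (ContinuousLinearMap.adjoint (A d)).comp (A d) ∂Q‖ ≤ c) (z : V) :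
    Integrable (fun d => A d z) Q ∧ ∫ d, A d z ∂Q = 0 ∧
      Integrable (fun d => ‖A d z‖ ^ 2) Q ∧ ∫ d, ‖A d z‖ ^ 2 ∂Q ≤ c * ‖z‖ ^ 2 := by
  -- As a quadratic form of AᵀA the square is linear in AᵀA, so the mean can be taken inside. Thus
  -- the norm of the mean covariance suffices, not the mean of the squared norm.
  have e1 : ∀ d, ‖A d z‖ ^ 2
      = inner ℝ ((ContinuousLinearMap.adjoint (A d)).comp (A d) z) z := by
    intro d
    rw [ContinuousLinearMap.comp_apply, ContinuousLinearMap.adjoint_inner_left,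
      real_inner_self_eq_norm_sq]
  have i2 := hA2.apply_continuousLinearMap z
  refine ⟨hA.apply_continuousLinearMap z, ?_, ?_, ?_⟩
  · rw [← ContinuousLinearMap.integral_apply hA, hA0, zero_apply]
  · simp only [e1]
    exact i2.inner_const z
  · simp only [e1]
    have h1 : ∫ d, inner ℝ ((ContinuousLinearMap.adjoint (A d)).comp (A d) z) z ∂Q
        = inner ℝ ((∫ d, (ContinuousLinearMap.adjoint (A d)).comp (A d) ∂Q) z) z := by
      rw [ContinuousLinearMap.integral_apply hA2]
      have := integral_inner (𝕜 := ℝ) i2 z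
      rw [real_inner_comm, ← this]
      simp only [real_inner_comm]
    rw [h1]
    refine (real_inner_le_norm _ _).trans ?_
    have h2 := (ContinuousLinearMap.le_of_opNorm_le _ hc z)
    nlinarith [norm_nonneg z]

end Noise

/-! ### Measurability of the oracles and of the derivatives -/

section Oracles

variable {X Y : Type*}
  [NormedAddCommGroup X] [InnerProductSpace ℝ X] [CompleteSpace X] [FiniteDimensional ℝ X]
  [MeasurableSpace X] [BorelSpace X]
  [NormedAddCommGroup Y] [InnerProductSpace ℝ Y] [CompleteSpace Y] [FiniteDimensional ℝ Y]
  [MeasurableSpace Y] [BorelSpace Y]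

theorem continuous_of_pairDist {V : Type*} [NormedAddCommGroup V] {F : X → Y → V} {c : ℝ}
    (hc : 0 ≤ c) (h : ∀ x y x' y', ‖F x y - F x' y'‖ ≤ c * pairDist x y x' y') :
    Continuous fun p : X × Y => F p.1 p.2 := by
  refine continuous_iff_continuousAt.2 fun p => ?_
  refine tendsto_iff_norm_sub_tendsto_zero.2 ?_
  have h1 : Tendsto (fun q : X × Y => c * (‖q.1 - p.1‖ + ‖q.2 - p.2‖)) (𝓝 p) (𝓝 0) := by
    have : Continuous fun q : X × Y => c * (‖q.1 - p.1‖ + ‖q.2 - p.2‖) := by fun_prop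
    simpa using this.tendsto p
  refine squeeze_zero (fun _ => norm_nonneg _) (fun q => ?_) h1
  exact (h _ _ _ _).trans (mul_le_mul_of_nonneg_left (pairDist_le _ _ _ _) hc)

namespace BilevelAssumptions

variable {f g : X → Y → ℝ} {Lf B Mg Lg' Lg μg : ℝ}

variable {α : Type*} {m : MeasurableSpace α}

theorem measurable_gradX (H : BilevelAssumptions f g Lf B Mg Lg' Lg μg) (hLf : 0 < Lf)
    {x : α → X} {y : α → Y} (hx : Measurable x) (hy : Measurable y) :
    Measurable fun a => gradX f (x a) (y a) := by
  have h1 := (continuous_of_pairDist hLf.le H.gradX_lipschitz).measurable.comp (hx.prodMk hy)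
  exact h1

theorem measurable_gradY (H : BilevelAssumptions f g Lf B Mg Lg' Lg μg) (hLf : 0 < Lf)
    {x : α → X} {y : α → Y} (hx : Measurable x) (hy : Measurable y) :
    Measurable fun a => gradY f (x a) (y a) := by
  have h1 := (continuous_of_pairDist hLf.le H.gradY_lipschitz).measurable.comp (hx.prodMk hy)
  exact h1

theorem measurable_gradY_inner (H : BilevelAssumptions f g Lf B Mg Lg' Lg μg)
    {x : α → X} {y : α → Y} (hx : Measurable x) (hy : Measurable y) :
    Measurable fun a => gradY g (x a) (y a) := by
  have h1 := (H.twice.differentiable_gradY.continuous).measurable.comp (hx.prodMk hy)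
  exact h1

theorem measurable_hessXY (H : BilevelAssumptions f g Lf B Mg Lg' Lg μg) (hMg : 0 < Mg)
    {x : α → X} {y : α → Y} (hx : Measurable x) (hy : Measurable y) :
    Measurable fun a => hessXY g (x a) (y a) := by
  have h1 := (continuous_of_pairDist hMg.le H.g_xy_lipschitz).measurable.comp (hx.prodMk hy)
  exact h1

theorem measurable_hessYY (H : BilevelAssumptions f g Lf B Mg Lg' Lg μg) (hMg : 0 < Mg)
    {x : α → X} {y : α → Y} (hx : Measurable x) (hy : Measurable y) :
    Measurable fun a => hessYY g (x a) (y a) := by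
  have h1 := (continuous_of_pairDist hMg.le H.g_yy_lipschitz).measurable.comp (hx.prodMk hy)
  exact h1

theorem continuous_innerSol (H : BilevelAssumptions f g Lf B Mg Lg' Lg μg) (hμg : 0 < μg)
    (hLg : 0 < Lg) : Continuous (innerSol g) :=
  continuous_iff_continuousAt.2 fun x => by
    obtain ⟨J, hJ, -⟩ := H.hasFDerivAt_innerSol hμg hLg x
    exact hJ.continuousAt

theorem measurable_linSol (H : BilevelAssumptions f g Lf B Mg Lg' Lg μg) (hμg : 0 < μg)
    (hLg : 0 < Lg) (hMg : 0 < Mg) (hLf : 0 < Lf) (hB : 0 < B)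
    {x : α → X} {y : α → Y} (hx : Measurable x) (hy : Measurable y) :
    Measurable fun a => linSol f g (x a) (y a) := by
  have h1 := (continuous_of_pairDist (by positivity) (H.linSol_lipschitz hμg hLg hMg)).measurable.comp (hx.prodMk hy)
  exact h1

theorem measurable_hyperGrad (H : BilevelAssumptions f g Lf B Mg Lg' Lg μg)
    (hMg : 0 < Mg) (hLf : 0 < Lf) {x : α → X} {y z : α → Y} (hx : Measurable x)
    (hy : Measurable y) (hz : Measurable z) :
    Measurable fun a => hyperGrad f g (x a) (y a) (z a) :=
  (H.measurable_gradX hLf hx hy).add (measurable_clm_apply (H.measurable_hessXY hMg hx hy) hz)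

theorem measurable_lossGrad (H : BilevelAssumptions f g Lf B Mg Lg' Lg μg) (hμg : 0 < μg)
    (hLg : 0 < Lg) (hMg : 0 < Mg) (hLf : 0 < Lf) (hB : 0 < B) {x : α → X} (hx : Measurable x) :
    Measurable fun a => lossGrad f g (x a) := by
  have h1 := (H.continuous_innerSol hμg hLg).measurable.comp hx
  exact H.measurable_hyperGrad hMg hLf hx h1 (H.measurable_linSol hμg hLg hMg hLf hB hx h1)

end BilevelAssumptions

variable {Ξ : Type*} [MeasurableSpace Ξ] {P : Measure Ξ} [IsProbabilityMeasure P]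
  {f g : X → Y → ℝ} {fhat ghat : Ξ → X → Y → ℝ}

namespace StochasticModel

theorem g_twice (M : StochasticModel P f g fhat ghat) (ξ : Ξ) : TwiceDifferentiable (ghat ξ) :=
  ⟨M.g_differentiable ξ, M.g_twice_differentiable ξ⟩

variable {α : Type*} {m : MeasurableSpace α}

theorem measurable_average {n : ℕ} {V : Type*} [NormedAddCommGroup V] [NormedSpace ℝ V]
    [MeasurableSpace V] [BorelSpace V] [SecondCountableTopology V] {F : Ξ × X × Y → V}
    (hF : Measurable F) {x : α → X} {y : α → Y} {D : α → Fin n → Ξ}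
    (hx : Measurable x) (hy : Measurable y) (hD : Measurable D) :
    Measurable fun a => (n : ℝ)⁻¹ • ∑ i, F (D a i, x a, y a) := by
  refine Measurable.const_smul (Finset.measurable_fun_sum _ fun i _ => ?_) _
  exact hF.comp (((measurable_pi_apply i).comp hD).prodMk (hx.prodMk hy))

theorem measurable_gradX (M : StochasticModel P f g fhat ghat) {n : ℕ}
    {x : α → X} {y : α → Y} {D : α → Fin n → Ξ}
    (hx : Measurable x) (hy : Measurable y) (hD : Measurable D) :
    Measurable fun a => gradX (batchAvg fhat (D a)) (x a) (y a) := by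
  simp only [gradX_batchAvg M.f_differentiable]
  exact measurable_average M.measurable_f_x hx hy hD

theorem measurable_gradY (M : StochasticModel P f g fhat ghat) {n : ℕ}
    {x : α → X} {y : α → Y} {D : α → Fin n → Ξ}
    (hx : Measurable x) (hy : Measurable y) (hD : Measurable D) :
    Measurable fun a => gradY (batchAvg fhat (D a)) (x a) (y a) := by
  simp only [gradY_batchAvg M.f_differentiable]
  exact measurable_average M.measurable_f_y hx hy hD

theorem measurable_gradY_inner (M : StochasticModel P f g fhat ghat) {n : ℕ}
    {x : α → X} {y : α → Y} {D : α → Fin n → Ξ}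
    (hx : Measurable x) (hy : Measurable y) (hD : Measurable D) :
    Measurable fun a => gradY (batchAvg ghat (D a)) (x a) (y a) := by
  simp only [gradY_batchAvg M.g_differentiable]
  exact measurable_average M.measurable_g_y hx hy hD

theorem measurable_hessXY (M : StochasticModel P f g fhat ghat) {n : ℕ}
    {x : α → X} {y : α → Y} {D : α → Fin n → Ξ}
    (hx : Measurable x) (hy : Measurable y) (hD : Measurable D) :
    Measurable fun a => hessXY (batchAvg ghat (D a)) (x a) (y a) := by
  simp only [hessXY_batchAvg M.g_twice]
  exact measurable_average M.measurable_g_xy hx hy hD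

theorem measurable_hessYY (M : StochasticModel P f g fhat ghat) {n : ℕ}
    {x : α → X} {y : α → Y} {D : α → Fin n → Ξ}
    (hx : Measurable x) (hy : Measurable y) (hD : Measurable D) :
    Measurable fun a => hessYY (batchAvg ghat (D a)) (x a) (y a) := by
  simp only [hessYY_batchAvg M.g_twice]
  exact measurable_average M.measurable_g_yy hx hy hD

end StochasticModel

/-! ### The noises of the algorithm are centered -/

namespace NoiseAssumptions

variable {σf σg σgxy σgyy Lf B Mg Lg' Lg μg : ℝ} {n : ℕ}

theorem isCentered_inner (N : NoiseAssumptions P f g fhat ghat σf σg σgxy σgyy)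
    (M : StochasticModel P f g fhat ghat) (H : BilevelAssumptions f g Lf B Mg Lg' Lg μg)
    (hn : 1 ≤ n) :
    IsCentered P n (fun p : (X × Y) × (Fin n → Ξ) =>
      gradY (batchAvg ghat p.2) p.1.1 p.1.2 - gradY g p.1.1 p.1.2) (fun _ => σg ^ 2 / n) where
  measurable := (M.measurable_gradY_inner (by fun_prop) (by fun_prop) (by fun_prop)).sub
    (H.measurable_gradY_inner (by fun_prop) (by fun_prop))
  integrable w := (N.g_integrable n hn w.1 w.2).sub (integrable_const (gradY g w.1 w.2))
  mean_zero w := by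
    have h1 := integral_sub (N.g_integrable n hn w.1 w.2)
      (integrable_const (gradY g w.1 w.2))
    rw [N.g_unbiased n hn w.1 w.2] at h1
    exact h1.trans (by simp)
  sq_integrable w := N.g_sq_integrable n hn w.1 w.2
  sq_le w := N.g_variance n hn w.1 w.2
  measurable_bound := measurable_const

/-- The noise of ∂ₓf is a coordinate of the noise of ∇f: projection commutes with the mean and does
not increase the norm. -/
theorem isCentered_gradX (N : NoiseAssumptions P f g fhat ghat σf σg σgxy σgyy)
    (M : StochasticModel P f g fhat ghat) (H : BilevelAssumptions f g Lf B Mg Lg' Lg μg)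
    (hLf : 0 < Lf) (hn : 1 ≤ n) :
    IsCentered P n (fun p : (X × Y) × (Fin n → Ξ) =>
      gradX (batchAvg fhat p.2) p.1.1 p.1.2 - gradX f p.1.1 p.1.2) (fun _ => σf ^ 2 / n) := by
  have hmeas : Measurable (fun p : (X × Y) × (Fin n → Ξ) =>
      gradX (batchAvg fhat p.2) p.1.1 p.1.2 - gradX f p.1.1 p.1.2) :=
    (M.measurable_gradX (by fun_prop) (by fun_prop) (by fun_prop)).sub
      (H.measurable_gradX hLf (by fun_prop) (by fun_prop))
  have hle : ∀ (w : X × Y) (d : Fin n → Ξ),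
      ‖gradX (batchAvg fhat d) w.1 w.2 - gradX f w.1 w.2‖ ^ 2
        ≤ ‖grad (batchAvg fhat d) w.1 w.2 - grad f w.1 w.2‖ ^ 2 := fun w d =>
    pow_le_pow_left₀ (norm_nonneg _)
      (norm_le_pair (b := gradY (batchAvg fhat d) w.1 w.2 - gradY f w.1 w.2)) 2
  have hint : ∀ w : X × Y, Integrable (fun d : Fin n → Ξ => gradX (batchAvg fhat d) w.1 w.2)
      (batchLaw P n) := fun w =>
    (WithLp.fstL 2 ℝ X Y).integrable_comp (N.f_integrable n hn w.1 w.2)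
  have hsq : ∀ w : X × Y, Integrable (fun d : Fin n → Ξ =>
      ‖gradX (batchAvg fhat d) w.1 w.2 - gradX f w.1 w.2‖ ^ 2) (batchLaw P n) := fun w =>
    (N.f_sq_integrable n hn w.1 w.2).mono'
      ((hmeas.comp (measurable_const.prodMk measurable_id)).norm.pow_const
        2).aestronglyMeasurable
      (Eventually.of_forall fun d => by
        rw [Real.norm_of_nonneg (by positivity)]; exact hle w d)
  refine ⟨hmeas, fun w => (hint w).sub (integrable_const (gradX f w.1 w.2)), fun w => ?_, hsq,
    fun w => ?_, measurable_const⟩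
  · refine (integral_sub (hint w) (integrable_const (gradX f w.1 w.2))).trans ?_
    have h1 := (WithLp.fstL 2 ℝ X Y).integral_comp_comm (N.f_integrable n hn w.1 w.2)
    rw [N.f_unbiased n hn w.1 w.2] at h1
    have h2 : ∫ d : Fin n → Ξ, gradX (batchAvg fhat d) w.1 w.2 ∂(batchLaw P n)
      = gradX f w.1 w.2 := h1
    rw [h2]
    simp
  · exact (integral_mono (hsq w) (N.f_sq_integrable n hn w.1 w.2) (hle w)).trans
      (N.f_variance n hn w.1 w.2)

theorem isCentered_gradY (N : NoiseAssumptions P f g fhat ghat σf σg σgxy σgyy)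
    (M : StochasticModel P f g fhat ghat) (H : BilevelAssumptions f g Lf B Mg Lg' Lg μg)
    (hLf : 0 < Lf) (hn : 1 ≤ n) :
    IsCentered P n (fun p : (X × Y) × (Fin n → Ξ) =>
      gradY (batchAvg fhat p.2) p.1.1 p.1.2 - gradY f p.1.1 p.1.2) (fun _ => σf ^ 2 / n) := by
  have hmeas : Measurable (fun p : (X × Y) × (Fin n → Ξ) =>
      gradY (batchAvg fhat p.2) p.1.1 p.1.2 - gradY f p.1.1 p.1.2) :=
    (M.measurable_gradY (by fun_prop) (by fun_prop) (by fun_prop)).sub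
      (H.measurable_gradY hLf (by fun_prop) (by fun_prop))
  have hle : ∀ (w : X × Y) (d : Fin n → Ξ),
      ‖gradY (batchAvg fhat d) w.1 w.2 - gradY f w.1 w.2‖ ^ 2
        ≤ ‖grad (batchAvg fhat d) w.1 w.2 - grad f w.1 w.2‖ ^ 2 := fun w d =>
    pow_le_pow_left₀ (norm_nonneg _)
      (norm_le_pair' (a := gradX (batchAvg fhat d) w.1 w.2 - gradX f w.1 w.2)) 2
  have hint : ∀ w : X × Y, Integrable (fun d : Fin n → Ξ => gradY (batchAvg fhat d) w.1 w.2)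
      (batchLaw P n) := fun w =>
    (WithLp.sndL 2 ℝ X Y).integrable_comp (N.f_integrable n hn w.1 w.2)
  have hsq : ∀ w : X × Y, Integrable (fun d : Fin n → Ξ =>
      ‖gradY (batchAvg fhat d) w.1 w.2 - gradY f w.1 w.2‖ ^ 2) (batchLaw P n) := fun w =>
    (N.f_sq_integrable n hn w.1 w.2).mono'
      ((hmeas.comp (measurable_const.prodMk measurable_id)).norm.pow_const
        2).aestronglyMeasurable
      (Eventually.of_forall fun d => by
        rw [Real.norm_of_nonneg (by positivity)]; exact hle w d)
  refine ⟨hmeas, fun w => (hint w).sub (integrable_const (gradY f w.1 w.2)), fun w => ?_, hsq,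
    fun w => ?_, measurable_const⟩
  · refine (integral_sub (hint w) (integrable_const (gradY f w.1 w.2))).trans ?_
    have h1 := (WithLp.sndL 2 ℝ X Y).integral_comp_comm (N.f_integrable n hn w.1 w.2)
    rw [N.f_unbiased n hn w.1 w.2] at h1
    have h2 : ∫ d : Fin n → Ξ, gradY (batchAvg fhat d) w.1 w.2 ∂(batchLaw P n)
      = gradY f w.1 w.2 := h1
    rw [h2]
    simp
  · exact (integral_mono (hsq w) (N.f_sq_integrable n hn w.1 w.2) (hle w)).trans
      (N.f_variance n hn w.1 w.2)

theorem isCentered_hessYY (N : NoiseAssumptions P f g fhat ghat σf σg σgxy σgyy)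
    (M : StochasticModel P f g fhat ghat) (H : BilevelAssumptions f g Lf B Mg Lg' Lg μg)
    (hMg : 0 < Mg) (hn : 1 ≤ n) :
    IsCentered P n (fun p : ((X × Y) × Y) × (Fin n → Ξ) =>
      (hessYY (batchAvg ghat p.2) p.1.1.1 p.1.1.2 - hessYY g p.1.1.1 p.1.1.2) p.1.2)
      (fun w => σgyy ^ 2 / n * ‖w.2‖ ^ 2) := by
  have hop := fun w : (X × Y) × Y => operator_noise (N.gyy_integrable n hn w.1.1 w.1.2)
    (N.gyy_unbiased n hn w.1.1 w.1.2) (N.gyy_sq_integrable n hn w.1.1 w.1.2)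
    (N.gyy_variance n hn w.1.1 w.1.2) w.2
  refine ⟨?_, fun w => (hop w).1, fun w => (hop w).2.1, fun w => (hop w).2.2.1,
    fun w => (hop w).2.2.2, by fun_prop⟩
  exact measurable_clm_apply (Measurable.sub
    (M.measurable_hessYY (by fun_prop) (by fun_prop) (by fun_prop))
    (H.measurable_hessYY hMg (by fun_prop) (by fun_prop))) (by fun_prop)

theorem isCentered_hessXY (N : NoiseAssumptions P f g fhat ghat σf σg σgxy σgyy)
    (M : StochasticModel P f g fhat ghat) (H : BilevelAssumptions f g Lf B Mg Lg' Lg μg)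
    (hMg : 0 < Mg) (hn : 1 ≤ n) :
    IsCentered P n (fun p : ((X × Y) × Y) × (Fin n → Ξ) =>
      (hessXY (batchAvg ghat p.2) p.1.1.1 p.1.1.2 - hessXY g p.1.1.1 p.1.1.2) p.1.2)
      (fun w => σgxy ^ 2 / n * ‖w.2‖ ^ 2) := by
  have hop := fun w : (X × Y) × Y => operator_noise (N.gxy_integrable n hn w.1.1 w.1.2)
    (N.gxy_unbiased n hn w.1.1 w.1.2) (N.gxy_sq_integrable n hn w.1.1 w.1.2)
    (N.gxy_variance n hn w.1.1 w.1.2) w.2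
  refine ⟨?_, fun w => (hop w).1, fun w => (hop w).2.1, fun w => (hop w).2.2.1,
    fun w => (hop w).2.2.2, by fun_prop⟩
  exact measurable_clm_apply (Measurable.sub
    (M.measurable_hessXY (by fun_prop) (by fun_prop) (by fun_prop))
    (H.measurable_hessXY hMg (by fun_prop) (by fun_prop))) (by fun_prop)

end NoiseAssumptions

end Oracles

/-! ### Order of the sampling times, and a scalar affine recursion -/

theorem instant_lt_of_inner {k j t t' : ℕ} (h : t < t') : instant k j t < instant k j t' := by
  simp [instant, Prod.Lex.toLex_lt_toLex, h]

theorem instant_lt_of_phase {k j j' t t' : ℕ} (h : j < j') : instant k j t < instant k j' t' := by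
  simp [instant, Prod.Lex.toLex_lt_toLex, h]

theorem instant_lt_of_outer {k k' j j' t t' : ℕ} (h : k < k') :
    instant k j t < instant k' j' t' := by
  simp [instant, Prod.Lex.toLex_lt_toLex, h]

/-- D is the fixed point of r ↦ ρ r + (1 − ρ) D, so the excess over D contracts by ρ. -/
theorem affine_recursion_le {r : ℕ → ℝ} {ρ D : ℝ} (hρ : 0 ≤ ρ)
    (h : ∀ t, r (t + 1) ≤ ρ * r t + (1 - ρ) * D) (t : ℕ) (hD : 0 ≤ D) :
    r t ≤ ρ ^ t * r 0 + D := by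
  induction t with
  | zero => simpa using hD
  | succ t ih =>
    refine (h t).trans ?_
    have := mul_le_mul_of_nonneg_left ih hρ
    rw [pow_succ]
    linarith

/-! ### Mean-square contraction of the steps of the two inner algorithms -/

section Iteration

variable {X Y Ξ Ω : Type*}
  [NormedAddCommGroup X] [InnerProductSpace ℝ X] [CompleteSpace X] [FiniteDimensional ℝ X]
  [MeasurableSpace X] [BorelSpace X]
  [NormedAddCommGroup Y] [InnerProductSpace ℝ Y] [CompleteSpace Y] [FiniteDimensional ℝ Y]
  [MeasurableSpace Y] [BorelSpace Y]
  [mΞ : MeasurableSpace Ξ] [mΩ : MeasurableSpace Ω] {P : Measure Ξ}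
  [IsProbabilityMeasure P] {Pr : Measure Ω} [IsProbabilityMeasure Pr]

/-- A bilevel problem with its stochastic oracles, samples and algorithmic parameters. -/
structure Setup (f g : X → Y → ℝ) (Lf B Mg Lg' Lg μg : ℝ) (P : Measure Ξ)
    (fhat ghat : Ξ → X → Y → ℝ) (σf σg σgxy σgyy : ℝ) (Pr : Measure Ω) (s : SampleIdx → Ω → Ξ)
    (p : Params) [IsProbabilityMeasure P] : Prop where
  hLf : 0 < Lf
  hB : 0 < B
  hMg : 0 < Mg
  hLg' : 0 < Lg'
  hLg : 0 < Lg
  hμg : 0 < μg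
  hμgLg : μg ≤ Lg
  bilevel : BilevelAssumptions f g Lf B Mg Lg' Lg μg
  model : StochasticModel P f g fhat ghat
  noise : NoiseAssumptions P f g fhat ghat σf σg σgxy σgyy
  sampling : IsSampling P Pr s
  hα : p.α = 1 / Lg
  hβ : p.β = 1 / (2 * Lg)
  hng : 1 ≤ p.ng
  hnf : 1 ≤ p.nf
  hngxy : 1 ≤ p.ngxy
  hngyy : 1 ≤ p.ngyy
  -- This makes the part of the Hessian noise that grows with the error of z cost at most half of
  -- the contraction βμ_g.
  stable : 4 * p.β * (σgyy ^ 2 / p.ngyy) ≤ μg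

variable {f g : X → Y → ℝ} {Lf B Mg Lg' Lg μg : ℝ} {fhat ghat : Ξ → X → Y → ℝ}
  {σf σg σgxy σgyy : ℝ} {s : SampleIdx → Ω → Ξ} {p : Params}

/-- The iterates of `ℬ` with exact Hessian `A` and exact gradient `v`. -/
def exactRun (A : Y →L[ℝ] Y) (v : Y) (β : ℝ) (z₀ : Y) : ℕ → Y
  | 0 => z₀
  | t + 1 => exactRun A v β z₀ t - β • (A (exactRun A v β z₀ t) + v)

namespace Setup

variable (S : Setup f g Lf B Mg Lg' Lg μg P fhat ghat σf σg σgxy σgyy Pr s p)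

include S

theorem αμ_le : p.α * μg ≤ 1 := by
  rw [S.hα, one_div, inv_mul_le_iff₀ S.hLg, mul_one]; exact S.hμgLg

theorem βμ_pos : 0 < p.β * μg := by
  have := S.hLg; have := S.hμg; rw [S.hβ]; positivity

theorem βμ_le : p.β * μg ≤ 1 / 2 := by
  have := S.hLg
  rw [S.hβ, one_div, inv_mul_le_iff₀ (by positivity)]
  linarith [S.hμgLg]

theorem memLp_innerSol {x : Ω → X} (hx : MemLp x 2 Pr) :
    MemLp (fun ω => innerSol g (x ω)) 2 Pr := by
  have h1 : MemLp (fun ω => innerSol g (x ω) - innerSol g 0) 2 Pr := by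
    have hc := S.bilevel.continuous_innerSol S.hμg S.hLg
    refine memLp_of_norm_le ((hc.comp_aestronglyMeasurable hx.1).sub
      aestronglyMeasurable_const) hx (c := Lg' / μg) fun ω => ?_
    simpa using S.bilevel.innerSol_lipschitz S.hμg (x ω) 0
  have h2 := h1.add (memLp_const (innerSol g 0))
  simpa [Pi.add_def] using h2

theorem memLp_linSol {x : Ω → X} {y : Ω → Y} (hx : Measurable x) (hy : Measurable y) :
    MemLp (fun ω => linSol f g (x ω) (y ω)) 2 Pr :=
  MemLp.of_bound (S.bilevel.measurable_linSol S.hμg S.hLg S.hMg S.hLf S.hB hx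
    hy).aestronglyMeasurable (B / μg)
    (Eventually.of_forall fun _ => S.bilevel.norm_linSol_le S.hμg S.hLg _ _)

theorem sqMean_linSol_le {x : Ω → X} {y : Ω → Y} (hx : Measurable x) (hy : Measurable y) :
    sqMean Pr (fun ω => linSol f g (x ω) (y ω)) ≤ B ^ 2 / μg ^ 2 := by
  refine (sqMean_le_of_le (S.memLp_linSol hx hy) (integrable_const (B ^ 2 / μg ^ 2))
    fun ω => ?_).trans_eq (by simp)
  rw [← div_pow]
  exact pow_le_pow_left₀ (norm_nonneg _) (S.bilevel.norm_linSol_le S.hμg S.hLg _ _) 2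

/-! #### The inner algorithm `𝒜` -/

section InnerRun

variable {k : ℕ} {x : Ω → X} {y₀ : Ω → Y}

/-- The exact gradient step contracts pointwise, and the sampling error is fresh, hence orthogonal
to it: it only adds α² times its variance. -/
theorem inner_run_step {t : ℕ} {y : Ω → Y} (hx : Measurable[past s (instant k 0 t)] x)
    (hy : Measurable[past s (instant k 0 t)] y)
    (hy2 : MemLp (fun ω => y ω - innerSol g (x ω)) 2 Pr) :
    let y' := fun ω => y ω - p.α • gradY (batchAvg ghat fun i : Fin p.ng => s (.g k t i) ω)
      (x ω) (y ω)
    Measurable[past s (instant k 0 (t + 1))] y' ∧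
    MemLp (fun ω => y' ω - innerSol g (x ω)) 2 Pr ∧
    sqMean Pr (fun ω => y' ω - innerSol g (x ω)) ≤
      (1 - p.α * μg) * sqMean Pr (fun ω => y ω - innerSol g (x ω))
        + p.α ^ 2 * (σg ^ 2 / p.ng) := by
  intro y'
  have hlt : instant k 0 t < instant k 0 (t + 1) := instant_lt_of_inner (Nat.lt_succ_self t)
  have hmono := past_mono s hlt.le
  have hpl := S.sampling.past_le (instant k 0 t)
  have hidx : ∀ i : Fin p.ng, (SampleIdx.g k t i).time = instant k 0 t := fun _ => rfl
  have hinj : Function.Injective fun i : Fin p.ng => SampleIdx.g k t i := fun i j h => by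
    simpa [Fin.ext_iff] using h
  have hym : Measurable[past s (instant k 0 (t + 1))] y' := by
    have h1 := S.model.measurable_gradY_inner (hx.mono hmono le_rfl) (hy.mono hmono le_rfl)
      (measurable_batch s hidx hlt)
    exact (hy.mono hmono le_rfl).sub (h1.const_smul p.α)
  refine ⟨hym, ?_⟩
  have hxy : Measurable[past s (instant k 0 t)] (fun ω => (x ω, y ω)) := hx.prodMk hy
  have hG := S.bilevel.measurable_gradY_inner hx hy
  have hφ : Measurable[past s (instant k 0 t)]
      (fun ω => y ω - p.α • gradY g (x ω) (y ω) - innerSol g (x ω)) := by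
    have h1 := (S.bilevel.continuous_innerSol S.hμg S.hLg).measurable.comp hx
    exact (hy.sub (hG.const_smul p.α)).sub h1
  have hcontr : ∀ ω, ‖y ω - p.α • gradY g (x ω) (y ω) - innerSol g (x ω)‖ ^ 2
      ≤ (1 - p.α * μg) * ‖y ω - innerSol g (x ω)‖ ^ 2 := fun ω => by
    rw [S.hα]; exact S.bilevel.norm_inner_step_sq_le S.hμg S.hLg (x ω) (y ω)
  have hφ2 : MemLp (fun ω => y ω - p.α • gradY g (x ω) (y ω) - innerSol g (x ω)) 2 Pr := by
    refine memLp_of_norm_le (hφ.mono hpl le_rfl).aestronglyMeasurable hy2 (c := 1) fun ω => ?_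
    rw [one_mul]
    refine (pow_le_pow_iff_left₀ (norm_nonneg _) (norm_nonneg _) two_ne_zero).1 ?_
    refine (hcontr ω).trans (mul_le_of_le_one_left (by positivity) ?_)
    have : 0 < p.α * μg := by rw [S.hα]; have := S.hLg; have := S.hμg; positivity
    linarith
  have h3 := (S.noise.isCentered_inner S.model S.bilevel S.hng).memLp_and_sqMean_sub_smul_le
    S.sampling hxy hinj hidx (integrable_const _) hφ hφ2 p.α
  have e : (fun ω => y' ω - innerSol g (x ω)) = fun ω =>
      (y ω - p.α • gradY g (x ω) (y ω) - innerSol g (x ω)) - p.α •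
        (gradY (batchAvg ghat fun i : Fin p.ng => s (.g k t i) ω) (x ω) (y ω)
          - gradY g (x ω) (y ω)) := by
    funext ω; simp only [y', smul_sub]; abel
  rw [e]
  refine ⟨h3.1, h3.2.trans ?_⟩
  have h4 := sqMean_mono hφ2 hy2 hcontr
  simp only [integral_const, probReal_univ, one_smul]
  gcongr

/-- The noise floor is the variance α²σ_g²/|D_g| added per step, divided by the loss 1 − ρ = αμ_g.
-/
theorem inner_run (hx : Measurable[past s (instant k 0 0)] x)
    (hy : Measurable[past s (instant k 0 0)] y₀) (hx2 : MemLp x 2 Pr) (hy2 : MemLp y₀ 2 Pr)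
    (T : ℕ) :
    let y := fun ω => algA ghat p.α (fun t (i : Fin p.ng) => s (.g k t i) ω) (x ω) (y₀ ω) T
    Measurable[past s (instant k 0 T)] y ∧
    MemLp (fun ω => y ω - innerSol g (x ω)) 2 Pr ∧
    sqMean Pr (fun ω => y ω - innerSol g (x ω)) ≤
      (1 - p.α * μg) ^ T * sqMean Pr (fun ω => y₀ ω - innerSol g (x ω))
        + p.α * σg ^ 2 / (μg * p.ng) := by
  set y := fun t ω => algA ghat p.α (fun t (i : Fin p.ng) => s (.g k t i) ω) (x ω) (y₀ ω) t
    with hydef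
  have key : ∀ t, Measurable[past s (instant k 0 t)] (y t) ∧
      MemLp (fun ω => y t ω - innerSol g (x ω)) 2 Pr := by
    intro t
    induction t with
    | zero => exact ⟨hy, hy2.sub (S.memLp_innerSol hx2)⟩
    | succ t ih =>
      have h1 := S.inner_run_step (hx.mono (past_mono s ?_) le_rfl) ih.1 ih.2
      · exact ⟨h1.1, h1.2.1⟩
      · rcases Nat.eq_zero_or_pos t with h | h
        · rw [h]
        · exact (instant_lt_of_inner h).le
  refine ⟨(key T).1, (key T).2, ?_⟩
  refine affine_recursion_le (r := fun t => sqMean Pr (fun ω => y t ω - innerSol g (x ω)))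
    (by linarith [S.αμ_le]) (fun t => ?_) T ?_
  · have hx' : Measurable[past s (instant k 0 t)] x := by
      refine hx.mono (past_mono s ?_) le_rfl
      rcases Nat.eq_zero_or_pos t with h | h
      · rw [h]
      · exact (instant_lt_of_inner h).le
    refine (S.inner_run_step hx' (key t).1 (key t).2).2.2.trans_eq ?_
    have := S.hμg.ne'
    have h1 : (p.ng : ℝ) ≠ 0 := by have := S.hng; positivity
    field_simp
    ring
  · have := S.hμg; have := S.hLg; rw [S.hα]; positivity

end InnerRun

/-! #### The inner algorithm `ℬ` -/

section LinearRun

variable {k : ℕ} {x : Ω → X} {y z₀ v : Ω → Y}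

/-- With r = z − z⋆, a step maps r to (I − βA)r − β(v − ∂_y f) − β(Â − A)z, where only the last term
is fresh. The error of v is common to all steps of the run and need not be orthogonal to r, so it is
handled by Young's inequality. The final claim is the orthogonality from which the conditional mean
of the run is computed. -/
theorem linear_run_step {t : ℕ} {z : Ω → Y} (hx : Measurable[past s (instant k 2 t)] x)
    (hy : Measurable[past s (instant k 2 t)] y) (hv : Measurable[past s (instant k 2 t)] v)
    (hz : Measurable[past s (instant k 2 t)] z) (hz2 : MemLp z 2 Pr)
    (hv2 : MemLp (fun ω => v ω - gradY f (x ω) (y ω)) 2 Pr) :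
    let z' := fun ω => z ω - p.β • (hessYY (batchAvg ghat fun i : Fin p.ngyy => s (.gyy k t i) ω)
      (x ω) (y ω) (z ω) + v ω)
    Measurable[past s (instant k 2 (t + 1))] z' ∧ MemLp z' 2 Pr ∧
    sqMean Pr (fun ω => z' ω - linSol f g (x ω) (y ω)) ≤
      (1 - p.β * μg / 2) * sqMean Pr (fun ω => z ω - linSol f g (x ω) (y ω))
        + (1 - (1 - p.β * μg / 2)) *
          (6 * sqMean Pr (fun ω => v ω - gradY f (x ω) (y ω)) / μg ^ 2
            + 4 * p.β * (σgyy ^ 2 / p.ngyy) * B ^ 2 / μg ^ 3) ∧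
    ∀ φ : Ω → Y, Measurable[past s (instant k 2 t)] φ → MemLp φ 2 Pr →
      ∫ ω, inner ℝ (φ ω) ((hessYY (batchAvg ghat fun i : Fin p.ngyy => s (.gyy k t i) ω)
        (x ω) (y ω) - hessYY g (x ω) (y ω)) (z ω)) ∂Pr = 0 ∧
      MemLp (fun ω => (hessYY (batchAvg ghat fun i : Fin p.ngyy => s (.gyy k t i) ω)
        (x ω) (y ω) - hessYY g (x ω) (y ω)) (z ω)) 2 Pr := by
  intro z'
  have hlt : instant k 2 t < instant k 2 (t + 1) := instant_lt_of_inner (Nat.lt_succ_self t)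
  have hmono := past_mono s hlt.le
  have hpl := S.sampling.past_le (instant k 2 t)
  have hidx : ∀ i : Fin p.ngyy, (SampleIdx.gyy k t i).time = instant k 2 t := fun _ => rfl
  have hinj : Function.Injective fun i : Fin p.ngyy => SampleIdx.gyy k t i := fun i j h => by
    simpa [Fin.ext_iff] using h
  have hzm : Measurable[past s (instant k 2 (t + 1))] z' := by
    have h1 := measurable_clm_apply (S.model.measurable_hessYY (hx.mono hmono le_rfl)
      (hy.mono hmono le_rfl) (measurable_batch s hidx hlt)) (hz.mono hmono le_rfl)
    exact (hz.mono hmono le_rfl).sub ((h1.add (hv.mono hmono le_rfl)).const_smul p.β)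
  have hW : Measurable[past s (instant k 2 t)] (fun ω => ((x ω, y ω), z ω)) :=
    (hx.prodMk hy).prodMk hz
  have hb : Integrable (fun ω => σgyy ^ 2 / p.ngyy * ‖z ω‖ ^ 2) Pr :=
    (integrable_norm_sq hz2).const_mul _
  have hC := S.noise.isCentered_hessYY S.model S.bilevel S.hMg S.hngyy
  have hl2 : MemLp (fun ω => linSol f g (x ω) (y ω)) 2 Pr :=
    S.memLp_linSol (hx.mono hpl le_rfl) (hy.mono hpl le_rfl)
  have hr2 : MemLp (fun ω => z ω - linSol f g (x ω) (y ω)) 2 Pr := hz2.sub hl2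
  have hlm := S.bilevel.measurable_linSol S.hμg S.hLg S.hMg S.hLf S.hB hx hy
  have hAr : Measurable[past s (instant k 2 t)] (fun ω => hessYY g (x ω) (y ω)
      (z ω - linSol f g (x ω) (y ω))) :=
    measurable_clm_apply (S.bilevel.measurable_hessYY S.hMg hx hy) (hz.sub hlm)
  have hSm : Measurable[past s (instant k 2 t)] (fun ω => (z ω - linSol f g (x ω) (y ω))
      - p.β • hessYY g (x ω) (y ω) (z ω - linSol f g (x ω) (y ω))) :=
    (hz.sub hlm).sub (hAr.const_smul p.β)
  have hcontr : ∀ ω, ‖(z ω - linSol f g (x ω) (y ω))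
      - p.β • hessYY g (x ω) (y ω) (z ω - linSol f g (x ω) (y ω))‖ ^ 2
      ≤ (1 - 3 / 2 * (p.β * μg)) * ‖z ω - linSol f g (x ω) (y ω)‖ ^ 2 := fun ω => by
    rw [S.hβ]
    exact (S.bilevel.isElliptic_hessYY S.hLg (x ω) (y ω)).norm_sub_smul_sq_le S.hμg.le S.hLg _
  have hκ := S.βμ_pos
  have hκ2 := S.βμ_le
  have hS2 : MemLp (fun ω => (z ω - linSol f g (x ω) (y ω))
      - p.β • hessYY g (x ω) (y ω) (z ω - linSol f g (x ω) (y ω))) 2 Pr := by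
    refine memLp_of_norm_le (hSm.mono hpl le_rfl).aestronglyMeasurable hr2 (c := 1) fun ω => ?_
    rw [one_mul]
    refine (pow_le_pow_iff_left₀ (norm_nonneg _) (norm_nonneg _) two_ne_zero).1 ?_
    exact (hcontr ω).trans (mul_le_of_le_one_left (by positivity) (by linarith))
  set φ : Ω → Y := fun ω => ((z ω - linSol f g (x ω) (y ω))
      - p.β • hessYY g (x ω) (y ω) (z ω - linSol f g (x ω) (y ω)))
      - p.β • (v ω - gradY f (x ω) (y ω)) with hφdef
  have hφm : Measurable[past s (instant k 2 t)] φ :=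
    hSm.sub ((hv.sub (S.bilevel.measurable_gradY S.hLf hx hy)).const_smul p.β)
  have hφ2 : MemLp φ 2 Pr := hS2.sub (hv2.const_smul p.β)
  have h3 := hC.memLp_and_sqMean_sub_smul_le S.sampling hW hinj hidx hb hφm hφ2 p.β
  have e : (fun ω => z' ω - linSol f g (x ω) (y ω)) = fun ω => φ ω - p.β •
      ((hessYY (batchAvg ghat fun i : Fin p.ngyy => s (.gyy k t i) ω) (x ω) (y ω)
        - hessYY g (x ω) (y ω)) (z ω)) := by
    funext ω
    have h5 := S.bilevel.hessYY_linSol S.hμg S.hLg (x ω) (y ω)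
    have h6 : gradY f (x ω) (y ω) = - hessYY g (x ω) (y ω) (linSol f g (x ω) (y ω)) := by
      rw [eq_neg_iff_add_eq_zero, add_comm]; exact h5
    simp only [z', hφdef, h6, map_sub, sub_apply]
    module
  have hz'2 : MemLp (fun ω => z' ω - linSol f g (x ω) (y ω)) 2 Pr := by rw [e]; exact h3.1
  refine ⟨hzm, ?_, ?_, fun ψ hψ hψ2 => ⟨hC.integral_inner_eq_zero S.sampling hW hinj hidx hb hψ hψ2,
    (hC.memLp_and_sqMean_le S.sampling hW hinj hidx hb).1⟩⟩
  · have h7 := hz'2.add hl2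
    simpa [Pi.add_def] using h7
  · rw [e]
    refine h3.2.trans ?_
    set r := sqMean Pr (fun ω => z ω - linSol f g (x ω) (y ω)) with hr
    set ν := sqMean Pr (fun ω => v ω - gradY f (x ω) (y ω)) with hν
    set q := σgyy ^ 2 / p.ngyy with hq
    have hq0 : 0 ≤ q := by positivity
    have hr0 : 0 ≤ r := sqMean_nonneg _
    have hν0 : 0 ≤ ν := sqMean_nonneg _
    have hβ0 : 0 < p.β := by have := S.hLg; rw [S.hβ]; positivity
    have hμ := S.hμg
    have h8 : sqMean Pr φ ≤ (1 - p.β * μg) * r + 3 * p.β / μg * ν := by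
      -- Young's parameter βμ_g/2 degrades the factor 1 − (3/2)βμ_g only to 1 − βμ_g.
      have hθ : 0 < p.β * μg / 2 := by positivity
      have h9 : ∀ ω, ‖φ ω‖ ^ 2 ≤ (1 - p.β * μg) * ‖z ω - linSol f g (x ω) (y ω)‖ ^ 2
          + 3 * p.β / μg * ‖v ω - gradY f (x ω) (y ω)‖ ^ 2 := by
        intro ω
        have h10 := norm_add_sq_le_young hθ ((z ω - linSol f g (x ω) (y ω))
          - p.β • hessYY g (x ω) (y ω) (z ω - linSol f g (x ω) (y ω)))
          (- (p.β • (v ω - gradY f (x ω) (y ω))))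
        rw [← sub_eq_add_neg, norm_neg, norm_smul, mul_pow, Real.norm_of_nonneg hβ0.le] at h10
        have h11 := hcontr ω
        refine h10.trans (add_le_add ?_ ?_)
        · refine (mul_le_mul_of_nonneg_left h11 (by positivity)).trans ?_
          rw [← mul_assoc]
          refine mul_le_mul_of_nonneg_right ?_ (by positivity)
          nlinarith
        · rw [← mul_assoc]
          refine mul_le_mul_of_nonneg_right ?_ (by positivity)
          have h12 : (1 + 1 / (p.β * μg / 2)) * p.β ^ 2 = p.β * (p.β * μg + 2) / μg := by
            field_simp
          rw [h12]
          refine div_le_div_of_nonneg_right ?_ hμ.le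
          nlinarith
      have i1 := (integrable_norm_sq hr2).const_mul (1 - p.β * μg)
      have i2 := (integrable_norm_sq hv2).const_mul (3 * p.β / μg)
      refine (sqMean_le_of_le hφ2 (i1.add i2) h9).trans_eq ?_
      rw [integral_add' i1 i2, integral_const_mul, integral_const_mul]
      rfl
    -- The variance is proportional to ‖z‖², not to ‖z − z⋆‖²; splitting off z⋆, which is bounded by
    -- B/μ_g, gives a part for the contraction and a part for the noise floor.
    have h13 : ∫ ω, q * ‖z ω‖ ^ 2 ∂Pr ≤ q * (2 * r + 2 * (B ^ 2 / μg ^ 2)) := by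
      rw [integral_const_mul]
      refine mul_le_mul_of_nonneg_left ?_ hq0
      have h14 := sqMean_add_le hr2 hl2
      simp only [sub_add_cancel] at h14
      refine h14.trans ?_
      have h15 := S.sqMean_linSol_le (hx.mono hpl le_rfl) (hy.mono hpl le_rfl)
      linarith
    have h16 : p.β ^ 2 * ∫ ω, q * ‖z ω‖ ^ 2 ∂Pr
        ≤ p.β ^ 2 * (q * (2 * r + 2 * (B ^ 2 / μg ^ 2))) :=
      mul_le_mul_of_nonneg_left h13 (by positivity)
    -- The stability condition: the rate drops from 1 − βμ_g to 1 − βμ_g/2.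
    have h17 : p.β ^ 2 * q * 2 * r ≤ p.β * μg / 2 * r := by
      refine mul_le_mul_of_nonneg_right ?_ hr0
      have := mul_le_mul_of_nonneg_left S.stable hβ0.le
      linarith
    have h18 : (1 - (1 - p.β * μg / 2)) * (6 * ν / μg ^ 2 + 4 * p.β * q * B ^ 2 / μg ^ 3)
        = 3 * p.β / μg * ν + p.β ^ 2 * q * (2 * (B ^ 2 / μg ^ 2)) := by
      field_simp
      ring
    rw [h18]
    linarith

end LinearRun

end Setup

end Iteration

/-! ### One outer iteration: conditional mean and second moment of the gradient error -/

section Iteration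

variable {X Y Ξ Ω : Type*}
  [NormedAddCommGroup X] [InnerProductSpace ℝ X] [CompleteSpace X] [FiniteDimensional ℝ X]
  [MeasurableSpace X] [BorelSpace X]
  [NormedAddCommGroup Y] [InnerProductSpace ℝ Y] [CompleteSpace Y] [FiniteDimensional ℝ Y]
  [MeasurableSpace Y] [BorelSpace Y]
  [mΞ : MeasurableSpace Ξ] [mΩ : MeasurableSpace Ω] {P : Measure Ξ}
  [IsProbabilityMeasure P] {Pr : Measure Ω} [IsProbabilityMeasure Pr]
  {f g : X → Y → ℝ} {Lf B Mg Lg' Lg μg : ℝ} {fhat ghat : Ξ → X → Y → ℝ}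
  {σf σg σgxy σgyy : ℝ} {s : SampleIdx → Ω → Ξ} {p : Params}

theorem instant_le_inner (k j t : ℕ) : instant k j 0 ≤ instant k j t := by
  rcases Nat.eq_zero_or_pos t with h | h
  · rw [h]
  · exact (instant_lt_of_inner h).le

namespace Setup

variable (S : Setup f g Lf B Mg Lg' Lg μg P fhat ghat σf σg σgxy σgyy Pr s p)

include S

theorem β_pos : 0 < p.β := by have := S.hLg; rw [S.hβ]; positivity

theorem hessYY_linSol_eq (x : X) (y : Y) : gradY f x y = - hessYY g x y (linSol f g x y) := by
  rw [eq_neg_iff_add_eq_zero, add_comm]; exact S.bilevel.hessYY_linSol S.hμg S.hLg x y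

/-- Without noise the rate is better; it is weakened to that of the stochastic run so that both
share the factor ρ_B. -/
theorem norm_exactRun_sub_sq_le (x : X) (y z₀ : Y) (t : ℕ) :
    ‖exactRun (hessYY g x y) (gradY f x y) p.β z₀ t - linSol f g x y‖ ^ 2
      ≤ (1 - p.β * μg / 2) ^ t * ‖z₀ - linSol f g x y‖ ^ 2 := by
  induction t with
  | zero => simp [exactRun]
  | succ t ih =>
    set r := exactRun (hessYY g x y) (gradY f x y) p.β z₀ t - linSol f g x y with hr
    have e : exactRun (hessYY g x y) (gradY f x y) p.β z₀ (t + 1) - linSol f g x y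
        = r - (1 / (2 * Lg)) • hessYY g x y r := by
      rw [exactRun, hr, S.hessYY_linSol_eq x y, ← S.hβ, map_sub]
      module
    have h1 := (S.bilevel.isElliptic_hessYY S.hLg x y).norm_sub_smul_sq_le S.hμg.le S.hLg r
    have hκ := S.βμ_pos
    have hκ2 := S.βμ_le
    rw [e]
    refine h1.trans ?_
    rw [← S.hβ, pow_succ]
    calc (1 - 3 / 2 * (p.β * μg)) * ‖r‖ ^ 2 ≤ (1 - p.β * μg / 2) * ‖r‖ ^ 2 := by
          refine mul_le_mul_of_nonneg_right ?_ (by positivity)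
          linarith
      _ ≤ (1 - p.β * μg / 2) * ((1 - p.β * μg / 2) ^ t * ‖z₀ - linSol f g x y‖ ^ 2) :=
          mul_le_mul_of_nonneg_left ih (by linarith)
      _ = _ := by ring

section LinearRun

variable {k : ℕ} {x : Ω → X} {y z₀ v : Ω → Y}

theorem measurable_exactRun {α : Type*} {m : MeasurableSpace α} {x : α → X} {y z₀ : α → Y} (hx : Measurable x) (hy : Measurable y)
    (hz : Measurable z₀) (t : ℕ) : Measurable fun ω : α =>
      exactRun (hessYY g (x ω) (y ω)) (gradY f (x ω) (y ω)) p.β (z₀ ω) t := by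
  induction t with
  | zero => exact hz
  | succ t ih =>
    exact ih.sub (((measurable_clm_apply (S.bilevel.measurable_hessYY S.hMg hx hy) ih).add
      (S.bilevel.measurable_gradY S.hLf hx hy)).const_smul p.β)

theorem memLp_exactRun (hx : Measurable x) (hy : Measurable y) (hz : Measurable z₀)
    (hz2 : MemLp z₀ 2 Pr) (t : ℕ) : MemLp (fun ω =>
      exactRun (hessYY g (x ω) (y ω)) (gradY f (x ω) (y ω)) p.β (z₀ ω) t) 2 Pr := by
  have hl2 : MemLp (fun ω => linSol f g (x ω) (y ω)) 2 Pr := S.memLp_linSol hx hy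
  have h1 : MemLp (fun ω =>
      exactRun (hessYY g (x ω) (y ω)) (gradY f (x ω) (y ω)) p.β (z₀ ω) t
        - linSol f g (x ω) (y ω)) 2 Pr := by
    refine memLp_of_norm_le ((S.measurable_exactRun hx hy hz t).sub
      (S.bilevel.measurable_linSol S.hμg S.hLg S.hMg S.hLf S.hB hx hy)).aestronglyMeasurable
      (hz2.sub hl2) (c := 1) fun ω => ?_
    rw [one_mul]
    refine (pow_le_pow_iff_left₀ (norm_nonneg _) (norm_nonneg _) two_ne_zero).1 ?_
    refine (S.norm_exactRun_sub_sq_le _ _ _ _).trans (mul_le_of_le_one_left (by positivity) ?_)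
    exact pow_le_one₀ (by linarith [S.βμ_le]) (by linarith [S.βμ_pos])
  simpa [Pi.add_def] using h1.add hl2

theorem memLp_hessYY_apply (hx : Measurable x) (hy : Measurable y) {φ : Ω → Y}
    (hφ : Measurable φ) (hφ2 : MemLp φ 2 Pr) :
    MemLp (fun ω => hessYY g (x ω) (y ω) (φ ω)) 2 Pr :=
  memLp_of_norm_le (measurable_clm_apply (S.bilevel.measurable_hessYY S.hMg hx hy)
    hφ).aestronglyMeasurable hφ2 (c := Lg) fun _ =>
    ContinuousLinearMap.le_of_opNorm_le _ (S.bilevel.norm_hessYY_le S.hLg _ _) _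

/-- The last claim says in weak form that, given the samples drawn before D_f, the mean of z is the
exact run. It is what keeps the noise floor of z out of the bias. -/
theorem linear_run (hx : Measurable[past s (instant k 1 0)] x)
    (hy : Measurable[past s (instant k 1 0)] y) (hz : Measurable[past s (instant k 1 0)] z₀)
    (hv : Measurable[past s (instant k 2 0)] v) (hz2 : MemLp z₀ 2 Pr)
    (hv2 : MemLp (fun ω => v ω - gradY f (x ω) (y ω)) 2 Pr)
    (hv0 : ∀ φ : Ω → Y, Measurable[past s (instant k 1 0)] φ → MemLp φ 2 Pr →
      ∫ ω, inner ℝ (φ ω) (v ω - gradY f (x ω) (y ω)) ∂Pr = 0) (N : ℕ) :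
    let z := fun ω =>
      algB ghat p.β (fun t (i : Fin p.ngyy) => s (.gyy k t i) ω) (x ω) (y ω) (v ω) (z₀ ω) N
    Measurable[past s (instant k 2 N)] z ∧ MemLp z 2 Pr ∧
    sqMean Pr (fun ω => z ω - linSol f g (x ω) (y ω)) ≤
      (1 - p.β * μg / 2) ^ N * sqMean Pr (fun ω => z₀ ω - linSol f g (x ω) (y ω))
        + (6 * sqMean Pr (fun ω => v ω - gradY f (x ω) (y ω)) / μg ^ 2
            + 4 * p.β * (σgyy ^ 2 / p.ngyy) * B ^ 2 / μg ^ 3) ∧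
    ∀ φ : Ω → Y, Measurable[past s (instant k 1 0)] φ → MemLp φ 2 Pr →
      ∫ ω, inner ℝ (φ ω) (z ω - exactRun (hessYY g (x ω) (y ω)) (gradY f (x ω) (y ω)) p.β
        (z₀ ω) N) ∂Pr = 0 := by
  set z := fun t ω =>
    algB ghat p.β (fun t (i : Fin p.ngyy) => s (.gyy k t i) ω) (x ω) (y ω) (v ω) (z₀ ω) t
    with hzdef
  have hm12 : ∀ t, past s (instant k 1 0) ≤ past s (instant k 2 t) := fun t =>
    past_mono s (instant_lt_of_phase (by norm_num)).le
  have hx' := fun t => hx.mono (hm12 t) le_rfl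
  have hy' := fun t => hy.mono (hm12 t) le_rfl
  have hv' := fun t => hv.mono (past_mono s (instant_le_inner k 2 t)) le_rfl
  have hpl := S.sampling.past_le (instant k 1 0)
  have hxΩ := hx.mono hpl le_rfl
  have hyΩ := hy.mono hpl le_rfl
  have hzΩ := hz.mono hpl le_rfl
  have key : ∀ t, Measurable[past s (instant k 2 t)] (z t) ∧ MemLp (z t) 2 Pr := by
    intro t
    induction t with
    | zero => exact ⟨hz.mono (hm12 0) le_rfl, hz2⟩
    | succ t ih =>
      have h1 := S.linear_run_step (hx' t) (hy' t) (hv' t) ih.1 ih.2 hv2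
      exact ⟨h1.1, h1.2.1⟩
  refine ⟨(key N).1, (key N).2, ?_, ?_⟩
  · refine affine_recursion_le (r := fun t => sqMean Pr (fun ω => z t ω
      - linSol f g (x ω) (y ω))) (by linarith [S.βμ_le]) (fun t => ?_) N ?_
    · exact (S.linear_run_step (hx' t) (hy' t) (hv' t) (key t).1 (key t).2 hv2).2.2.1
    · have := S.β_pos
      have := S.hμg
      have := sqMean_nonneg (Pr := Pr) (fun ω => v ω - gradY f (x ω) (y ω))
      positivity
  -- The induction is over all test vectors at once: the error of the mean is multiplied by I − βA,
  -- and the symmetry of A moves this operator to φ. As A depends on (x, y) only, φ − βAφ is again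
  -- an admissible test vector.
  · have horth : ∀ t, ∀ φ : Ω → Y, Measurable[past s (instant k 1 0)] φ → MemLp φ 2 Pr →
        ∫ ω, inner ℝ (φ ω) (z t ω - exactRun (hessYY g (x ω) (y ω)) (gradY f (x ω) (y ω)) p.β
          (z₀ ω) t) ∂Pr = 0 := by
      intro t
      induction t with
      | zero => intro φ _ _; simp [hzdef, algB, exactRun]
      | succ t ih =>
        intro φ hφ hφ2
        obtain ⟨o1, o2⟩ := (S.linear_run_step (hx' t) (hy' t) (hv' t) (key t).1 (key t).2 hv2).2.2.2
          φ (hφ.mono (hm12 t) le_rfl) hφ2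
        have hAφ : Measurable[past s (instant k 1 0)] (fun ω => hessYY g (x ω) (y ω) (φ ω)) :=
          measurable_clm_apply (S.bilevel.measurable_hessYY S.hMg hx hy) hφ
        have hAφ2 := S.memLp_hessYY_apply hxΩ hyΩ (hφ.mono hpl le_rfl) hφ2
        have o3 := ih (fun ω => φ ω - p.β • hessYY g (x ω) (y ω) (φ ω))
          (hφ.sub (hAφ.const_smul p.β)) (hφ2.sub (hAφ2.const_smul p.β))
        have o4 := hv0 φ hφ hφ2
        have hd2 := (key t).2.sub (S.memLp_exactRun hxΩ hyΩ hzΩ hz2 t)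
        have i1 := integrable_inner_of_memLp (hφ2.sub (hAφ2.const_smul p.β)) hd2
        have i2 := (integrable_inner_of_memLp hφ2 o2).const_mul p.β
        have i3 := (integrable_inner_of_memLp hφ2 hv2).const_mul p.β
        have e : ∀ ω, inner ℝ (φ ω) (z (t + 1) ω - exactRun (hessYY g (x ω) (y ω))
              (gradY f (x ω) (y ω)) p.β (z₀ ω) (t + 1))
            = inner ℝ (φ ω - p.β • hessYY g (x ω) (y ω) (φ ω))
                (z t ω - exactRun (hessYY g (x ω) (y ω)) (gradY f (x ω) (y ω)) p.β (z₀ ω) t)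
              - p.β * inner ℝ (φ ω) ((hessYY (batchAvg ghat fun i : Fin p.ngyy =>
                  s (.gyy k t i) ω) (x ω) (y ω) - hessYY g (x ω) (y ω)) (z t ω))
              - p.β * inner ℝ (φ ω) (v ω - gradY f (x ω) (y ω)) := by
          intro ω
          have h1 : z (t + 1) ω = z t ω - p.β • (hessYY (batchAvg ghat fun i : Fin p.ngyy =>
                  s (.gyy k t i) ω) (x ω) (y ω) (z t ω) + v ω) := rfl
          rw [h1, exactRun, inner_sub_left, inner_smul_left, S.bilevel.twice.hessYY_symm,
            conj_trivial, ← inner_smul_right, ← inner_smul_right, ← inner_smul_right,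
            ← inner_sub_right, ← inner_sub_right, ← inner_sub_right]
          congr 1
          simp only [sub_apply, map_sub]
          module
        have h5 := integral_sub (i1.sub i2) i3
        have h6 := integral_sub i1 i2
        refine (integral_congr_ae (ae_of_all _ e)).trans (h5.trans ?_)
        refine (congrArg₂ (· - ·) h6 rfl).trans ?_
        rw [integral_const_mul, integral_const_mul, o1, o4]
        simpa using o3
    exact horth N

end LinearRun

/-! #### One outer iteration -/

/-- The estimates for one outer iteration, from `w = (x, y₀, z₀)` to `w'`. -/
structure _root_.AmIGO.IterationBounds (f g : X → Y → ℝ) (Lf B Mg Lg' μg : ℝ)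
    (σf σg σgxy σgyy : ℝ) (Pr : Measure Ω) (s : SampleIdx → Ω → Ξ) (p : Params) (k : ℕ)
    (w w' : Ω → X × Y × Y) : Prop where
  measurable : Measurable[past s (instant (k + 1) 0 0)] w'
  memLp_x : MemLp (fun ω => (w' ω).1) 2 Pr
  memLp_y : MemLp (fun ω => (w' ω).2.1) 2 Pr
  memLp_z : MemLp (fun ω => (w' ω).2.2) 2 Pr
  inner_le : sqMean Pr (fun ω => (w' ω).2.1 - innerSol g (w ω).1) ≤
    (1 - p.α * μg) ^ p.T * sqMean Pr (fun ω => (w ω).2.1 - innerSol g (w ω).1)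
      + p.α * σg ^ 2 / (μg * p.ng)
  linear_le : sqMean Pr (fun ω => (w' ω).2.2 - linSol f g (w ω).1 (w' ω).2.1) ≤
    (1 - p.β * μg / 2) ^ p.N * sqMean Pr (fun ω => (w ω).2.2 - linSol f g (w ω).1 (w' ω).2.1)
      + (6 * (σf ^ 2 / p.nf) / μg ^ 2 + 4 * p.β * (σgyy ^ 2 / p.ngyy) * B ^ 2 / μg ^ 3)
  -- e is the whole error of the gradient estimate; b has the same pairings with the past. The bound
  -- of b contains ρ_B times the initial error of z instead of its final error, and no variance of
  -- the batches D_f, D_gxy or D_gyy apart from the errors at hand.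
  exists_error : ∃ e b : Ω → X, MemLp e 2 Pr ∧ MemLp b 2 Pr ∧
    (∀ ω, (w' ω).1 = (w ω).1 - p.γ • (lossGrad f g (w ω).1 + e ω)) ∧
    (∀ φ : Ω → X, Measurable[past s (instant k 1 0)] φ → MemLp φ 2 Pr →
      ∫ ω, inner ℝ (φ ω) (e ω) ∂Pr = ∫ ω, inner ℝ (φ ω) (b ω) ∂Pr) ∧
    sqMean Pr b ≤
      2 * (Lf + Mg * B / μg + Lg' * (Lf / μg + Mg * B / μg ^ 2)) ^ 2
          * sqMean Pr (fun ω => (w' ω).2.1 - innerSol g (w ω).1)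
        + 2 * Lg' ^ 2 * ((1 - p.β * μg / 2) ^ p.N
          * sqMean Pr (fun ω => (w ω).2.2 - linSol f g (w ω).1 (w' ω).2.1)) ∧
    sqMean Pr e ≤ 3 * (σf ^ 2 / p.nf)
      + 3 * (σgxy ^ 2 / p.ngxy * (2 * sqMean Pr (fun ω => (w' ω).2.2
          - linSol f g (w ω).1 (w' ω).2.1) + 2 * (B ^ 2 / μg ^ 2)))
      + 3 * (2 * (Lf + Mg * B / μg + Lg' * (Lf / μg + Mg * B / μg ^ 2)) ^ 2
          * sqMean Pr (fun ω => (w' ω).2.1 - innerSol g (w ω).1)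
        + 2 * Lg' ^ 2 * sqMean Pr (fun ω => (w' ω).2.2 - linSol f g (w ω).1 (w' ω).2.1))

section Outer

variable {k : ℕ} {x : Ω → X} {y z : Ω → Y}

theorem memLp_lossGrad (hx : Measurable x) (hx2 : MemLp x 2 Pr) :
    MemLp (fun ω => lossGrad f g (x ω)) 2 Pr := by
  have h1 : MemLp (fun ω => lossGrad f g (x ω) - lossGrad f g 0) 2 Pr := by
    refine memLp_of_norm_le ((S.bilevel.measurable_lossGrad S.hμg S.hLg S.hMg S.hLf S.hB
      hx).sub measurable_const).aestronglyMeasurable hx2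
      (c := smoothConst Lf B Mg Lg' μg) fun ω => ?_
    simpa using S.bilevel.lossGrad_lipschitz S.hμg S.hLg S.hMg S.hLg' S.hLf S.hB (x ω) 0
  have h2 := h1.add (memLp_const (lossGrad f g 0))
  simpa [Pi.add_def] using h2

theorem memLp_and_sqMean_hyperGrad_sub (hx : Measurable x) (hy : Measurable y)
    (hz : Measurable z) (hy2 : MemLp (fun ω => y ω - innerSol g (x ω)) 2 Pr)
    (hz2 : MemLp (fun ω => z ω - linSol f g (x ω) (y ω)) 2 Pr) :
    MemLp (fun ω => hyperGrad f g (x ω) (y ω) (z ω) - lossGrad f g (x ω)) 2 Pr ∧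
    sqMean Pr (fun ω => hyperGrad f g (x ω) (y ω) (z ω) - lossGrad f g (x ω)) ≤
      2 * (Lf + Mg * B / μg + Lg' * (Lf / μg + Mg * B / μg ^ 2)) ^ 2
          * sqMean Pr (fun ω => y ω - innerSol g (x ω))
        + 2 * Lg' ^ 2 * sqMean Pr (fun ω => z ω - linSol f g (x ω) (y ω)) := by
  set Ly := Lf + Mg * B / μg + Lg' * (Lf / μg + Mg * B / μg ^ 2) with hLy
  have hmeas : Measurable fun ω => hyperGrad f g (x ω) (y ω) (z ω) - lossGrad f g (x ω) :=
    (S.bilevel.measurable_hyperGrad S.hMg S.hLf hx hy hz).sub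
      (S.bilevel.measurable_lossGrad S.hμg S.hLg S.hMg S.hLf S.hB hx)
  have h1 : ∀ ω, ‖hyperGrad f g (x ω) (y ω) (z ω) - lossGrad f g (x ω)‖ ^ 2 ≤
      2 * Ly ^ 2 * ‖y ω - innerSol g (x ω)‖ ^ 2
        + 2 * Lg' ^ 2 * ‖z ω - linSol f g (x ω) (y ω)‖ ^ 2 := fun ω => by
    refine (pow_le_pow_left₀ (norm_nonneg _) (S.bilevel.hyperGrad_sub_lossGrad_le S.hμg S.hLg
      S.hMg S.hLg' (x ω) (y ω) (z ω)) 2).trans ?_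
    refine (sq_add_le_two _ _).trans_eq ?_
    rw [← hLy]
    ring
  have i1 := (integrable_norm_sq hy2).const_mul (2 * Ly ^ 2)
  have i2 := (integrable_norm_sq hz2).const_mul (2 * Lg' ^ 2)
  have hint : Integrable (fun ω => ‖hyperGrad f g (x ω) (y ω) (z ω) - lossGrad f g (x ω)‖ ^ 2)
      Pr := (i1.add i2).mono' (hmeas.norm.pow_const 2).aestronglyMeasurable
      (Eventually.of_forall fun ω => by
        rw [Real.norm_of_nonneg (by positivity)]; exact h1 ω)
  have hmem := (memLp_two_iff_integrable_sq_norm hmeas.aestronglyMeasurable).2 hint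
  refine ⟨hmem, (sqMean_le_of_le hmem (i1.add i2) h1).trans_eq ?_⟩
  rw [integral_add' i1 i2, integral_const_mul, integral_const_mul]
  rfl

/-- The gradient error is the noise of ∂ₓf, the Jacobian noise applied to z, and the deterministic
error of the hypergradient at (y, z). The first two are orthogonal to the past, and the third is
affine in z; replacing z by its conditional mean therefore gives b. -/
theorem iteration {w : Ω → X × Y × Y} (hw : Measurable[past s (instant k 0 0)] w)
    (hx2 : MemLp (fun ω => (w ω).1) 2 Pr) (hy2 : MemLp (fun ω => (w ω).2.1) 2 Pr)
    (hz2 : MemLp (fun ω => (w ω).2.2) 2 Pr) :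
    IterationBounds f g Lf B Mg Lg' μg σf σg σgxy σgyy Pr s p k w
      (fun ω => amigoStep fhat ghat p (fun i => s i ω) k (w ω)) := by
  set x : Ω → X := fun ω => (w ω).1
  set y₀ : Ω → Y := fun ω => (w ω).2.1
  set z₀ : Ω → Y := fun ω => (w ω).2.2
  set y : Ω → Y := fun ω =>
    algA ghat p.α (fun t (i : Fin p.ng) => s (.g k t i) ω) (x ω) (y₀ ω) p.T with hydef
  set u : Ω → X := fun ω => gradX (batchAvg fhat fun i : Fin p.nf => s (.f k i) ω) (x ω) (y ω)
    with hudef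
  set v : Ω → Y := fun ω => gradY (batchAvg fhat fun i : Fin p.nf => s (.f k i) ω) (x ω) (y ω)
    with hvdef
  set z : Ω → Y := fun ω => algB ghat p.β (fun t (i : Fin p.ngyy) => s (.gyy k t i) ω) (x ω)
    (y ω) (v ω) (z₀ ω) p.N with hzdef
  set H : Ω → Y →L[ℝ] X := fun ω =>
    hessXY (batchAvg ghat fun i : Fin p.ngxy => s (.gxy k i) ω) (x ω) (y ω) with hHdef
  set w' : Ω → X × Y × Y := fun ω => amigoStep fhat ghat p (fun i => s i ω) k (w ω) with hw'def
  have hw' : w' = fun ω => (x ω - p.γ • (u ω + H ω (z ω)), y ω, z ω) := rfl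
  -- measurability and the inner run
  have hx0 : Measurable[past s (instant k 0 0)] x := measurable_fst.comp hw
  have hy0 : Measurable[past s (instant k 0 0)] y₀ := (measurable_fst.comp measurable_snd).comp hw
  have hz0 : Measurable[past s (instant k 0 0)] z₀ := (measurable_snd.comp measurable_snd).comp hw
  have m01 : past s (instant k 0 0) ≤ past s (instant k 1 0) :=
    past_mono s (instant_lt_of_phase (by norm_num)).le
  have m12 : past s (instant k 1 0) ≤ past s (instant k 2 0) :=
    past_mono s (instant_lt_of_phase (by norm_num)).le
  have m13 : past s (instant k 1 0) ≤ past s (instant k 3 0) :=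
    past_mono s (instant_lt_of_phase (by norm_num)).le
  have m23 : past s (instant k 2 p.N) ≤ past s (instant k 3 0) :=
    past_mono s (instant_lt_of_phase (by norm_num)).le
  have m24 : past s (instant k 2 0) ≤ past s (instant (k + 1) 0 0) :=
    past_mono s (instant_lt_of_outer (Nat.lt_succ_self k)).le
  have m34 : past s (instant k 3 0) ≤ past s (instant (k + 1) 0 0) :=
    past_mono s (instant_lt_of_outer (Nat.lt_succ_self k)).le
  obtain ⟨hyT, hyr2, hyle⟩ := S.inner_run hx0 hy0 hx2 hy2 p.T
  have hx1 := hx0.mono m01 le_rfl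
  have hy1 : Measurable[past s (instant k 1 0)] y :=
    hyT.mono (past_mono s (instant_lt_of_phase (by norm_num)).le) le_rfl
  have hz1 := hz0.mono m01 le_rfl
  have hpl := S.sampling.past_le
  have hxΩ : Measurable x := hx1.mono (hpl _) le_rfl
  have hyΩ : Measurable y := hy1.mono (hpl _) le_rfl
  have hz0Ω : Measurable z₀ := hz1.mono (hpl _) le_rfl
  -- the batch `D_f`
  have hidxf : ∀ i : Fin p.nf, (SampleIdx.f k i).time = instant k 1 0 := fun _ => rfl
  have hinjf : Function.Injective fun i : Fin p.nf => SampleIdx.f k i := fun i j h => by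
    simpa [Fin.ext_iff] using h
  have hDf := measurable_batch s hidxf (instant_lt_of_phase (k := k) (t := 0) (t' := 0)
    (by norm_num : 1 < 2))
  have hxy1 : Measurable[past s (instant k 1 0)] (fun ω => (x ω, y ω)) := hx1.prodMk hy1
  have hu2m : Measurable[past s (instant k 2 0)] u :=
    S.model.measurable_gradX (hx1.mono m12 le_rfl) (hy1.mono m12 le_rfl) hDf
  have hv2m : Measurable[past s (instant k 2 0)] v :=
    S.model.measurable_gradY (hx1.mono m12 le_rfl) (hy1.mono m12 le_rfl) hDf
  have hCu := S.noise.isCentered_gradX S.model S.bilevel S.hLf S.hnf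
  have hCv := S.noise.isCentered_gradY S.model S.bilevel S.hLf S.hnf
  obtain ⟨hu2, hule⟩ := hCu.memLp_and_sqMean_le S.sampling hxy1 hinjf hidxf (integrable_const _)
  obtain ⟨hv2, hvle⟩ := hCv.memLp_and_sqMean_le S.sampling hxy1 hinjf hidxf (integrable_const _)
  simp only [integral_const, probReal_univ, one_smul] at hule hvle
  have hv0 : ∀ φ : Ω → Y, Measurable[past s (instant k 1 0)] φ → MemLp φ 2 Pr →
      ∫ ω, inner ℝ (φ ω) (v ω - gradY f (x ω) (y ω)) ∂Pr = 0 := fun φ hφ hφ2 =>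
    hCv.integral_inner_eq_zero S.sampling hxy1 hinjf hidxf (integrable_const _) hφ hφ2
  have hu0 : ∀ φ : Ω → X, Measurable[past s (instant k 1 0)] φ → MemLp φ 2 Pr →
      ∫ ω, inner ℝ (φ ω) (u ω - gradX f (x ω) (y ω)) ∂Pr = 0 := fun φ hφ hφ2 =>
    hCu.integral_inner_eq_zero S.sampling hxy1 hinjf hidxf (integrable_const _) hφ hφ2
  -- the linear run
  obtain ⟨hzN, hzL2, hzle, hzorth⟩ := S.linear_run hx1 hy1 hz1 hv2m hz2 hv2 hv0 p.N
  have hz3 : Measurable[past s (instant k 3 0)] z := hzN.mono m23 le_rfl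
  have hzΩ : Measurable z := hz3.mono (hpl _) le_rfl
  have hl2 : MemLp (fun ω => linSol f g (x ω) (y ω)) 2 Pr := S.memLp_linSol hxΩ hyΩ
  have hzr2 : MemLp (fun ω => z ω - linSol f g (x ω) (y ω)) 2 Pr := hzL2.sub hl2
  -- the batch `D_gxy`
  have hidxg : ∀ i : Fin p.ngxy, (SampleIdx.gxy k i).time = instant k 3 0 := fun _ => rfl
  have hinjg : Function.Injective fun i : Fin p.ngxy => SampleIdx.gxy k i := fun i j h => by
    simpa [Fin.ext_iff] using h
  have hDg := measurable_batch s hidxg (instant_lt_of_outer (j := 3) (j' := 0) (t := 0) (t' := 0)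
    (Nat.lt_succ_self k))
  have hx3 := hx1.mono m13 le_rfl
  have hy3 := hy1.mono m13 le_rfl
  have hW3 : Measurable[past s (instant k 3 0)] (fun ω => ((x ω, y ω), z ω)) :=
    (hx3.prodMk hy3).prodMk hz3
  have hHm : Measurable[past s (instant (k + 1) 0 0)] H :=
    S.model.measurable_hessXY (hx3.mono m34 le_rfl) (hy3.mono m34 le_rfl) hDg
  have hCg := S.noise.isCentered_hessXY S.model S.bilevel S.hMg S.hngxy
  have hbg : Integrable (fun ω => σgxy ^ 2 / p.ngxy * ‖z ω‖ ^ 2) Pr :=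
    (integrable_norm_sq hzL2).const_mul _
  obtain ⟨hF2, hFle⟩ := hCg.memLp_and_sqMean_le S.sampling hW3 hinjg hidxg hbg
  have hF0 : ∀ φ : Ω → X, Measurable[past s (instant k 1 0)] φ → MemLp φ 2 Pr →
      ∫ ω, inner ℝ (φ ω) ((H ω - hessXY g (x ω) (y ω)) (z ω)) ∂Pr = 0 := fun φ hφ hφ2 =>
    hCg.integral_inner_eq_zero S.sampling hW3 hinjg hidxg hbg (hφ.mono m13 le_rfl) hφ2
  have hF2 : MemLp (fun ω => (H ω - hessXY g (x ω) (y ω)) (z ω)) 2 Pr := hF2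
  have hFle' : sqMean Pr (fun ω => (H ω - hessXY g (x ω) (y ω)) (z ω)) ≤
      σgxy ^ 2 / p.ngxy * (2 * sqMean Pr (fun ω => z ω - linSol f g (x ω) (y ω))
        + 2 * (B ^ 2 / μg ^ 2)) := by
    refine hFle.trans ?_
    simp only
    rw [integral_const_mul]
    refine mul_le_mul_of_nonneg_left ?_ (by positivity)
    have h14 := sqMean_add_le hzr2 hl2
    simp only [sub_add_cancel] at h14
    exact h14.trans (by linarith [S.sqMean_linSol_le hxΩ hyΩ])
  -- the total error and its mean
  obtain ⟨hg2, hgle⟩ := S.memLp_and_sqMean_hyperGrad_sub hxΩ hyΩ hzΩ hyr2 hzr2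
  set zb : Ω → Y := fun ω => exactRun (hessYY g (x ω) (y ω)) (gradY f (x ω) (y ω)) p.β (z₀ ω) p.N
    with hzb
  have hzb1 : Measurable[past s (instant k 1 0)] zb := S.measurable_exactRun hx1 hy1 hz1 p.N
  have hzbΩ : Measurable zb := hzb1.mono (hpl _) le_rfl
  have hzb2 : MemLp zb 2 Pr := S.memLp_exactRun hxΩ hyΩ hz0Ω hz2 p.N
  have hzbr2 : MemLp (fun ω => zb ω - linSol f g (x ω) (y ω)) 2 Pr := hzb2.sub hl2
  have hz0r2 : MemLp (fun ω => z₀ ω - linSol f g (x ω) (y ω)) 2 Pr := hz2.sub hl2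
  have hzble := sqMean_mono hzbr2 hz0r2 (fun ω =>
    S.norm_exactRun_sub_sq_le (x ω) (y ω) (z₀ ω) p.N)
  obtain ⟨hb2, hble⟩ := S.memLp_and_sqMean_hyperGrad_sub hxΩ hyΩ hzbΩ hyr2 hzbr2
  set e₁ : Ω → X := fun ω => (u ω - gradX f (x ω) (y ω)) + (H ω - hessXY g (x ω) (y ω)) (z ω)
    + (hyperGrad f g (x ω) (y ω) (z ω) - lossGrad f g (x ω)) with he₁
  have he2 : MemLp e₁ 2 Pr := (hu2.add hF2).add hg2
  have hrec : ∀ ω, (w' ω).1 = x ω - p.γ • (lossGrad f g (x ω) + e₁ ω) := fun ω => by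
    have : u ω + H ω (z ω) = lossGrad f g (x ω) + e₁ ω := by
      simp only [he₁, hyperGrad, sub_apply]
      abel
    rw [← this, hw']
  have hwm : Measurable[past s (instant (k + 1) 0 0)] w' := by
    have hx4 := hx3.mono m34 le_rfl
    have hy4 := hy3.mono m34 le_rfl
    have hz4 := hz3.mono m34 le_rfl
    rw [hw']
    exact (hx4.sub (((hu2m.mono m24 le_rfl).add (measurable_clm_apply hHm hz4)).const_smul
      p.γ)).prodMk (hy4.prodMk hz4)
  refine ⟨hwm, ?_, ?_, hzL2, hyle, ?_, e₁, _, he2, hb2, hrec, ?_, ?_, ?_⟩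
  · have h1 : MemLp (fun ω => x ω - p.γ • (lossGrad f g (x ω) + e₁ ω)) 2 Pr :=
      hx2.sub (((S.memLp_lossGrad hxΩ hx2).add he2).const_smul p.γ)
    exact (funext hrec : (fun ω => (w' ω).1) = _) ▸ h1
  · have h1 := hyr2.add (S.memLp_innerSol hx2)
    have h2 : (fun ω => (w' ω).2.1)
        = (fun ω => y ω - innerSol g (x ω)) + fun ω => innerSol g (x ω) := by
      funext ω; simp [hw']
    rw [h2]
    exact h1
  · refine hzle.trans ?_
    have := S.hμg
    exact add_le_add le_rfl (add_le_add (div_le_div_of_nonneg_right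
      (mul_le_mul_of_nonneg_left hvle (by norm_num)) (by positivity)) le_rfl)
  · intro φ hφ hφ2
    have hφΩ := hφ.mono (hpl _) le_rfl
    -- ∂_xy g at (x, y) is known from the past, so its adjoint may be applied to φ, producing a test
    -- vector against which z − zb has mean zero.
    have hadj : ∀ ω (a : Y), inner ℝ (φ ω) (hessXY g (x ω) (y ω) a)
        = inner ℝ (ContinuousLinearMap.adjoint (hessXY g (x ω) (y ω)) (φ ω)) a := fun ω a =>
      (ContinuousLinearMap.adjoint_inner_left _ _ _).symm
    have hadjc : Continuous (fun A : Y →L[ℝ] X => ContinuousLinearMap.adjoint A) :=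
      (ContinuousLinearMap.adjoint (𝕜 := ℝ) (E := Y) (F := X)).continuous
    have hχm : Measurable[past s (instant k 1 0)] (fun ω =>
        ContinuousLinearMap.adjoint (hessXY g (x ω) (y ω)) (φ ω)) :=
      measurable_clm_apply (hadjc.measurable.comp (S.bilevel.measurable_hessXY S.hMg hx1 hy1)) hφ
    have hχ2 : MemLp (fun ω => ContinuousLinearMap.adjoint (hessXY g (x ω) (y ω)) (φ ω)) 2 Pr :=
      memLp_of_norm_le (hχm.mono (hpl _) le_rfl).aestronglyMeasurable hφ2 (c := Lg') fun ω =>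
        ContinuousLinearMap.le_of_opNorm_le _ (by
          rw [LinearIsometryEquiv.norm_map]; exact S.bilevel.norm_hessXY_le S.hLg' _ _) _
    have o1 := hu0 φ hφ hφ2
    have o2 := hF0 φ hφ hφ2
    have o3 := hzorth _ hχm hχ2
    have i1 := integrable_inner_of_memLp hφ2 hu2
    have i2 := integrable_inner_of_memLp hφ2 hF2
    have i3 := integrable_inner_of_memLp hχ2 (hzL2.sub hzb2)
    have i4 := integrable_inner_of_memLp hφ2 hb2
    have e : ∀ ω, inner ℝ (φ ω) (e₁ ω) = inner ℝ (φ ω) (u ω - gradX f (x ω) (y ω))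
        + inner ℝ (φ ω) ((H ω - hessXY g (x ω) (y ω)) (z ω))
        + inner ℝ (ContinuousLinearMap.adjoint (hessXY g (x ω) (y ω)) (φ ω)) (z ω - zb ω)
        + inner ℝ (φ ω) (hyperGrad f g (x ω) (y ω) (zb ω) - lossGrad f g (x ω)) := fun ω => by
      rw [← hadj, ← inner_add_right, ← inner_add_right, ← inner_add_right]
      congr 1
      simp only [he₁, hyperGrad, map_sub]
      abel
    have h1 := integral_add ((i1.add i2).add i3) i4
    have h2 := integral_add (i1.add i2) i3
    have h3 := integral_add i1 i2
    have h4 : ∫ ω, (inner ℝ (φ ω) (u ω - gradX f (x ω) (y ω))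
        + inner ℝ (φ ω) ((H ω - hessXY g (x ω) (y ω)) (z ω))) ∂Pr = 0 :=
      h3.trans (by
        refine (congrArg₂ (· + ·) o1 o2).trans (add_zero _))
    have h5 : ∫ ω, (inner ℝ (φ ω) (u ω - gradX f (x ω) (y ω))
        + inner ℝ (φ ω) ((H ω - hessXY g (x ω) (y ω)) (z ω))
        + inner ℝ (ContinuousLinearMap.adjoint (hessXY g (x ω) (y ω)) (φ ω)) (z ω - zb ω)) ∂Pr
        = 0 := h2.trans ((congrArg₂ (· + ·) h4 o3).trans (add_zero _))
    refine (integral_congr_ae (ae_of_all _ e)).trans (h1.trans ?_)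
    refine (congrArg₂ (· + ·) h5 rfl).trans (zero_add _)
  · exact hble.trans (add_le_add le_rfl (mul_le_mul_of_nonneg_left hzble (by positivity)))
  · have h1 := sqMean_add₃_le hu2 hF2 hg2
    exact h1.trans (add_le_add (add_le_add
      (mul_le_mul_of_nonneg_left hule (by norm_num))
      (mul_le_mul_of_nonneg_left hFle' (by norm_num)))
      (mul_le_mul_of_nonneg_left hgle (by norm_num)))

end Outer

end Setup

end Iteration

/-! ### The weights of the averages -/

theorem eta_le {μ γ η₀ : ℝ} (hγ : 0 ≤ γ) (hγμ : γ * μ ≤ 1) (hμ : 0 < μ) (h : μ ≤ η₀) (k : ℕ) :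
    eta μ γ η₀ k ≤ η₀ := by
  induction k with
  | zero => exact le_rfl
  | succ k ih =>
    have h0 := le_eta hγ hγμ h k
    have h1 : 0 ≤ γ * (eta μ γ η₀ k - μ) := mul_nonneg hγ (sub_nonneg.2 h0)
    refine le_trans ?_ ih
    exact div_le_self (by linarith) (by linarith)

/-- Divided by 2, this is the identity δ_{k+1}(1 − γμ)/(2γ) = (1 − δ_{k+1})η_k/2: the distance terms
then decay by the same factor 1 − δ_{k+1} as the loss of the averages. -/
theorem eta_succ_mul {μ γ η₀ : ℝ} (hγ : 0 ≤ γ) (hγμ : γ * μ ≤ 1) (h : μ ≤ η₀) (k : ℕ) :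
    eta μ γ η₀ (k + 1) * (1 - γ * μ) = (1 - γ * eta μ γ η₀ (k + 1)) * eta μ γ η₀ k := by
  have := eta_succ hγ hγμ h k
  linear_combination this

/-! ### A gradient step with an error -/

section Descent

variable {E : Type*} [NormedAddCommGroup E] [InnerProductSpace ℝ E] [CompleteSpace E]

/-- One inexact gradient step of length `1 / L`. -/
theorem inexact_gradient_step_le {h : E → ℝ} {G : E → E} {m L γ : ℝ} (hL0 : 0 < L)
    (hγ : γ = 1 / L) (hh : StrongConvexOn univ m h) (hG : ∀ x, HasGradientAt h (G x) x)
    (hL : ∀ x y, ‖G x - G y‖ ≤ L * ‖x - y‖) (x₀ x e : E) :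
    h (x - γ • (G x + e)) - h x₀ + 1 / (2 * γ) * ‖x - γ • (G x + e) - x₀‖ ^ 2 ≤
      1 / (2 * γ) * (1 - γ * m) * ‖x - x₀‖ ^ 2 - inner ℝ (x - x₀ - γ • G x) e
        + γ * ‖e‖ ^ 2 := by
  have hγ0 : 0 < γ := by rw [hγ]; positivity
  have hLγ : L = 1 / γ := by rw [hγ]; simp
  -- Smoothness and the expansion of the squared distance each contribute (γ/2)‖G + e‖². With −γ⟨G,
  -- G + e⟩ this leaves γ⟨G, e⟩ + γ‖e‖², so that e enters linearly only against x − x₀ − γG.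
  have h1 := le_of_lipschitz_gradient hG hL x (x - γ • (G x + e))
  have h2 := StrongConvexOn.le_of_hasGradientAt hh (hG x) x₀
  have h3 : ‖x - γ • (G x + e) - x₀‖ ^ 2 = ‖x - x₀‖ ^ 2 - 2 * γ * inner ℝ (G x + e) (x - x₀)
      + γ ^ 2 * ‖G x + e‖ ^ 2 := by
    rw [sub_right_comm, norm_sub_sq_real, norm_smul, inner_smul_right,
      Real.norm_of_nonneg hγ0.le, real_inner_comm]
    ring
  rw [sub_sub_cancel_left, inner_neg_right, norm_neg, norm_smul, inner_smul_right,
    Real.norm_of_nonneg hγ0.le, hLγ] at h1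
  rw [h3]
  have h4 : 1 / (2 * γ) * (‖x - x₀‖ ^ 2 - 2 * γ * inner ℝ (G x + e) (x - x₀)
      + γ ^ 2 * ‖G x + e‖ ^ 2) = 1 / (2 * γ) * ‖x - x₀‖ ^ 2 - inner ℝ (G x + e) (x - x₀)
      + γ / 2 * ‖G x + e‖ ^ 2 := by field_simp
  have h5 : 1 / γ / 2 * (γ * ‖G x + e‖) ^ 2 = γ / 2 * ‖G x + e‖ ^ 2 := by field_simp
  have h6 : 1 / (2 * γ) * (1 - γ * m) * ‖x - x₀‖ ^ 2
      = 1 / (2 * γ) * ‖x - x₀‖ ^ 2 - m / 2 * ‖x - x₀‖ ^ 2 := by field_simp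
  rw [h4, h6]
  rw [h5] at h1
  have h7 : inner ℝ (G x) (x₀ - x) = - inner ℝ (G x) (x - x₀) := by
    rw [← neg_sub, inner_neg_right]
  rw [h7, norm_sub_rev x₀ x] at h2
  have h8 : ‖G x + e‖ ^ 2 = ‖G x‖ ^ 2 + 2 * inner ℝ (G x) e + ‖e‖ ^ 2 := norm_add_sq_real _ _
  rw [inner_add_right, real_inner_self_eq_norm_sq] at h1
  rw [inner_sub_left, inner_smul_left, inner_add_left, conj_trivial,
    real_inner_comm (x - x₀) e]
  rw [h8] at h1 ⊢
  nlinarith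

end Descent

/-! ### The recursion for the errors -/

/-- The inequalities between the errors of consecutive outer iterations. -/
structure ErrorRecursion (ρA ρB Ry Rz Ly lam lz Lg' γ μ vf vxy Bμ : ℝ)
    (δ d Yo Y Zo Z V ee bb Δ : ℕ → ℝ) : Prop where
  Yo_nonneg : ∀ k, 0 ≤ Yo k
  Y_nonneg : ∀ k, 0 ≤ Y k
  Zo_nonneg : ∀ k, 0 ≤ Zo k
  Z_nonneg : ∀ k, 0 ≤ Z k
  V_nonneg : ∀ k, 0 ≤ V k
  ee_nonneg : ∀ k, 0 ≤ ee k
  bb_nonneg : ∀ k, 0 ≤ bb k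
  Y_le : ∀ k, Y k ≤ ρA * Yo k + Ry
  Z_le : ∀ k, Z k ≤ ρB * Zo k + Rz
  bb_le : ∀ k, bb k ≤ 2 * Ly ^ 2 * Y k + 2 * Lg' ^ 2 * (ρB * Zo k)
  ee_le : ∀ k, ee k ≤ 3 * vf + 3 * (vxy * (2 * Z k + 2 * Bμ))
    + 3 * (2 * Ly ^ 2 * Y k + 2 * Lg' ^ 2 * Z k)
  Δ_le : ∀ k, Δ k ≤ 2 * γ ^ 2 * ee k + 2 * d k
  Yo_succ_le : ∀ k, Yo (k + 1) ≤ 2 * Y k + 2 * (lam ^ 2 * Δ k)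
  Zo_succ_le : ∀ k, Zo (k + 1) ≤ 2 * Z k
    + 2 * (lz ^ 2 * (Δ k + (3 * Y (k + 1) + 3 * (lam ^ 2 * Δ k) + 3 * Y k)))
  V_succ_le : ∀ k, V (k + 1) ≤ (1 - δ (k + 1) / 2) * V k
    + δ (k + 1) * (4 / μ * bb k + γ * ee k)
  d_le : ∀ k, d k ≤ 2 / μ * V k

/-! ### The errors of the algorithm satisfy the recursion -/

section Trajectory

variable {X Y Ξ Ω : Type*}
  [NormedAddCommGroup X] [InnerProductSpace ℝ X] [CompleteSpace X] [FiniteDimensional ℝ X]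
  [MeasurableSpace X] [BorelSpace X]
  [NormedAddCommGroup Y] [InnerProductSpace ℝ Y] [CompleteSpace Y] [FiniteDimensional ℝ Y]
  [MeasurableSpace Y] [BorelSpace Y]
  [mΞ : MeasurableSpace Ξ] [mΩ : MeasurableSpace Ω] {P : Measure Ξ}
  [IsProbabilityMeasure P] {Pr : Measure Ω} [IsProbabilityMeasure Pr]
  {f g : X → Y → ℝ} {Lf B Mg Lg' Lg μg : ℝ} {fhat ghat : Ξ → X → Y → ℝ}
  {σf σg σgxy σgyy : ℝ} {s : SampleIdx → Ω → Ξ} {p : Params}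

/-- The random state of the algorithm after `k` outer iterations. -/
def state (fhat ghat : Ξ → X → Y → ℝ) (p : Params) (s : SampleIdx → Ω → Ξ) (w₀ : X × Y × Y)
    (k : ℕ) (ω : Ω) : X × Y × Y := amigo fhat ghat p (fun i => s i ω) w₀ k

namespace Setup

variable (S : Setup f g Lf B Mg Lg' Lg μg P fhat ghat σf σg σgxy σgyy Pr s p)

include S

theorem smoothConst_pos : 0 < smoothConst Lf B Mg Lg' μg := by
  have := S.hLf; have := S.hB; have := S.hMg; have := S.hLg'; have := S.hμg
  rw [smoothConst]
  positivity

theorem state_measurable_memLp (w₀ : X × Y × Y) (k : ℕ) :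
    Measurable[past s (instant k 0 0)] (state fhat ghat p s w₀ k) ∧
    MemLp (fun ω => (state fhat ghat p s w₀ k ω).1) 2 Pr ∧
    MemLp (fun ω => (state fhat ghat p s w₀ k ω).2.1) 2 Pr ∧
    MemLp (fun ω => (state fhat ghat p s w₀ k ω).2.2) 2 Pr := by
  induction k with
  | zero =>
    exact ⟨measurable_const, memLp_const w₀.1, memLp_const w₀.2.1, memLp_const w₀.2.2⟩
  | succ k ih =>
    have h1 := S.iteration ih.1 ih.2.1 ih.2.2.1 ih.2.2.2
    exact ⟨h1.measurable, h1.memLp_x, h1.memLp_y, h1.memLp_z⟩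

theorem iteration_state (w₀ : X × Y × Y) (k : ℕ) :
    IterationBounds f g Lf B Mg Lg' μg σf σg σgxy σgyy Pr s p k (state fhat ghat p s w₀ k)
      (state fhat ghat p s w₀ (k + 1)) := by
  have h := S.state_measurable_memLp w₀ k
  exact S.iteration h.1 h.2.1 h.2.2.1 h.2.2.2

section Loss

variable {μ η₀ : ℝ}

theorem continuous_outerLoss : Continuous (outerLoss f g) :=
  continuous_iff_continuousAt.2 fun x =>
    (S.bilevel.hasGradientAt_outerLoss S.hμg S.hLg x).continuousAt

theorem outerLoss_gap_nonneg (hμ : 0 < μ) (hsc : StrongConvexOn univ μ (outerLoss f g)) (x : X) :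
    0 ≤ outerLoss f g x - outerLoss f g (outerSol f g) :=
  sub_nonneg.2 (S.bilevel.isMinOn_outerSol S.hμg S.hLg hμ hsc (mem_univ x))

theorem outerLoss_gap_le (hμ : 0 < μ) (hsc : StrongConvexOn univ μ (outerLoss f g)) (x : X) :
    outerLoss f g x - outerLoss f g (outerSol f g)
      ≤ smoothConst Lf B Mg Lg' μg / 2 * ‖x - outerSol f g‖ ^ 2 := by
  have h1 := le_of_lipschitz_gradient (S.bilevel.hasGradientAt_outerLoss S.hμg S.hLg)
    (S.bilevel.lossGrad_lipschitz S.hμg S.hLg S.hMg S.hLg' S.hLf S.hB) (outerSol f g) x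
  rw [S.bilevel.lossGrad_outerSol S.hμg S.hLg hμ hsc, inner_zero_left] at h1
  linarith

theorem integrable_outerLoss_gap (hμ : 0 < μ) (hsc : StrongConvexOn univ μ (outerLoss f g))
    {x : Ω → X} (hx : MemLp x 2 Pr) :
    Integrable (fun ω => outerLoss f g (x ω) - outerLoss f g (outerSol f g)) Pr := by
  have h1 : MemLp (fun ω => x ω - outerSol f g) 2 Pr := hx.sub (memLp_const _)
  refine ((integrable_norm_sq h1).const_mul (smoothConst Lf B Mg Lg' μg / 2)).mono'
    ((S.continuous_outerLoss.comp_aestronglyMeasurable hx.1).sub aestronglyMeasurable_const)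
    (Eventually.of_forall fun ω => ?_)
  rw [Real.norm_of_nonneg (S.outerLoss_gap_nonneg hμ hsc _)]
  exact S.outerLoss_gap_le hμ hsc _

theorem memLp_avgIterate (w₀ : X × Y × Y) (δ : ℕ → ℝ) (k : ℕ) :
    MemLp (fun ω => avgIterate δ (fun j => (state fhat ghat p s w₀ j ω).1) k) 2 Pr := by
  induction k with
  | zero => exact (S.state_measurable_memLp w₀ 0).2.1
  | succ k ih =>
    exact (ih.const_smul (1 - δ (k + 1))).add
      ((S.state_measurable_memLp w₀ (k + 1)).2.1.const_smul (δ (k + 1)))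

theorem norm_lossGrad_le (hμ : 0 < μ) (hsc : StrongConvexOn univ μ (outerLoss f g)) (x : X) :
    ‖lossGrad f g x‖ ≤ smoothConst Lf B Mg Lg' μg * ‖x - outerSol f g‖ := by
  have h1 := S.bilevel.lossGrad_lipschitz S.hμg S.hLg S.hMg S.hLg' S.hLf S.hB x (outerSol f g)
  rwa [S.bilevel.lossGrad_outerSol S.hμg S.hLg hμ hsc, sub_zero] at h1

/-- The expected progress of an outer iteration. -/
theorem expected_step_le (hμ : 0 < μ) (hsc : StrongConvexOn univ μ (outerLoss f g))
    (hγ : p.γ = 1 / smoothConst Lf B Mg Lg' μg) {k : ℕ} {x e b : Ω → X}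
    (hx : Measurable[past s (instant k 0 0)] x) (hx2 : MemLp x 2 Pr) (he2 : MemLp e 2 Pr)
    (hb2 : MemLp b 2 Pr)
    (horth : ∀ φ : Ω → X, Measurable[past s (instant k 1 0)] φ → MemLp φ 2 Pr →
      ∫ ω, inner ℝ (φ ω) (e ω) ∂Pr = ∫ ω, inner ℝ (φ ω) (b ω) ∂Pr) :
    let x' := fun ω => x ω - p.γ • (lossGrad f g (x ω) + e ω)
    ∫ ω, (outerLoss f g (x' ω) - outerLoss f g (outerSol f g)) ∂Pr
        + 1 / (2 * p.γ) * sqMean Pr (fun ω => x' ω - outerSol f g) ≤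
      1 / (2 * p.γ) * (1 - p.γ * μ) * sqMean Pr (fun ω => x ω - outerSol f g)
        + μ / 4 * sqMean Pr (fun ω => x ω - outerSol f g) + 4 / μ * sqMean Pr b
        + p.γ * sqMean Pr e := by
  intro x'
  have hL0 := S.smoothConst_pos
  have hγ0 : 0 < p.γ := by rw [hγ]; positivity
  have m01 : past s (instant k 0 0) ≤ past s (instant k 1 0) :=
    past_mono s (instant_lt_of_phase (by norm_num)).le
  have hx1 := hx.mono m01 le_rfl
  have hxΩ : Measurable x := hx.mono (S.sampling.past_le _) le_rfl
  have hxs2 : MemLp (fun ω => x ω - outerSol f g) 2 Pr := hx2.sub (memLp_const _)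
  have hG2 := S.memLp_lossGrad hxΩ hx2
  have hx'2 : MemLp x' 2 Pr := hx2.sub ((hG2.add he2).const_smul p.γ)
  have hx's2 : MemLp (fun ω => x' ω - outerSol f g) 2 Pr := hx'2.sub (memLp_const _)
  set φ : Ω → X := fun ω => x ω - outerSol f g - p.γ • lossGrad f g (x ω) with hφdef
  have hφm : Measurable[past s (instant k 1 0)] φ :=
    (hx1.sub measurable_const).sub ((S.bilevel.measurable_lossGrad S.hμg S.hLg S.hMg S.hLf S.hB
      hx1).const_smul p.γ)
  have hφ2 : MemLp φ 2 Pr := hxs2.sub (hG2.const_smul p.γ)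
  have hφle : ∀ ω, ‖φ ω‖ ≤ 2 * ‖x ω - outerSol f g‖ := fun ω => by
    have h1 := S.norm_lossGrad_le hμ hsc (x ω)
    have h2 : ‖p.γ • lossGrad f g (x ω)‖ ≤ ‖x ω - outerSol f g‖ := by
      rw [norm_smul, Real.norm_of_nonneg hγ0.le, hγ, one_div, inv_mul_le_iff₀ hL0]
      exact h1
    exact (norm_sub_le _ _).trans (by linarith)
  have i1 := S.integrable_outerLoss_gap hμ hsc hx'2
  have i2 := (integrable_norm_sq hx's2).const_mul (1 / (2 * p.γ))
  have i3 := (integrable_norm_sq hxs2).const_mul (1 / (2 * p.γ) * (1 - p.γ * μ))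
  have i4 := integrable_inner_of_memLp hφ2 he2
  have i5 := (integrable_norm_sq he2).const_mul p.γ
  have key := integral_mono (i1.add i2) ((i3.sub i4).add i5) (fun ω =>
    inexact_gradient_step_le hL0 hγ hsc (S.bilevel.hasGradientAt_outerLoss S.hμg S.hLg)
      (S.bilevel.lossGrad_lipschitz S.hμg S.hLg S.hMg S.hLg' S.hLf S.hB)
      (outerSol f g) (x ω) (e ω))
  rw [integral_add' i1 i2, integral_add' (i3.sub i4) i5, integral_sub' i3 i4, integral_const_mul,
    integral_const_mul, integral_const_mul, horth φ hφm hφ2] at key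
  have i6 := integrable_inner_of_memLp hφ2 hb2
  have j1 := (integrable_norm_sq hxs2).const_mul (μ / 4)
  have j2 := (integrable_norm_sq hb2).const_mul (4 / μ)
  have h8 : -∫ ω, inner ℝ (φ ω) (b ω) ∂Pr ≤ μ / 4 * sqMean Pr (fun ω => x ω - outerSol f g)
      + 4 / μ * sqMean Pr b := by
    rw [← integral_neg]
    refine (integral_mono i6.neg (j1.add j2) fun ω => ?_).trans_eq ?_
    · have h9 := neg_le_of_abs_le (abs_real_inner_le_norm (φ ω) (b ω))
      have h10 : ‖φ ω‖ * ‖b ω‖ ≤ 2 * ‖x ω - outerSol f g‖ * ‖b ω‖ :=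
        mul_le_mul_of_nonneg_right (hφle ω) (norm_nonneg _)
      -- The weights are chosen so that, after multiplication by δ, the term μ/4 consumes at most
      -- half of the decay of (η/2)‖x − x⋆‖². The price 4/μ falls on b only.
      have h11 : 2 * ‖x ω - outerSol f g‖ * ‖b ω‖
          ≤ μ / 4 * ‖x ω - outerSol f g‖ ^ 2 + 4 / μ * ‖b ω‖ ^ 2 := by
        have h12 : 0 ≤ (μ * ‖x ω - outerSol f g‖ - 4 * ‖b ω‖) ^ 2 / (4 * μ) := by positivity
        have h13 : (μ * ‖x ω - outerSol f g‖ - 4 * ‖b ω‖) ^ 2 / (4 * μ)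
            = μ / 4 * ‖x ω - outerSol f g‖ ^ 2 - 2 * ‖x ω - outerSol f g‖ * ‖b ω‖
              + 4 / μ * ‖b ω‖ ^ 2 := by
          field_simp
          ring
        linarith
      simp only [Pi.neg_apply, Pi.add_apply]
      linarith
    · rw [integral_add' j1 j2, integral_const_mul, integral_const_mul]
      rfl
  simp only [sqMean] at h8 ⊢
  linarith

/-- Mind the shift of indices: the state k is (x_k, y_{k−1}, z_{k−1}). The initial errors of the
runs of iteration k thus pair the old y or z of state k with the new targets, and the final errors
take y_k and z_k from state k + 1. -/
theorem exists_errorRecursion (hμ : 0 < μ) (hμL : μ ≤ smoothConst Lf B Mg Lg' μg)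
    (hsc : StrongConvexOn univ μ (outerLoss f g))
    (hγ : p.γ = 1 / smoothConst Lf B Mg Lg' μg) (hη : μ ≤ η₀)
    (hηL : η₀ ≤ smoothConst Lf B Mg Lg' μg) (w₀ : X × Y × Y) :
    ∃ Yk Zk ee bb Δ : ℕ → ℝ,
    ErrorRecursion ((1 - p.α * μg) ^ p.T) ((1 - p.β * μg / 2) ^ p.N)
      (p.α * σg ^ 2 / (μg * p.ng))
      (6 * (σf ^ 2 / p.nf) / μg ^ 2 + 4 * p.β * (σgyy ^ 2 / p.ngyy) * B ^ 2 / μg ^ 3)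
      (Lf + Mg * B / μg + Lg' * (Lf / μg + Mg * B / μg ^ 2))
      (Lg' / μg) (Lf / μg + Mg * B / μg ^ 2) Lg' p.γ μ (σf ^ 2 / p.nf) (σgxy ^ 2 / p.ngxy)
      (B ^ 2 / μg ^ 2)
      (fun k => p.γ * eta μ p.γ η₀ k)
      (fun k => sqMean Pr (fun ω => (state fhat ghat p s w₀ k ω).1 - outerSol f g))
      (fun k => sqMean Pr (fun ω => (state fhat ghat p s w₀ k ω).2.1
        - innerSol g (state fhat ghat p s w₀ k ω).1))
      Yk
      (fun k => sqMean Pr (fun ω => (state fhat ghat p s w₀ k ω).2.2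
        - linSol f g (state fhat ghat p s w₀ k ω).1 (state fhat ghat p s w₀ (k + 1) ω).2.1))
      Zk
      (fun k => ∫ ω, (outerLoss f g (avgIterate (fun j => p.γ * eta μ p.γ η₀ j)
          (fun j => (state fhat ghat p s w₀ j ω).1) k) - outerLoss f g (outerSol f g)) ∂Pr
        + eta μ p.γ η₀ k / 2
          * sqMean Pr (fun ω => (state fhat ghat p s w₀ k ω).1 - outerSol f g))
      ee bb Δ := by
  have hL0 := S.smoothConst_pos
  have hγ0 : 0 < p.γ := by rw [hγ]; positivity
  have hγμ : p.γ * μ ≤ 1 := by rw [hγ, one_div, inv_mul_le_iff₀ hL0]; linarith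
  set w := state fhat ghat p s w₀ with hw
  have hst := S.state_measurable_memLp w₀
  have hit := S.iteration_state w₀
  choose e b he2 hb2 hrec horth hble hele using fun k => (hit k).exists_error
  have hm : ∀ k, Measurable (w k) := fun k => (hst k).1.mono (S.sampling.past_le _) le_rfl
  have hxm : ∀ k, Measurable fun ω => (w k ω).1 := fun k => measurable_fst.comp (hm k)
  have hym : ∀ k, Measurable fun ω => (w k ω).2.1 := fun k =>
    (measurable_fst.comp measurable_snd).comp (hm k)
  have hx2 := fun k => (hst k).2.1
  have hy2 := fun k => (hst k).2.2.1
  have hz2 := fun k => (hst k).2.2.2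
  have hys2 : ∀ k j, MemLp (fun ω => (w k ω).2.1 - innerSol g (w j ω).1) 2 Pr := fun k j =>
    (hy2 k).sub (S.memLp_innerSol (hx2 j))
  have hΔ2 : ∀ k, MemLp (fun ω => (w (k + 1) ω).1 - (w k ω).1) 2 Pr := fun k =>
    (hx2 (k + 1)).sub (hx2 k)
  have hxs2 : ∀ k, MemLp (fun ω => (w k ω).1 - outerSol f g) 2 Pr := fun k =>
    (hx2 k).sub (memLp_const _)
  have hηk := fun k => le_eta hγ0.le hγμ hη k
  have hηk' := fun k => (eta_le hγ0.le hγμ hμ hη k).trans hηL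
  have hinner : ∀ k, sqMean Pr (fun ω => innerSol g (w (k + 1) ω).1 - innerSol g (w k ω).1)
      ≤ (Lg' / μg) ^ 2 * sqMean Pr (fun ω => (w (k + 1) ω).1 - (w k ω).1) := fun k =>
    sqMean_mono ((S.memLp_innerSol (hx2 (k + 1))).sub (S.memLp_innerSol (hx2 k))) (hΔ2 k) fun ω => by
      rw [← mul_pow]
      exact pow_le_pow_left₀ (norm_nonneg _) (S.bilevel.innerSol_lipschitz S.hμg _ _) 2
  have hinner' : ∀ k, sqMean Pr (fun ω => innerSol g (w k ω).1 - innerSol g (w (k + 1) ω).1)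
      ≤ (Lg' / μg) ^ 2 * sqMean Pr (fun ω => (w (k + 1) ω).1 - (w k ω).1) := fun k =>
    sqMean_mono ((S.memLp_innerSol (hx2 k)).sub (S.memLp_innerSol (hx2 (k + 1)))) (hΔ2 k) fun ω => by
      rw [← mul_pow, norm_sub_rev (w (k + 1) ω).1]
      exact pow_le_pow_left₀ (norm_nonneg _) (S.bilevel.innerSol_lipschitz S.hμg _ _) 2
  refine ⟨fun k => sqMean Pr (fun ω => (w (k + 1) ω).2.1 - innerSol g (w k ω).1),
    fun k => sqMean Pr (fun ω => (w (k + 1) ω).2.2 - linSol f g (w k ω).1 (w (k + 1) ω).2.1),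
    fun k => sqMean Pr (e k), fun k => sqMean Pr (b k),
    fun k => sqMean Pr (fun ω => (w (k + 1) ω).1 - (w k ω).1), ?_⟩
  refine ⟨fun _ => sqMean_nonneg _, fun _ => sqMean_nonneg _,
    fun _ => sqMean_nonneg _, fun _ => sqMean_nonneg _, fun k => ?_, fun _ => sqMean_nonneg _,
    fun _ => sqMean_nonneg _, fun k => (hit k).inner_le, fun k => (hit k).linear_le, hble, hele,
    fun k => ?_, fun k => ?_, fun k => ?_, fun k => ?_, fun k => ?_⟩
  · have h1 := (hμ.le).trans (hηk k)
    have h2 := sqMean_nonneg (Pr := Pr) (fun ω => (w k ω).1 - outerSol f g)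
    have h3 : 0 ≤ ∫ ω, (outerLoss f g (avgIterate (fun j => p.γ * eta μ p.γ η₀ j)
        (fun j => (w j ω).1) k) - outerLoss f g (outerSol f g)) ∂Pr :=
      integral_nonneg fun ω => S.outerLoss_gap_nonneg hμ hsc _
    positivity
  · -- size of the step
    have h1 : (fun ω => (w (k + 1) ω).1 - (w k ω).1)
        = fun ω => (-p.γ) • e k ω + (-p.γ) • lossGrad f g (w k ω).1 := by
      funext ω; rw [hrec]; module
    have hG2 := (S.memLp_lossGrad (hxm k) (hx2 k)).const_smul (-p.γ)
    rw [h1]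
    refine (sqMean_add_le ((he2 k).const_smul (-p.γ)) hG2).trans (add_le_add ?_ ?_)
    · have h2 := sqMean_mono ((he2 k).const_smul (-p.γ)) (he2 k) (c := p.γ ^ 2) fun ω => by
        simp [norm_smul, mul_pow]
      linarith
    · have h2 := sqMean_mono hG2 (hxs2 k) (c := 1) fun ω => by
        rw [one_mul]
        refine pow_le_pow_left₀ (norm_nonneg _) ?_ 2
        simp only [Pi.smul_apply]
        rw [norm_smul, norm_neg, Real.norm_of_nonneg hγ0.le, hγ, one_div, inv_mul_le_iff₀ hL0]
        exact S.norm_lossGrad_le hμ hsc _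
      exact mul_le_mul_of_nonneg_left (by simpa using h2) (by norm_num)
  -- Warm start: y_k is now judged against y⋆(x_{k+1}), and the target has moved by at most L_g'/μ_g
  -- times the step.
  · have h1 : (fun ω => (w (k + 1) ω).2.1 - innerSol g (w (k + 1) ω).1)
        = fun ω => ((w (k + 1) ω).2.1 - innerSol g (w k ω).1)
          + (innerSol g (w k ω).1 - innerSol g (w (k + 1) ω).1) := by
      funext ω; abel
    rw [h1]
    refine (sqMean_add_le (hys2 (k + 1) k) ((S.memLp_innerSol (hx2 k)).sub
      (S.memLp_innerSol (hx2 (k + 1))))).trans (add_le_add le_rfl ?_)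
    exact mul_le_mul_of_nonneg_left (hinner' k) (by norm_num)
  · have hl2 : ∀ k, MemLp (fun ω => linSol f g (w k ω).1 (w (k + 1) ω).2.1) 2 Pr := fun k =>
      S.memLp_linSol (hxm k) (hym (k + 1))
    have h1 : (fun ω => (w (k + 1) ω).2.2 - linSol f g (w (k + 1) ω).1 (w (k + 1 + 1) ω).2.1)
        = fun ω => ((w (k + 1) ω).2.2 - linSol f g (w k ω).1 (w (k + 1) ω).2.1)
          + (linSol f g (w k ω).1 (w (k + 1) ω).2.1
            - linSol f g (w (k + 1) ω).1 (w (k + 1 + 1) ω).2.1) := by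
      funext ω; abel
    rw [h1]
    refine (sqMean_add_le ((hz2 (k + 1)).sub (hl2 k)) ((hl2 k).sub (hl2 (k + 1)))).trans
      (add_le_add le_rfl ?_)
    refine mul_le_mul_of_nonneg_left ?_ (by norm_num)
    have hdy2 : MemLp (fun ω => (w (k + 1 + 1) ω).2.1 - (w (k + 1) ω).2.1) 2 Pr :=
      (hy2 (k + 1 + 1)).sub (hy2 (k + 1))
    have i1 := (integrable_norm_sq (hΔ2 k)).const_mul ((Lf / μg + Mg * B / μg ^ 2) ^ 2)
    have i2 := (integrable_norm_sq hdy2).const_mul ((Lf / μg + Mg * B / μg ^ 2) ^ 2)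
    have h2 := sqMean_le_of_le ((hl2 k).sub (hl2 (k + 1))) (i1.add i2) fun ω => by
      have h3 := pow_le_pow_left₀ (norm_nonneg _) (S.bilevel.linSol_lipschitz S.hμg S.hLg S.hMg
        (w k ω).1 (w (k + 1) ω).2.1 (w (k + 1) ω).1 (w (k + 1 + 1) ω).2.1) 2
      rw [mul_pow, pairDist_sq, norm_sub_rev (w k ω).1, norm_sub_rev (w (k + 1) ω).2.1,
        mul_add] at h3
      exact h3
    rw [integral_add' i1 i2, integral_const_mul, integral_const_mul, ← mul_add] at h2
    refine h2.trans (mul_le_mul_of_nonneg_left (add_le_add le_rfl ?_) (by positivity))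
    -- z⋆ also depends on y. The move from y_k to y_{k+1} passes through both inner solutions, which
    -- is why `Y (k + 1)` appears in the bound.
    have h4 : (fun ω => (w (k + 1 + 1) ω).2.1 - (w (k + 1) ω).2.1)
        = fun ω => ((w (k + 1 + 1) ω).2.1 - innerSol g (w (k + 1) ω).1)
          + (innerSol g (w (k + 1) ω).1 - innerSol g (w k ω).1)
          + (-1 : ℝ) • ((w (k + 1) ω).2.1 - innerSol g (w k ω).1) := by
      funext ω; module
    have h5 := sqMean_add₃_le (hys2 (k + 1 + 1) (k + 1)) ((S.memLp_innerSol (hx2 (k + 1))).sub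
      (S.memLp_innerSol (hx2 k))) ((hys2 (k + 1) k).const_smul (-1 : ℝ))
    have h6 : sqMean Pr ((-1 : ℝ) • fun ω => (w (k + 1) ω).2.1 - innerSol g (w k ω).1)
        = sqMean Pr fun ω => (w (k + 1) ω).2.1 - innerSol g (w k ω).1 := by
      simp [sqMean, norm_sub_rev]
    rw [h6] at h5
    have h7 : ∫ ω, ‖(w (k + 1 + 1) ω).2.1 - (w (k + 1) ω).2.1‖ ^ 2 ∂Pr
        = sqMean Pr (fun ω => (w (k + 1 + 1) ω).2.1 - (w (k + 1) ω).2.1) := rfl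
    rw [h7, h4]
    refine h5.trans (add_le_add (add_le_add le_rfl ?_) le_rfl)
    exact mul_le_mul_of_nonneg_left (hinner k) (by norm_num)
  · -- the outer recursion
    set δ := fun j => p.γ * eta μ p.γ η₀ j with hδ
    set d := fun k => sqMean Pr (fun ω => (w k ω).1 - outerSol f g) with hd
    have hδ0 : 0 ≤ δ (k + 1) := mul_nonneg hγ0.le (hμ.le.trans (hηk _))
    have hδ1 : δ (k + 1) ≤ 1 := by
      simp only [hδ]
      rw [hγ, one_div, inv_mul_le_iff₀ hL0, mul_one, ← one_div, ← hγ]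
      exact hηk' _
    have hstep := S.expected_step_le hμ hsc hγ (measurable_fst.comp (hst k).1) (hx2 k) (he2 k)
      (hb2 k) (horth k)
    have hx' : ∀ ω, (w (k + 1) ω).1 = (w k ω).1 - p.γ • (lossGrad f g (w k ω).1 + e k ω) :=
      hrec k
    have hstep' : ∫ ω, (outerLoss f g (w (k + 1) ω).1 - outerLoss f g (outerSol f g)) ∂Pr
        + 1 / (2 * p.γ) * d (k + 1) ≤ 1 / (2 * p.γ) * (1 - p.γ * μ) * d k + μ / 4 * d k
          + 4 / μ * sqMean Pr (b k) + p.γ * sqMean Pr (e k) := by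
      simp only [hd, hx']
      exact hstep
    have i1 := S.integrable_outerLoss_gap hμ hsc (S.memLp_avgIterate w₀ δ k)
    have i2 := S.integrable_outerLoss_gap hμ hsc (S.memLp_avgIterate w₀ δ (k + 1))
    have i3 := S.integrable_outerLoss_gap hμ hsc (hx2 (k + 1))
    have hconv : ∫ ω, (outerLoss f g (avgIterate δ (fun j => (w j ω).1) (k + 1))
          - outerLoss f g (outerSol f g)) ∂Pr ≤
        (1 - δ (k + 1)) * ∫ ω, (outerLoss f g (avgIterate δ (fun j => (w j ω).1) k)
          - outerLoss f g (outerSol f g)) ∂Pr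
        + δ (k + 1) * ∫ ω, (outerLoss f g (w (k + 1) ω).1 - outerLoss f g (outerSol f g)) ∂Pr := by
      refine (integral_mono i2 ((i1.const_mul (1 - δ (k + 1))).add (i3.const_mul (δ (k + 1))))
        fun ω => ?_).trans_eq ?_
      · have hcv : ConvexOn ℝ univ (outerLoss f g) := by
          rw [← strongConvexOn_zero]; exact hsc.mono hμ.le
        have h1 := hcv.2 (mem_univ (avgIterate δ (fun j => (w j ω).1) k))
          (mem_univ (w (k + 1) ω).1) (sub_nonneg.2 hδ1) hδ0 (by ring)
        simp only [smul_eq_mul] at h1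
        simp only [Pi.add_apply, avgIterate]
        linarith
      · rw [integral_add' (i1.const_mul _) (i3.const_mul _), integral_const_mul,
          integral_const_mul]
    have h0 : 0 ≤ ∫ ω, (outerLoss f g (avgIterate δ (fun j => (w j ω).1) k)
        - outerLoss f g (outerSol f g)) ∂Pr :=
      integral_nonneg fun ω => S.outerLoss_gap_nonneg hμ hsc _
    have hdk : 0 ≤ d k := sqMean_nonneg _
    have h3 := mul_le_mul_of_nonneg_left hstep' hδ0
    have h4 := eta_succ_mul hγ0.le hγμ hη k
    have h5 : δ (k + 1) * (1 / (2 * p.γ) * d (k + 1)) = eta μ p.γ η₀ (k + 1) / 2 * d (k + 1) := by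
      simp only [hδ]; field_simp
    -- The recursion of η turns the weight of the old distance into (1 − δ)η_k/2, the one in the
    -- previous energy.
    have h6 : δ (k + 1) * (1 / (2 * p.γ) * (1 - p.γ * μ) * d k)
        = (1 - δ (k + 1)) * (eta μ p.γ η₀ k / 2 * d k) := by
      have : δ (k + 1) * (1 / (2 * p.γ) * (1 - p.γ * μ) * d k)
        = (eta μ p.γ η₀ (k + 1) * (1 - p.γ * μ)) / 2 * d k := by
        simp only [hδ]; field_simp
      rw [this, h4]
      simp only [hδ]
      ring
    have h7 : δ (k + 1) * (μ / 4 * d k) ≤ δ (k + 1) * (eta μ p.γ η₀ k / 4 * d k) := by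
      have := hηk k
      gcongr
    have h8 : 0 ≤ δ (k + 1) * ∫ ω, (outerLoss f g (avgIterate δ (fun j => (w j ω).1) k)
        - outerLoss f g (outerSol f g)) ∂Pr := mul_nonneg hδ0 h0
    simp only [mul_add, h5, h6] at h3
    change ∫ ω, (outerLoss f g (avgIterate δ (fun j => (w j ω).1) (k + 1))
          - outerLoss f g (outerSol f g)) ∂Pr + eta μ p.γ η₀ (k + 1) / 2 * d (k + 1)
      ≤ (1 - δ (k + 1) / 2) * (∫ ω, (outerLoss f g (avgIterate δ (fun j => (w j ω).1) k)
          - outerLoss f g (outerSol f g)) ∂Pr + eta μ p.γ η₀ k / 2 * d k)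
        + δ (k + 1) * (4 / μ * sqMean Pr (b k) + p.γ * sqMean Pr (e k))
    linarith
  · have h0 : 0 ≤ ∫ ω, (outerLoss f g (avgIterate (fun j => p.γ * eta μ p.γ η₀ j)
        (fun j => (w j ω).1) k) - outerLoss f g (outerSol f g)) ∂Pr :=
      integral_nonneg fun ω => S.outerLoss_gap_nonneg hμ hsc _
    have h1 := sqMean_nonneg (Pr := Pr) (fun ω => (w k ω).1 - outerSol f g)
    have h2 : μ / 2 * sqMean Pr (fun ω => (w k ω).1 - outerSol f g)
        ≤ eta μ p.γ η₀ k / 2 * sqMean Pr (fun ω => (w k ω).1 - outerSol f g) := by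
      have := hηk k
      gcongr
    rw [div_mul_eq_mul_div, le_div_iff₀ hμ]
    linarith

end Loss

end Setup

end Trajectory

/-! ### Convergence of the error recursion -/

/-- Bounds of the coefficients of an `ErrorRecursion` in terms of the inner and the outer condition
number `κ` and `κL`, of a constant `M`, and of a noise level `τ` that is small compared to `ε`. -/
structure CoefficientBounds (M κ κL τ ε Ry Rz Ly lam lz Lg' γ μ vf vxy Bμ : ℝ) : Prop where
  one_le_M : 1 ≤ M
  one_le_κ : 1 ≤ κ
  one_le_κL : 1 ≤ κL
  τ_nonneg : 0 ≤ τ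
  τ_le : 2400 * M ^ 7 * τ ≤ ε
  ε_le : ε ≤ 1
  γ_nonneg : 0 ≤ γ
  μ_inv : 1 / μ = κL * γ
  γ_mul_le : γ * κ ^ 3 ≤ M
  Ry_nonneg : 0 ≤ Ry
  Ry_le : Ry * (κ * κL) ≤ M ^ 2 * τ
  Rz_nonneg : 0 ≤ Rz
  Rz_le : Rz ≤ 10 * M ^ 4 * κ ^ 3 * τ
  Ly_nonneg : 0 ≤ Ly
  Ly_le : Ly ≤ M * κ ^ 2
  lam_nonneg : 0 ≤ lam
  lam_le : lam ≤ M * κ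
  lz_nonneg : 0 ≤ lz
  lz_le : lz ≤ M * κ ^ 2
  Lg'_nonneg : 0 ≤ Lg'
  Lg'_le : Lg' ≤ M
  vf_le : vf ≤ τ
  vxy_le : vxy ≤ τ
  Bμ_nonneg : 0 ≤ Bμ
  Bμ_le : Bμ ≤ M ^ 2 * κ ^ 2

namespace CoefficientBounds

variable {M κ κL τ ε Ry Rz Ly lam lz Lg' γ μ vf vxy Bμ : ℝ}
  (H : CoefficientBounds M κ κL τ ε Ry Rz Ly lam lz Lg' γ μ vf vxy Bμ)

include H

theorem ε_nonneg : 0 ≤ ε := by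
  have := H.one_le_M; have := H.τ_nonneg
  exact le_trans (by positivity) H.τ_le

theorem pow_mul_τ_le {n : ℕ} (hn : n ≤ 7) : 2400 * (M ^ n * τ) ≤ ε := by
  have h := pow_le_pow_right₀ H.one_le_M hn
  have := mul_le_mul_of_nonneg_right h H.τ_nonneg
  linarith [H.τ_le]

theorem Lysq_le : Ly ^ 2 ≤ M ^ 2 * κ ^ 4 :=
  (pow_le_pow_left₀ H.Ly_nonneg H.Ly_le 2).trans_eq (by ring)

theorem lamsq_le : lam ^ 2 ≤ M ^ 2 * κ ^ 2 :=
  (pow_le_pow_left₀ H.lam_nonneg H.lam_le 2).trans_eq (by ring)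

theorem lzsq_le : lz ^ 2 ≤ M ^ 2 * κ ^ 4 :=
  (pow_le_pow_left₀ H.lz_nonneg H.lz_le 2).trans_eq (by ring)

theorem Lg'sq_le : Lg' ^ 2 ≤ M ^ 2 := pow_le_pow_left₀ H.Lg'_nonneg H.Lg'_le 2

theorem γ_le : γ ≤ M := by
  have h := one_le_pow₀ H.one_le_κ (n := 3)
  exact (le_mul_of_one_le_right H.γ_nonneg h).trans H.γ_mul_le

theorem Ry_le_ε : Ry ≤ ε := by
  have h := one_le_mul_of_one_le_of_one_le H.one_le_κ H.one_le_κL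
  have h1 := (le_mul_of_one_le_right H.Ry_nonneg h).trans H.Ry_le
  have h2 := H.pow_mul_τ_le (n := 2) (by norm_num)
  have := H.ε_nonneg
  linarith

theorem Rz_le_ε : Rz ≤ κ ^ 3 * ε := by
  have h2 := H.pow_mul_τ_le (n := 4) (by norm_num)
  have hκ : 0 ≤ κ ^ 3 := pow_nonneg (by linarith [H.one_le_κ]) 3
  have hε := H.ε_nonneg
  refine H.Rz_le.trans ?_
  calc 10 * M ^ 4 * κ ^ 3 * τ = κ ^ 3 * (10 * (M ^ 4 * τ)) := by ring
    _ ≤ κ ^ 3 * ε := mul_le_mul_of_nonneg_left (by linarith) hκ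

/-- The contribution of the inner errors and of the noise to one outer step. -/
theorem noise_le {a b Y Z bb ee : ℝ} (ha : 0 ≤ a) (hb : 0 ≤ b) (hY0 : 0 ≤ Y) (hZ0 : 0 ≤ Z)
    (hY : Y ≤ a + Ry) (hZ : Z ≤ b + Rz)
    (hbb : bb ≤ 2 * Ly ^ 2 * Y + 2 * Lg' ^ 2 * b)
    (hee : ee ≤ 3 * vf + 3 * (vxy * (2 * Z + 2 * Bμ)) + 3 * (2 * Ly ^ 2 * Y + 2 * Lg' ^ 2 * Z)) :
    4 / μ * bb + γ * ee ≤ 20 * M ^ 3 * (κ * κL) * (a + b) + ε / 16 := by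
  have hM := H.one_le_M; have hκ := H.one_le_κ; have hκL := H.one_le_κL
  have hτ := H.τ_nonneg; have hγ := H.γ_nonneg; have hRy := H.Ry_nonneg; have hRz := H.Rz_nonneg
  have hγM := H.γ_le
  have hK : κ ≤ κ * κL := le_mul_of_one_le_right (by linarith) hκL
  have hK' : κL ≤ κ * κL := le_mul_of_one_le_left (by linarith) hκ
  have hτ1 : τ ≤ 1 := by
    have := H.pow_mul_τ_le (n := 0) (by norm_num)
    have := H.ε_le
    simp only [pow_zero, one_mul] at *
    linarith
  -- the bias
  have hbb' : bb ≤ 2 * (M ^ 2 * κ ^ 4) * (a + Ry) + 2 * M ^ 2 * b := by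
    have h1 := mul_le_mul H.Lysq_le hY hY0 (by positivity)
    have h2 := mul_le_mul_of_nonneg_right H.Lg'sq_le hb
    linarith
  -- 1/μ = κ_L γ, and γ cancels three of the four powers of κ in Ly². The remaining κκ_L meets Ry,
  -- whose product with it is small.
  have hbias : 4 / μ * bb ≤ 8 * M ^ 3 * (κ * κL) * (a + b) + 8 * (M ^ 5 * τ) := by
    have e1 : 4 / μ * bb = 4 * κL * γ * bb := by
      rw [div_eq_mul_one_div, H.μ_inv]; ring
    rw [e1]
    refine (mul_le_mul_of_nonneg_left hbb' (by positivity)).trans ?_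
    have h1 : (γ * κ ^ 3) * (M ^ 2 * (κ * κL) * a) ≤ M * (M ^ 2 * (κ * κL) * a) :=
      mul_le_mul_of_nonneg_right H.γ_mul_le (by positivity)
    have h2 : (γ * κ ^ 3) * (M ^ 2 * (Ry * (κ * κL))) ≤ M * (M ^ 2 * (M ^ 2 * τ)) :=
      mul_le_mul H.γ_mul_le (mul_le_mul_of_nonneg_left H.Ry_le (by positivity)) (by positivity)
        (by positivity)
    have h3 : (γ * κL) * (M ^ 2 * b) ≤ (M * (κ * κL)) * (M ^ 2 * b) :=
      mul_le_mul_of_nonneg_right (mul_le_mul hγM hK' (by positivity) (by positivity))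
        (by positivity)
    linarith
  -- the variance
  have hee' : ee ≤ 3 * τ + 6 * τ * (M ^ 2 * κ ^ 2) + 6 * (M ^ 2 * κ ^ 4) * (a + Ry)
      + 12 * M ^ 2 * (b + Rz) := by
    have h1 := mul_le_mul H.Lysq_le hY hY0 (by positivity)
    have h2 := mul_le_mul H.Lg'sq_le hZ hZ0 (by positivity)
    -- Since τ ≤ 1 ≤ M², the part of the Jacobian noise proportional to `Z` has no larger
    -- coefficient than the direct error of z.
    have h3 : vxy * Z ≤ M ^ 2 * (b + Rz) :=
      mul_le_mul ((H.vxy_le.trans hτ1).trans (one_le_pow₀ hM)) hZ hZ0 (by positivity)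
    have h4 := mul_le_mul H.vxy_le H.Bμ_le H.Bμ_nonneg hτ
    have h5 := H.vf_le
    linarith
  have hvar : γ * ee ≤ 12 * M ^ 3 * (κ * κL) * (a + b) + 135 * (M ^ 7 * τ) := by
    refine (mul_le_mul_of_nonneg_left hee' hγ).trans ?_
    have h1 : (γ * κ ^ 3) * (M ^ 2 * κ * a) ≤ M * (M ^ 2 * (κ * κL) * a) :=
      mul_le_mul H.γ_mul_le (mul_le_mul_of_nonneg_right
        (mul_le_mul_of_nonneg_left hK (by positivity)) ha) (by positivity) (by positivity)
    have h2 : (γ * κ ^ 3) * (M ^ 2 * (Ry * κ)) ≤ M * (M ^ 2 * (M ^ 2 * τ)) :=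
      mul_le_mul H.γ_mul_le (mul_le_mul_of_nonneg_left
        ((mul_le_mul_of_nonneg_left hK hRy).trans H.Ry_le) (by positivity)) (by positivity)
        (by positivity)
    have h3 : γ * (M ^ 2 * b) ≤ M * (κ * κL) * (M ^ 2 * b) := by
      refine mul_le_mul_of_nonneg_right ?_ (by positivity)
      exact hγM.trans (le_mul_of_one_le_right (by linarith) (by linarith))
    have h4 : γ * (M ^ 2 * Rz) ≤ 10 * (M ^ 7 * τ) := by
      calc γ * (M ^ 2 * Rz) ≤ γ * (M ^ 2 * (10 * M ^ 4 * κ ^ 3 * τ)) := by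
            have := H.Rz_le; gcongr
        _ = (γ * κ ^ 3) * (10 * M ^ 6 * τ) := by ring
        _ ≤ M * (10 * M ^ 6 * τ) := mul_le_mul_of_nonneg_right H.γ_mul_le (by positivity)
        _ = _ := by ring
    have h5 : (γ * κ ^ 2) * (M ^ 2 * τ) ≤ M * (M ^ 2 * τ) := by
      refine mul_le_mul_of_nonneg_right (le_trans ?_ H.γ_mul_le) (by positivity)
      exact mul_le_mul_of_nonneg_left (pow_le_pow_right₀ hκ (by norm_num)) hγ
    have h6 : γ * τ ≤ M * τ := mul_le_mul_of_nonneg_right hγM hτ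
    have h7 : M * τ ≤ M ^ 7 * τ :=
      mul_le_mul_of_nonneg_right (le_self_pow₀ hM (by norm_num)) hτ
    have h8 : M ^ 3 * τ ≤ M ^ 7 * τ :=
      mul_le_mul_of_nonneg_right (pow_le_pow_right₀ hM (by norm_num)) hτ
    have h9 : M ^ 5 * τ ≤ M ^ 7 * τ :=
      mul_le_mul_of_nonneg_right (pow_le_pow_right₀ hM (by norm_num)) hτ
    have h10 : 0 ≤ M ^ 3 * (κ * κL) * a := by positivity
    linarith
  have h9 : M ^ 5 * τ ≤ M ^ 7 * τ :=
    mul_le_mul_of_nonneg_right (pow_le_pow_right₀ hM (by norm_num)) hτ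
  have h11 : 0 ≤ M ^ 7 * τ := by positivity
  -- The noise terms sum to at most (8 + 135)M⁷τ, and 143/2400 < 1/16.
  have := H.τ_le
  linarith

end CoefficientBounds

namespace ErrorRecursion

variable {ρA ρB Ry Rz Ly lam lz Lg' γ μ vf vxy Bμ : ℝ} {δ d Yo Y Zo Z V ee bb Δ : ℕ → ℝ}
  (R : ErrorRecursion ρA ρB Ry Rz Ly lam lz Lg' γ μ vf vxy Bμ δ d Yo Y Zo Z V ee bb Δ)
  {M κ κL τ ε : ℝ} (H : CoefficientBounds M κ κL τ ε Ry Rz Ly lam lz Lg' γ μ vf vxy Bμ)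

include R H

theorem noise_le (hρA : 0 ≤ ρA) (hρB : 0 ≤ ρB) (k : ℕ) :
    4 / μ * bb k + γ * ee k ≤
      20 * M ^ 3 * (κ * κL) * (ρA * Yo k + ρB * Zo k) + ε / 16 :=
  H.noise_le (mul_nonneg hρA (R.Yo_nonneg k)) (mul_nonneg hρB (R.Zo_nonneg k)) (R.Y_nonneg k)
    (R.Z_nonneg k) (R.Y_le k) (R.Z_le k) (R.bb_le k) (R.ee_le k)

/-- The inner errors at the start of an iteration are bounded by the energy of the previous one. -/
theorem inner_error_le (hρA : 0 ≤ ρA) (hρA' : ρA ≤ 1) (hρB : 0 ≤ ρB) (hμ : 0 < μ) (k : ℕ) :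
    Yo (k + 1) ≤ 1100 * M ^ 8 * (κ * κL) ^ 7 * (ρA * Yo k + ρB * Zo k + V k + ε) ∧
    Zo (k + 1) ≤ 1100 * M ^ 8 * (κ * κL) ^ 7 * (ρA * Yo k + ρB * Zo k + V k + ε) := by
  have hM := H.one_le_M; have hκ := H.one_le_κ; have hκL := H.one_le_κL
  have hγ := H.γ_nonneg; have hRy := H.Ry_nonneg; have hRz := H.Rz_nonneg
  have hγM := H.γ_le; have hε := H.ε_nonneg
  have hnoise := R.noise_le H hρA hρB k
  have ha := mul_nonneg hρA (R.Yo_nonneg k)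
  have hb := mul_nonneg hρB (R.Zo_nonneg k)
  have hV := R.V_nonneg k
  set U := ρA * Yo k + ρB * Zo k + V k + ε with hU
  set K := κ * κL with hK
  have hU0 : 0 ≤ U := by positivity
  have hK1 : 1 ≤ K := one_le_mul_of_one_le_of_one_le hκ hκL
  have hκK : κ ≤ K := le_mul_of_one_le_right (by linarith) hκL
  have hκLK : κL ≤ K := le_mul_of_one_le_left (by linarith) hκ
  have hκ2 : κ ^ 2 ≤ K ^ 2 := pow_le_pow_left₀ (by linarith) hκK 2
  have hκ4 : κ ^ 4 ≤ K ^ 4 := pow_le_pow_left₀ (by linarith) hκK 4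
  -- monomials in `M` and `K`
  have mono : ∀ {i j i' j' : ℕ}, i ≤ i' → j ≤ j' → M ^ i * K ^ j * U ≤ M ^ i' * K ^ j' * U :=
    fun hi hj => mul_le_mul_of_nonneg_right (mul_le_mul (pow_le_pow_right₀ hM hi)
      (pow_le_pow_right₀ hK1 hj) (by positivity) (by positivity)) hU0
  have hY : Y k ≤ U := by linarith [R.Y_le k, H.Ry_le_ε]
  have hZ : Z k ≤ M ^ 0 * K ^ 3 * U := by
    have h1 := H.Rz_le_ε
    have h2 : κ ^ 3 * ε ≤ K ^ 3 * ε :=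
      mul_le_mul_of_nonneg_right (pow_le_pow_left₀ (by linarith) hκK 3) hε
    have h3 : ρB * Zo k ≤ K ^ 3 * (ρB * Zo k) := le_mul_of_one_le_left hb (one_le_pow₀ hK1)
    have h4 : K ^ 3 * (ρB * Zo k) + K ^ 3 * ε ≤ K ^ 3 * U := by
      rw [← mul_add]; exact mul_le_mul_of_nonneg_left (by linarith) (by positivity)
    rw [pow_zero, one_mul]
    linarith [R.Z_le k]
  have hΔ : Δ k ≤ 50 * (M ^ 4 * K ^ 1 * U) := by
    have h1 : γ * ee k ≤ 21 * (M ^ 3 * K ^ 1 * U) := by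
      -- Dropping the nonnegative bias term, the noise estimate bounds γ 𝔼‖e‖² by itself.
      have h2 : 0 ≤ 4 / μ * bb k := mul_nonneg (by positivity) (R.bb_nonneg k)
      have h3 : M ^ 3 * K * (ρA * Yo k + ρB * Zo k) ≤ M ^ 3 * K * U :=
        mul_le_mul_of_nonneg_left (by linarith) (by positivity)
      have h4 := mono (Nat.zero_le 3) (Nat.zero_le 1)
      rw [pow_zero, pow_zero, one_mul, one_mul] at h4
      rw [pow_one] at *
      linarith
    have h2 : γ * (γ * ee k) ≤ M * (21 * (M ^ 3 * K ^ 1 * U)) :=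
      mul_le_mul hγM h1 (mul_nonneg hγ (R.ee_nonneg k)) (by linarith)
    have h3 : d k ≤ 2 * (M ^ 1 * K ^ 1 * U) := by
      refine (R.d_le k).trans ?_
      rw [div_eq_mul_one_div, H.μ_inv]
      have h4 : κL * γ * V k ≤ K * M * U :=
        mul_le_mul (mul_le_mul hκLK hγM hγ (by linarith)) (by linarith) hV (by positivity)
      linarith
    have h5 := mono (show 1 ≤ 4 by norm_num) (le_refl 1)
    have h6 : 0 ≤ M ^ 4 * K ^ 1 * U := by positivity
    linarith [R.Δ_le k]
  have hΔ0 : 0 ≤ 50 * (M ^ 4 * K ^ 1 * U) := by positivity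
  have hlamΔ : lam ^ 2 * Δ k ≤ 50 * (M ^ 6 * K ^ 3 * U) := by
    have h1 : lam ^ 2 * Δ k ≤ (M ^ 2 * K ^ 2) * (50 * (M ^ 4 * K ^ 1 * U)) := by
      refine (mul_le_mul_of_nonneg_left hΔ (sq_nonneg _)).trans ?_
      refine mul_le_mul_of_nonneg_right (H.lamsq_le.trans ?_) hΔ0
      exact mul_le_mul_of_nonneg_left hκ2 (by positivity)
    linarith
  have hYo : Yo (k + 1) ≤ 102 * (M ^ 6 * K ^ 3 * U) := by
    have h1 := mono (Nat.zero_le 6) (Nat.zero_le 3)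
    rw [pow_zero, pow_zero, one_mul, one_mul] at h1
    linarith [R.Yo_succ_le k]
  have hY' : Y (k + 1) ≤ 103 * (M ^ 6 * K ^ 3 * U) := by
    have h1 := mono (Nat.zero_le 6) (Nat.zero_le 3)
    rw [pow_zero, pow_zero, one_mul, one_mul] at h1
    have h2 := mul_le_of_le_one_left (R.Yo_nonneg (k + 1)) hρA'
    linarith [R.Y_le (k + 1), H.Ry_le_ε]
  have hZo : Zo (k + 1) ≤ 1100 * (M ^ 8 * K ^ 7 * U) := by
    have h1 : Δ k + (3 * Y (k + 1) + 3 * (lam ^ 2 * Δ k) + 3 * Y k)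
        ≤ 520 * (M ^ 6 * K ^ 3 * U) := by
      have h2 := mono (Nat.zero_le 6) (Nat.zero_le 3)
      have h3 := mono (show 4 ≤ 6 by norm_num) (show 1 ≤ 3 by norm_num)
      rw [pow_zero, pow_zero, one_mul, one_mul] at h2
      linarith
    have h2 : lz ^ 2 * (Δ k + (3 * Y (k + 1) + 3 * (lam ^ 2 * Δ k) + 3 * Y k))
        ≤ (M ^ 2 * K ^ 4) * (520 * (M ^ 6 * K ^ 3 * U)) := by
      refine (mul_le_mul_of_nonneg_left h1 (sq_nonneg _)).trans ?_
      refine mul_le_mul_of_nonneg_right (H.lzsq_le.trans ?_) (by positivity)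
      exact mul_le_mul_of_nonneg_left hκ4 (by positivity)
    have h3 := mono (Nat.zero_le 8) (show 3 ≤ 7 by norm_num)
    have h4 : 0 ≤ M ^ 8 * K ^ 7 * U := by positivity
    linarith [R.Zo_succ_le k]
  refine ⟨?_, by linarith⟩
  have h1 := mono (show 6 ≤ 8 by norm_num) (show 3 ≤ 7 by norm_num)
  have h2 : 0 ≤ M ^ 8 * K ^ 7 * U := by positivity
  linarith

/-- The total energy contracts up to a multiple of `ε`. -/
theorem energy_succ_le (hρA : 0 ≤ ρA) (hρA' : ρA ≤ 1) (hρB : 0 ≤ ρB) (hμ : 0 < μ) {q : ℝ}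
    (hqA : √ρA ≤ q) (hqB : √ρB ≤ q)
    (hq : 32 * (1100 * M ^ 8 * (κ * κL) ^ 7) * κL * q ≤ 1) (k : ℕ)
    (hδ : 1 / κL ≤ δ (k + 1)) (hδ' : δ (k + 1) ≤ 1) :
    V (k + 1) + 1 / κL * (√ρA * Yo (k + 1) + √ρB * Zo (k + 1)) ≤
      (1 - δ (k + 1) / 4) * (V k + 1 / κL * (√ρA * Yo k + √ρB * Zo k))
        + δ (k + 1) / 4 * (ε / 2) := by
  have hM := H.one_le_M; have hκ := H.one_le_κ; have hκL := H.one_le_κL; have hε := H.ε_nonneg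
  have hnoise := R.noise_le H hρA hρB k
  obtain ⟨hY, hZ⟩ := R.inner_error_le H hρA hρA' hρB hμ k
  have hV := R.V_nonneg k
  have hYo := R.Yo_nonneg k
  have hZo := R.Zo_nonneg k
  set K := κ * κL with hK
  have hK1 : 1 ≤ K := one_le_mul_of_one_le_of_one_le hκ hκL
  set P := 1100 * M ^ 8 * K ^ 7 with hP
  have hq0 : 0 ≤ q := (Real.sqrt_nonneg _).trans hqA
  set t := δ (k + 1) with ht
  have hκL0 : 0 < 1 / κL := by positivity
  have ht0 : 0 ≤ t := hκL0.le.trans hδ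
  set w := √ρA * Yo k + √ρB * Zo k with hw
  have hw0 : 0 ≤ w := by positivity
  have hP0 : 0 ≤ P := by positivity
  have hPq : P * q ≤ 1 / 32 * (1 / κL) := by
    rw [mul_one_div, le_div_iff₀ (by linarith)]
    linarith
  have hκL1 : 1 / κL ≤ 1 := by rw [div_le_one (by linarith)]; exact hκL
  -- One root of each rate is kept as the weight of the error in the energy; the other is at most q
  -- and pays for the polynomial constants.
  have hab : ρA * Yo k + ρB * Zo k ≤ q * w := by
    have h1 : ρA ≤ q * √ρA := by
      nth_rewrite 1 [← Real.mul_self_sqrt hρA]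
      exact mul_le_mul_of_nonneg_right hqA (Real.sqrt_nonneg _)
    have h2 : ρB ≤ q * √ρB := by
      nth_rewrite 1 [← Real.mul_self_sqrt hρB]
      exact mul_le_mul_of_nonneg_right hqB (Real.sqrt_nonneg _)
    have h3 := mul_le_mul_of_nonneg_right h1 hYo
    have h4 := mul_le_mul_of_nonneg_right h2 hZo
    rw [hw]
    linarith
  have hab0 : 0 ≤ ρA * Yo k + ρB * Zo k := by positivity
  have hPP : 20 * M ^ 3 * K + 1 / 16 ≤ P := by
    have h1 : M ^ 3 * K ≤ M ^ 8 * K ^ 7 :=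
      mul_le_mul (pow_le_pow_right₀ hM (by norm_num)) (le_self_pow₀ hK1 (by norm_num))
        (by linarith) (by positivity)
    have h2 : 1 ≤ M ^ 8 * K ^ 7 :=
      one_le_mul_of_one_le_of_one_le (one_le_pow₀ hM) (one_le_pow₀ hK1)
    rw [hP]
    linarith
  -- the new inner errors
  set U := ρA * Yo k + ρB * Zo k + V k + ε with hU
  have hU0 : 0 ≤ U := by positivity
  have hnew : 1 / κL * (√ρA * Yo (k + 1) + √ρB * Zo (k + 1)) ≤ t * (U / 16) := by
    have h1 : √ρA * Yo (k + 1) ≤ q * (P * U) :=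
      mul_le_mul hqA hY (R.Yo_nonneg _) hq0
    have h2 : √ρB * Zo (k + 1) ≤ q * (P * U) :=
      mul_le_mul hqB hZ (R.Zo_nonneg _) hq0
    have h3 : √ρA * Yo (k + 1) + √ρB * Zo (k + 1) ≤ U / 16 := by
      have h4 := mul_le_mul_of_nonneg_right (hPq.trans (mul_le_mul_of_nonneg_left hκL1
        (by norm_num))) hU0
      linarith
    exact mul_le_mul hδ h3 (add_nonneg (mul_nonneg (Real.sqrt_nonneg _) (R.Yo_nonneg _))
      (mul_nonneg (Real.sqrt_nonneg _) (R.Zo_nonneg _))) ht0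
  -- the old inner errors
  have hold : t * ((20 * M ^ 3 * K + 1 / 16) * (ρA * Yo k + ρB * Zo k))
      ≤ (1 - t / 4) * (1 / κL * w) := by
    have h1 : (20 * M ^ 3 * K + 1 / 16) * (ρA * Yo k + ρB * Zo k) ≤ 1 / 32 * (1 / κL) * w := by
      refine (mul_le_mul hPP hab hab0 hP0).trans ?_
      rw [← mul_assoc]
      exact mul_le_mul_of_nonneg_right hPq hw0
    have h2 : 0 ≤ 1 / κL * w := by positivity
    have h3 := mul_le_mul_of_nonneg_left h1 ht0
    have h4 := mul_le_mul_of_nonneg_right hδ' h2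
    linarith
  have hmain := R.V_succ_le k
  have h1 := mul_le_mul_of_nonneg_left hnoise ht0
  have h2 : 0 ≤ t * V k := mul_nonneg ht0 hV
  rw [hU] at hnew
  linarith

/-- ε/2 is the fixed point of the one-step bound, and δ ≥ 1/κ_L makes the contraction of the excess
uniform. -/
theorem energy_le (hρA : 0 ≤ ρA) (hρA' : ρA ≤ 1) (hρB : 0 ≤ ρB) (hμ : 0 < μ) {q : ℝ}
    (hqA : √ρA ≤ q) (hqB : √ρB ≤ q)
    (hq : 32 * (1100 * M ^ 8 * (κ * κL) ^ 7) * κL * q ≤ 1)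
    (hδ : ∀ k, 1 / κL ≤ δ k) (hδ' : ∀ k, δ k ≤ 1) (k : ℕ) :
    V k + 1 / κL * (√ρA * Yo k + √ρB * Zo k) ≤
      (1 - 1 / κL / 4) ^ k * (V 0 + 1 / κL * (√ρA * Yo 0 + √ρB * Zo 0)) + ε / 2 := by
  have hκL := H.one_le_κL
  have hκL1 : 1 / κL ≤ 1 := by rw [div_le_one (by linarith)]; exact hκL
  have h0 : 0 ≤ V 0 + 1 / κL * (√ρA * Yo 0 + √ρB * Zo 0) := by
    have := R.V_nonneg 0; have := R.Yo_nonneg 0; have := R.Zo_nonneg 0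
    positivity
  induction k with
  | zero => linarith [H.ε_nonneg]
  | succ k ih =>
    refine (R.energy_succ_le H hρA hρA' hρB hμ hqA hqB hq k (hδ _) (hδ' _)).trans ?_
    have h1 : 0 ≤ 1 - δ (k + 1) / 4 := by linarith [hδ' (k + 1)]
    have h2 := mul_le_mul_of_nonneg_left ih h1
    have h3 : 0 ≤ (1 - 1 / κL / 4) ^ k * (V 0 + 1 / κL * (√ρA * Yo 0 + √ρB * Zo 0)) :=
      mul_nonneg (pow_nonneg (by linarith) _) h0
    have h4 := mul_le_mul_of_nonneg_right
      (show 1 - δ (k + 1) / 4 ≤ 1 - 1 / κL / 4 by linarith [hδ (k + 1)]) h3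
    rw [pow_succ]
    linarith

end ErrorRecursion

/-! ### The choice of the parameters -/

/-- A constant that bounds the ratios of the problem constants. -/
theorem exists_problem_const {Lf B Mg Lg' Lg : ℝ} (hLf : 0 < Lf) (hB : 0 < B) (hMg : 0 < Mg)
    (hLg' : 0 < Lg') (hLg : 0 < Lg) :
    ∃ M : ℝ, 1 ≤ M ∧ Lg' ≤ M ∧ 1 / Lg ≤ M ∧ B / Lg ≤ M ∧ Lg' / Lg ≤ M ∧
      Lf / Lg + Mg * B / Lg ^ 2 ≤ M ∧
      Lf + Mg * B / Lg + Lg' * (Lf / Lg + Mg * B / Lg ^ 2) ≤ M ∧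
      Lg ^ 3 / (Lg' ^ 2 * Mg * B) ≤ M := by
  have h1 : 0 < 1 / Lg := by positivity
  have h2 : 0 < B / Lg := by positivity
  have h3 : 0 < Lg' / Lg := by positivity
  have h4 : 0 < Lf / Lg + Mg * B / Lg ^ 2 := by positivity
  have h5 : 0 < Lf + Mg * B / Lg + Lg' * (Lf / Lg + Mg * B / Lg ^ 2) := by positivity
  have h6 : 0 < Lg ^ 3 / (Lg' ^ 2 * Mg * B) := by positivity
  refine ⟨1 + Lg' + 1 / Lg + B / Lg + Lg' / Lg + (Lf / Lg + Mg * B / Lg ^ 2)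
    + (Lf + Mg * B / Lg + Lg' * (Lf / Lg + Mg * B / Lg ^ 2)) + Lg ^ 3 / (Lg' ^ 2 * Mg * B),
    ?_, ?_, ?_, ?_, ?_, ?_, ?_, ?_⟩ <;> linarith

/-- The product of the term L_g'M_gB/μ_g² in the first factor with L_g'/μ_g in the second. -/
theorem smoothConst_ge {Lf B Mg Lg' μg : ℝ} (hLf : 0 < Lf) (hB : 0 < B) (hMg : 0 < Mg)
    (hLg' : 0 < Lg') (hμg : 0 < μg) :
    Lg' ^ 2 * Mg * B / μg ^ 3 ≤ smoothConst Lf B Mg Lg' μg := by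
  have h : Lg' ^ 2 * Mg * B / μg ^ 3 = (Lg' * Mg * B / μg ^ 2) * (Lg' / μg) := by
    field_simp
  rw [h, smoothConst]
  refine mul_le_mul ?_ ?_ (by positivity) (by positivity)
  · have : 0 ≤ (Lg' * Lf + Mg * B) / μg := by positivity
    linarith
  · linarith

theorem variance_le_of_order {c a σ ε : ℝ} {n : ℕ} (hc : 0 < c) (ha : 0 < a) (hε : 0 < ε)
    (hn : 1 ≤ n) (h : c * (a * σ ^ 2 / ε) ≤ n) : σ ^ 2 / n * a ≤ ε / c := by
  have hn0 : (0 : ℝ) < n := by exact_mod_cast hn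
  rw [div_mul_eq_mul_div, div_le_div_iff₀ hn0 hc]
  have h1 := mul_le_mul_of_nonneg_right h hε.le
  have h2 : c * (a * σ ^ 2 / ε) * ε = σ ^ 2 * a * c := by field_simp
  linarith

/-- Each coefficient is a ratio with powers of μ_g below. Replacing μ_g by L_g there costs powers of
κ and leaves a ratio bounded by M. -/
theorem coefficientBounds {Lf B Mg Lg' Lg M μg μ c ε σf σg σgxy σgyy : ℝ} {ng nf ngxy ngyy : ℕ}
    (hLf : 0 < Lf) (hB : 0 < B) (hMg : 0 < Mg) (hLg' : 0 < Lg') (hLg : 0 < Lg)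
    (hM : 1 ≤ M) (hM1 : Lg' ≤ M) (hM2 : 1 / Lg ≤ M) (hM3 : B / Lg ≤ M) (hM4 : Lg' / Lg ≤ M)
    (hM5 : Lf / Lg + Mg * B / Lg ^ 2 ≤ M)
    (hM6 : Lf + Mg * B / Lg + Lg' * (Lf / Lg + Mg * B / Lg ^ 2) ≤ M)
    (hM7 : Lg ^ 3 / (Lg' ^ 2 * Mg * B) ≤ M)
    (hc : 2400 * M ^ 7 ≤ c) (hμg : 0 < μg) (hμgLg : μg ≤ Lg) (hμ : 0 < μ)
    (hμL : μ ≤ smoothConst Lf B Mg Lg' μg) (hε : 0 < ε) (hε1 : ε ≤ 1)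
    (vg : σg ^ 2 / ng * (smoothConst Lf B Mg Lg' μg / μ * (Lg / μg) ^ 2) ≤ ε / c)
    (vf : σf ^ 2 / nf ≤ ε / c) (vxy : σgxy ^ 2 / ngxy ≤ ε / c) (vyy : σgyy ^ 2 / ngyy ≤ ε / c) :
    CoefficientBounds M (Lg / μg) (smoothConst Lf B Mg Lg' μg / μ) (ε / c) ε
      (1 / Lg * σg ^ 2 / (μg * ng))
      (6 * (σf ^ 2 / nf) / μg ^ 2 + 4 * (1 / (2 * Lg)) * (σgyy ^ 2 / ngyy) * B ^ 2 / μg ^ 3)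
      (Lf + Mg * B / μg + Lg' * (Lf / μg + Mg * B / μg ^ 2))
      (Lg' / μg) (Lf / μg + Mg * B / μg ^ 2) Lg' (1 / smoothConst Lf B Mg Lg' μg) μ
      (σf ^ 2 / nf) (σgxy ^ 2 / ngxy) (B ^ 2 / μg ^ 2) := by
  have hL : 0 < smoothConst Lf B Mg Lg' μg := hμ.trans_le hμL
  have hLge := smoothConst_ge hLf hB hMg hLg' hμg
  set L := smoothConst Lf B Mg Lg' μg with hLdef
  set κ := Lg / μg with hκdef
  have hκ : 1 ≤ κ := (one_le_div hμg).2 hμgLg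
  have hκL : 1 ≤ L / μ := (one_le_div hμ).2 hμL
  have hinv : 1 / μg = 1 / Lg * κ := by rw [hκdef]; field_simp
  have hinvle : 1 / μg ≤ M * κ := by
    rw [hinv]; exact mul_le_mul_of_nonneg_right hM2 (by linarith)
  have hBμ : B / μg ≤ M * κ := by
    have : B / μg = B / Lg * κ := by rw [hκdef]; field_simp
    rw [this]; exact mul_le_mul_of_nonneg_right hM3 (by linarith)
  have hlz : Lf / μg + Mg * B / μg ^ 2 ≤ (Lf / Lg + Mg * B / Lg ^ 2) * κ ^ 2 := by
    have h1 : Lf / μg = Lf / Lg * κ := by rw [hκdef]; field_simp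
    have h2 : Mg * B / μg ^ 2 = Mg * B / Lg ^ 2 * κ ^ 2 := by rw [hκdef]; field_simp
    have h3 : Lf / Lg * κ ≤ Lf / Lg * κ ^ 2 :=
      mul_le_mul_of_nonneg_left (le_self_pow₀ hκ (by norm_num)) (by positivity)
    rw [h1, h2, add_mul]
    linarith
  have hc0 : 0 < c := lt_of_lt_of_le (by positivity) hc
  have hτ : 0 ≤ ε / c := by positivity
  refine
    { one_le_M := hM, one_le_κ := hκ, one_le_κL := hκL, τ_nonneg := hτ, τ_le := ?_
      ε_le := hε1, γ_nonneg := by positivity, μ_inv := ?_, γ_mul_le := ?_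
      Ry_nonneg := by positivity, Ry_le := ?_, Rz_nonneg := by positivity, Rz_le := ?_
      Ly_nonneg := by positivity, Ly_le := ?_, lam_nonneg := by positivity, lam_le := ?_
      lz_nonneg := by positivity, lz_le := ?_, Lg'_nonneg := hLg'.le, Lg'_le := hM1
      vf_le := vf, vxy_le := vxy, Bμ_nonneg := by positivity
      Bμ_le := ?_ }
  · rw [mul_div_assoc', div_le_iff₀ hc0]
    have := mul_le_mul_of_nonneg_right hc hε.le
    linarith
  · field_simp
  · have h1 : Lg' ^ 2 * Mg * B / Lg ^ 3 * κ ^ 3 ≤ L := by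
      refine le_trans (le_of_eq ?_) hLge
      rw [hκdef]; field_simp
    have h2 := mul_le_mul_of_nonneg_left h1
      (show 0 ≤ Lg ^ 3 / (Lg' ^ 2 * Mg * B) by positivity)
    have h3 : Lg ^ 3 / (Lg' ^ 2 * Mg * B) * (Lg' ^ 2 * Mg * B / Lg ^ 3 * κ ^ 3) = κ ^ 3 := by
      field_simp
    rw [one_div, inv_mul_le_iff₀ hL]
    have h4 := mul_le_mul_of_nonneg_right hM7 hL.le
    linarith
  -- The floor of y itself contributes one κ = L_g/μ_g. With the weight κκ_L this gives exactly the
  -- factor κ_Lκ² in the order of |D_g|.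
  · have h1 : 1 / Lg * σg ^ 2 / (μg * ng) * (κ * (L / μ))
        = 1 / Lg * (1 / Lg) * (σg ^ 2 / ng * (L / μ * κ ^ 2)) := by
      rw [hκdef]; field_simp
    rw [h1, pow_two M]
    exact mul_le_mul (mul_le_mul hM2 hM2 (by positivity) (by positivity)) vg (by positivity)
      (by positivity)
  · have h1 : 6 * (σf ^ 2 / nf) / μg ^ 2 ≤ 6 * (ε / c) * (M * κ) ^ 2 := by
      rw [div_eq_mul_one_div, ← one_div_pow]
      exact mul_le_mul (by linarith) (pow_le_pow_left₀ (by positivity) hinvle 2) (by positivity)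
        (by positivity)
    have h2 : 4 * (1 / (2 * Lg)) * (σgyy ^ 2 / ngyy) * B ^ 2 / μg ^ 3
        = 2 * ((1 / Lg) * (σgyy ^ 2 / ngyy) * ((B / μg) ^ 2 * (1 / μg))) := by
      field_simp; norm_num
    have h3 : (1 / Lg) * (σgyy ^ 2 / ngyy) * ((B / μg) ^ 2 * (1 / μg))
        ≤ M * (ε / c) * ((M * κ) ^ 2 * (M * κ)) :=
      mul_le_mul (mul_le_mul hM2 vyy (by positivity) (by positivity))
        (mul_le_mul (pow_le_pow_left₀ (by positivity) hBμ 2) hinvle (by positivity)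
          (by positivity)) (by positivity) (by positivity)
    have h4 : M ^ 2 * κ ^ 2 * (ε / c) ≤ M ^ 4 * κ ^ 3 * (ε / c) :=
      mul_le_mul_of_nonneg_right (mul_le_mul (pow_le_pow_right₀ hM (by norm_num))
        (pow_le_pow_right₀ hκ (by norm_num)) (by positivity) (by positivity)) hτ
    have h5 : 0 ≤ M ^ 4 * κ ^ 3 * (ε / c) := by positivity
    rw [h2]
    linarith
  · have h1 := mul_le_mul_of_nonneg_left hlz hLg'.le
    have h2 : Mg * B / μg = Mg * B / Lg * κ := by rw [hκdef]; field_simp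
    have h3 : Mg * B / Lg * κ ≤ Mg * B / Lg * κ ^ 2 :=
      mul_le_mul_of_nonneg_left (le_self_pow₀ hκ (by norm_num)) (by positivity)
    have h4 : Lf ≤ Lf * κ ^ 2 := le_mul_of_one_le_right hLf.le (one_le_pow₀ hκ)
    have h5 := mul_le_mul_of_nonneg_right hM6 (sq_nonneg κ)
    rw [h2]
    linarith
  · have : Lg' / μg = Lg' / Lg * κ := by rw [hκdef]; field_simp
    rw [this]; exact mul_le_mul_of_nonneg_right hM4 (by linarith)
  · exact hlz.trans (mul_le_mul_of_nonneg_right hM5 (sq_nonneg _))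
  · rw [← div_pow, ← mul_pow]
    exact pow_le_pow_left₀ (by positivity) hBμ 2

theorem sqrt_one_sub_pow_le {r : ℝ} (hr : r ≤ 1) (n : ℕ) :
    √((1 - r) ^ n) ≤ Real.exp (-(r * n / 2)) := by
  refine Real.sqrt_le_iff.2 ⟨(Real.exp_pos _).le, ?_⟩
  rw [← Real.exp_nat_mul]
  refine (pow_le_pow_left₀ (by linarith) (Real.one_sub_le_exp_neg r) n).trans_eq ?_
  rw [← Real.exp_nat_mul]
  congr 1
  push_cast
  ring

/-- exp(c/8) exceeds A and K^(c/8) exceeds Kⁿ. This is why the logarithm of the condition numbers in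
T and N suffices to beat a polynomial. -/
theorem mul_exp_neg_le_one {c A K : ℝ} {n : ℕ} (hK : 1 ≤ K) (hc : 8 * n ≤ c)
    (hA : 8 * A ≤ c) :
    A * K ^ n * Real.exp (-(c * (1 + Real.log K) / 8)) ≤ 1 := by
  rw [Real.exp_neg, ← div_eq_mul_inv, div_le_one (Real.exp_pos _)]
  have h1 : c * (1 + Real.log K) / 8 = c / 8 + c / 8 * Real.log K := by ring
  have h2 : K ^ n ≤ Real.exp (c / 8 * Real.log K) := by
    have h3 : K ^ n = Real.exp (n * Real.log K) := by
      rw [Real.exp_nat_mul, Real.exp_log (by linarith)]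
    rw [h3]
    exact Real.exp_le_exp.2 (mul_le_mul_of_nonneg_right (by linarith) (Real.log_nonneg hK))
  rw [h1, Real.exp_add]
  refine mul_le_mul ?_ h2 (by positivity) (Real.exp_pos _).le
  linarith [Real.add_one_le_exp (c / 8)]

/-- The number of steps after which a linearly converging sequence is smaller than `ε`. -/
theorem exists_iteration_le {V : ℕ → ℝ} {κ E ε : ℝ} (hκ : 1 ≤ κ) (hε : 0 < ε) (h0 : V 0 ≤ E)
    (hV : ∀ k, V k ≤ (1 - 1 / κ / 4) ^ k * E + ε / 2) :
    ∃ k : ℕ, V k ≤ ε ∧ (k : ℝ) ≤ 9 * κ * max 1 (Real.log (E / ε)) := by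
  have hm : (1 : ℝ) ≤ max 1 (Real.log (E / ε)) := le_max_left _ _
  -- If E ≤ ε no iteration is needed; this also disposes of logarithms of nonpositive numbers.
  rcases le_or_gt E ε with hE | hE
  · exact ⟨0, h0.trans hE, by push_cast; positivity⟩
  have hE0 : 0 < E := hε.trans hE
  have hl : 0 ≤ Real.log (E / ε) := Real.log_nonneg ((one_le_div hε).2 hE.le)
  set l := Real.log (E / ε) with hldef
  have hκ1 : 1 / κ ≤ 1 := by rw [div_le_one (by linarith)]; exact hκ
  -- The l in the exponent reduces E to ε, and the extra 1 gives a factor 1/e ≤ 1/2.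
  refine ⟨⌈4 * κ * (1 + l)⌉₊, (hV _).trans ?_, ?_⟩
  · have h1 : (1 - 1 / κ / 4) ^ ⌈4 * κ * (1 + l)⌉₊ ≤ Real.exp (-(1 + l)) := by
      refine (pow_le_pow_left₀ (by linarith) (Real.one_sub_le_exp_neg _) _).trans ?_
      rw [← Real.exp_nat_mul, Real.exp_le_exp]
      have h2 := Nat.le_ceil (4 * κ * (1 + l))
      have h3 := mul_le_mul_of_nonneg_right h2 (show 0 ≤ 1 / κ / 4 by positivity)
      have h4 : 4 * κ * (1 + l) * (1 / κ / 4) = 1 + l := by field_simp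
      linarith
    have h2 : Real.exp (-(1 + l)) * E ≤ ε / 2 := by
      rw [Real.exp_neg, Real.exp_add, hldef, Real.exp_log (by positivity),
        inv_mul_le_iff₀ (by positivity)]
      have h3 : Real.exp 1 * (E / ε) * (ε / 2) = Real.exp 1 / 2 * E := by field_simp
      rw [h3]
      have h4 := Real.add_one_le_exp 1
      exact le_mul_of_one_le_left hE0.le (by linarith)
    have h3 := mul_le_mul_of_nonneg_right h1 hE0.le
    linarith
  · have h1 := (Nat.ceil_lt_add_one (show 0 ≤ 4 * κ * (1 + l) by positivity)).le
    have h2 : κ * l ≤ κ * max 1 l := mul_le_mul_of_nonneg_left (le_max_right _ _) (by linarith)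
    have h3 : κ * 1 ≤ κ * max 1 l := mul_le_mul_of_nonneg_left hm (by linarith)
    linarith

theorem ErrorRecursion.exists_iteration_le
    {ρA ρB Ry Rz Ly lam lz Lg' γ μ vf vxy Bμ : ℝ} {δ d Yo Y Zo Z V ee bb Δ : ℕ → ℝ}
    (R : ErrorRecursion ρA ρB Ry Rz Ly lam lz Lg' γ μ vf vxy Bμ δ d Yo Y Zo Z V ee bb Δ)
    {M κ κL τ ε : ℝ} (H : CoefficientBounds M κ κL τ ε Ry Rz Ly lam lz Lg' γ μ vf vxy Bμ)
    (hρA : 0 ≤ ρA) (hρA' : ρA ≤ 1) (hρB : 0 ≤ ρB) (hμ : 0 < μ) {q : ℝ}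
    (hqA : √ρA ≤ q) (hqB : √ρB ≤ q)
    (hq : 32 * (1100 * M ^ 8 * (κ * κL) ^ 7) * κL * q ≤ 1)
    (hδ : ∀ k, 1 / κL ≤ δ k) (hδ' : ∀ k, δ k ≤ 1) (hε : 0 < ε) {E : ℝ}
    (hE : V 0 + 1 / κL * (√ρA * Yo 0 + √ρB * Zo 0) ≤ E) :
    ∃ k : ℕ, V k ≤ ε ∧ (k : ℝ) ≤ 9 * κL * max 1 (Real.log (E / ε)) := by
  have hκL := H.one_le_κL
  have hκL1 : 1 / κL ≤ 1 := by rw [div_le_one (by linarith)]; exact hκL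
  have hV : ∀ k, V k ≤ V k + 1 / κL * (√ρA * Yo k + √ρB * Zo k) := fun k => by
    have := R.Yo_nonneg k; have := R.Zo_nonneg k
    exact le_add_of_nonneg_right (by positivity)
  refine AmIGO.exists_iteration_le hκL hε ((hV 0).trans hE) fun k => ?_
  refine (hV k).trans ((R.energy_le H hρA hρA' hρB hμ hqA hqB hq hδ hδ' k).trans ?_)
  have := mul_le_mul_of_nonneg_left hE
    (pow_nonneg (show 0 ≤ 1 - 1 / κL / 4 by linarith) k)
  linarith

/-- A batch has at least one sample, so an inner run may cost a multiple of κℓ however small the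
variances are. This is what the alternative εκ to S(ε) accounts for. -/
theorem complexity_le {c c' κ κL ℓ ε m σf σg σgxy σgyy : ℝ} {p : Params} {k : ℕ}
    (hc' : 0 ≤ c') (hκ : 1 ≤ κ) (hκL : 1 ≤ κL) (hℓ : 1 ≤ ℓ) (hε : 0 < ε) (hm : 0 ≤ m)
    (hT : (p.T : ℝ) ≤ c' * (κ * ℓ)) (hN : (p.N : ℝ) ≤ c' * (κ * ℓ))
    (hng : IsOrder c c' (κL * κ ^ 2 * σg ^ 2 / ε) p.ng)
    (hngxy : IsOrder c c' (σgxy ^ 2 / ε) p.ngxy)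
    (hnf : IsOrder c c' (σf ^ 2 / ε) p.nf)
    (hngyy : IsOrder c c' (σgyy ^ 2 * max (1 / ε) κ) p.ngyy)
    (hk : (k : ℝ) ≤ 9 * κL * m) :
    complexity p k ≤ 9 * (2 * c' ^ 2 + 2 * c') * ℓ * (κL *
      max (κL * κ ^ 3 * σg ^ 2 + κ * max 1 (ε * κ) * σgyy ^ 2 + σgxy ^ 2 + σf ^ 2) (ε * κ)
        * (1 / ε) * m) := by
  have hmε : (1 : ℝ) ≤ max 1 (ε * κ) := le_max_left _ _
  set S := κL * κ ^ 3 * σg ^ 2 + κ * max 1 (ε * κ) * σgyy ^ 2 + σgxy ^ 2 + σf ^ 2 with hS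
  set Q := max S (ε * κ) * (1 / ε) with hQ
  have hκQ : κ ≤ Q := by
    rw [hQ, mul_one_div, le_div_iff₀ hε, mul_comm]; exact le_max_right _ _
  have hSQ : S / ε ≤ Q := by
    rw [hQ, mul_one_div]; exact div_le_div_of_nonneg_right (le_max_left _ _) hε.le
  have le_of_le : ∀ a, a ≤ S → a / ε ≤ Q := fun a ha =>
    (div_le_div_of_nonneg_right ha hε.le).trans hSQ
  have p1 : 0 ≤ κL * κ ^ 3 * σg ^ 2 := by positivity
  have p2 : 0 ≤ κ * max 1 (ε * κ) * σgyy ^ 2 := by positivity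
  have p3 := sq_nonneg σgxy
  have p4 := sq_nonneg σf
  have hQ0 : 0 ≤ Q := by linarith
  -- the four batches
  have b1 : (p.T : ℝ) * p.ng ≤ c' ^ 2 * (ℓ * Q) := by
    have h1 : κ * max 1 (κL * κ ^ 2 * σg ^ 2 / ε) ≤ Q := by
      rw [mul_max_of_nonneg _ _ (by linarith)]
      refine max_le (by linarith) (le_trans (le_of_eq ?_) (le_of_le (κL * κ ^ 3 * σg ^ 2)
        (by linarith)))
      ring
    refine (mul_le_mul hT hng.2.2 (Nat.cast_nonneg _) (by positivity)).trans ?_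
    have h2 := mul_le_mul_of_nonneg_left h1 (show 0 ≤ c' ^ 2 * ℓ by positivity)
    linarith
  have b2 : (p.N : ℝ) * p.ngyy ≤ c' ^ 2 * (ℓ * Q) := by
    have h1 : κ * max 1 (σgyy ^ 2 * max (1 / ε) κ) ≤ Q := by
      rw [mul_max_of_nonneg _ _ (by linarith)]
      refine max_le (by linarith) (le_trans (le_of_eq ?_)
        (le_of_le (κ * max 1 (ε * κ) * σgyy ^ 2) (by linarith)))
      have h2 : max (1 / ε) κ = max 1 (ε * κ) / ε := by
        rw [← max_div_div_right hε.le, mul_div_cancel_left₀ _ hε.ne']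
      rw [h2]; ring
    refine (mul_le_mul hN hngyy.2.2 (Nat.cast_nonneg _) (by positivity)).trans ?_
    have h2 := mul_le_mul_of_nonneg_left h1 (show 0 ≤ c' ^ 2 * ℓ by positivity)
    linarith
  have hQℓ : Q ≤ ℓ * Q := le_mul_of_one_le_left hQ0 hℓ
  have b3 : (p.ngxy : ℝ) ≤ c' * (ℓ * Q) := hngxy.2.2.trans <|
    mul_le_mul_of_nonneg_left ((max_le (by linarith) (le_of_le _ (by linarith))).trans hQℓ) hc'
  have b4 : (p.nf : ℝ) ≤ c' * (ℓ * Q) := hnf.2.2.trans <|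
    mul_le_mul_of_nonneg_left ((max_le (by linarith) (le_of_le _ (by linarith))).trans hQℓ) hc'
  rw [complexity]
  refine (mul_le_mul hk (show _ ≤ (2 * c' ^ 2 + 2 * c') * (ℓ * Q) by linarith) (by positivity)
    (by positivity)).trans_eq ?_
  rw [hQ]
  ring

/-- The energy of the recursion at time `0` is at most the initial energy. -/
theorem initial_energy_ge {X Y Ξ Ω : Type*}
    [NormedAddCommGroup X] [InnerProductSpace ℝ X] [CompleteSpace X]
    [NormedAddCommGroup Y] [InnerProductSpace ℝ Y] [CompleteSpace Y] [MeasurableSpace Ω]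
    {Pr : Measure Ω} [IsProbabilityMeasure Pr] {f g : X → Y → ℝ} {fhat ghat : Ξ → X → Y → ℝ}
    {p : Params} {s : SampleIdx → Ω → Ξ} {μg μ η₀ : ℝ} {w₀ : X × Y × Y} (hγ : 0 ≤ p.γ)
    (hη : μ ≤ η₀) :
    (∫ _ : Ω, (outerLoss f g w₀.1 - outerLoss f g (outerSol f g)) ∂Pr
      + η₀ / 2 * sqMean Pr (fun _ : Ω => w₀.1 - outerSol f g))
      + p.γ * μ * (√((1 - p.α * μg) ^ p.T) * sqMean Pr (fun _ : Ω => w₀.2.1 - innerSol g w₀.1)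
      + √((1 - p.β * μg / 2) ^ p.N) * sqMean Pr (fun ω => w₀.2.2
        - linSol f g w₀.1 (state fhat ghat p s w₀ 1 ω).2.1)) ≤
    initialEnergy Pr f g fhat ghat p s μg η₀ w₀
      + (outerLoss f g w₀.1 - outerLoss f g (outerSol f g)) := by
  have h1 := mul_le_mul_of_nonneg_left hη hγ
  have hY : 0 ≤ √((1 - p.α * μg) ^ p.T) * ‖w₀.2.1 - innerSol g w₀.1‖ ^ 2 := by positivity
  have hZ : 0 ≤ √((1 - p.β * μg / 2) ^ p.N) * ∫ ω, ‖w₀.2.2 - linSol f g w₀.1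
      (amigo fhat ghat p (fun i => s i ω) w₀ 1).2.1‖ ^ 2 ∂Pr :=
    mul_nonneg (Real.sqrt_nonneg _) (integral_nonneg fun _ => by positivity)
  have h2 := mul_le_mul_of_nonneg_right h1 hY
  have h3 := mul_le_mul_of_nonneg_right h1 hZ
  simp only [sqMean, integral_const, probReal_univ, one_smul, initialEnergy, state]
  linarith

end AmIGO

end

/-! ### Assembly of the corollary -/

theorem corollary2
    (Lf B Mg Lg' Lg : ℝ) (hLf : 0 < Lf) (hB : 0 < B) (hMg : 0 < Mg) (hLg' : 0 < Lg')
    (hLg : 0 < Lg) :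
    ∃ c : ℝ, 0 < c ∧ ∀ c' : ℝ, c ≤ c' → ∃ C : ℝ, 0 < C ∧
    -- the problem
    ∀ (dX dY : ℕ) (f g : EuclideanSpace ℝ (Fin dX) → EuclideanSpace ℝ (Fin dY) → ℝ)
      (μg μ : ℝ), 0 < μg → μg ≤ Lg →
      AmIGO.BilevelAssumptions f g Lf B Mg Lg' Lg μg →
      0 < μ → μ ≤ AmIGO.smoothConst Lf B Mg Lg' μg →
      StrongConvexOn univ μ (AmIGO.outerLoss f g) →
    -- the noise
    ∀ (Ξ : Type*) [MeasurableSpace Ξ] (P : Measure Ξ)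
      [IsProbabilityMeasure P]
      (fhat ghat : Ξ → EuclideanSpace ℝ (Fin dX) → EuclideanSpace ℝ (Fin dY) → ℝ)
      (σf σg σgxy σgyy : ℝ),
      AmIGO.StochasticModel P f g fhat ghat →
      AmIGO.NoiseAssumptions P f g fhat ghat σf σg σgxy σgyy →
    -- the independent samples of law `P` that the algorithm uses
    ∀ (Ω : Type*) [MeasurableSpace Ω] (Pr : Measure Ω)
      [IsProbabilityMeasure Pr] (s : AmIGO.SampleIdx → Ω → Ξ),
      iIndepFun s Pr →
      (∀ i, MeasurePreserving (s i) Pr P) →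
    -- initial values, precision and parameters
    ∀ (w₀ : EuclideanSpace ℝ (Fin dX) × EuclideanSpace ℝ (Fin dY) × EuclideanSpace ℝ (Fin dY))
      (η₀ ε : ℝ) (T N nf ng ngxy ngyy : ℕ),
      let L := AmIGO.smoothConst Lf B Mg Lg' μg
      let κL := L / μ
      let κg := Lg / μg
      let logFactor := 1 + Real.log (κg * κL)
      μ ≤ η₀ → η₀ ≤ L → 0 < ε → ε ≤ 1 →
      c * (κg * logFactor) ≤ T → T ≤ c' * (κg * logFactor) →
      c * (κg * logFactor) ≤ N → N ≤ c' * (κg * logFactor) →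
      AmIGO.IsOrder c c' (κL * κg ^ 2 * σg ^ 2 / ε) ng →
      AmIGO.IsOrder c c' (σgxy ^ 2 / ε) ngxy →
      AmIGO.IsOrder c c' (σf ^ 2 / ε) nf →
      AmIGO.IsOrder c c' (σgyy ^ 2 * max (1 / ε) κg) ngyy →
      let p : AmIGO.Params :=
        { T := T, N := N, nf := nf, ng := ng, ngxy := ngxy, ngyy := ngyy,
          α := 1 / Lg, β := 1 / (2 * Lg), γ := 1 / L }
      let x : ℕ → Ω → EuclideanSpace ℝ (Fin dX) :=
        fun k ω => (AmIGO.amigo fhat ghat p (fun i => s i ω) w₀ k).1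
      let xhat : ℕ → Ω → EuclideanSpace ℝ (Fin dX) :=
        fun k ω => AmIGO.avgIterate (fun j => p.γ * AmIGO.eta μ p.γ η₀ j) (fun j => x j ω) k
      let xstar := AmIGO.outerSol f g
      let loss := AmIGO.outerLoss f g
      let E₀ := AmIGO.initialEnergy Pr f g fhat ghat p s μg η₀ w₀ + (loss w₀.1 - loss xstar)
      let S := κL * κg ^ 3 * σg ^ 2 + κg * max 1 (ε * κg) * σgyy ^ 2 + σgxy ^ 2 + σf ^ 2
      ∃ k : ℕ,
        Integrable (fun ω => loss (xhat k ω) - loss xstar) Pr ∧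
        Integrable (fun ω => ‖x k ω - xstar‖ ^ 2) Pr ∧
        ∫ ω, (loss (xhat k ω) - loss xstar) ∂Pr + μ / 2 * ∫ ω, ‖x k ω - xstar‖ ^ 2 ∂Pr ≤ ε ∧
        AmIGO.complexity p k ≤
          C * logFactor * (κL * max S (ε * κg) * (1 / ε) * max 1 (Real.log (E₀ / ε))) := by
  obtain ⟨M, hM, hM1, hM2, hM3, hM4, hM5, hM6, hM7⟩ :=
    AmIGO.exists_problem_const hLf hB hMg hLg' hLg
  have hM8 : 1 ≤ M ^ 8 := one_le_pow₀ hM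
  -- The strictest demand on c is 8 · 35200 M⁸, from the exponential decay of the inner rates; the
  -- noise bound needs only 2400 M⁷.
  refine ⟨1000000 * M ^ 8, by positivity, fun c' hcc' => ?_⟩
  set c := 1000000 * M ^ 8 with hc
  have hc0 : 0 < c := by positivity
  have hc'0 : 0 < c' := hc0.trans_le hcc'
  refine ⟨9 * (2 * c' ^ 2 + 2 * c'), by positivity, ?_⟩
  intro dX dY f g μg μ hμg hμgLg hbil hμ hμL hsc Ξ _ P _ fhat ghat σf σg σgxy σgyy hmodel hnoise
    Ω _ Pr _ s hind hlaw w₀ η₀ ε T N nf ng ngxy ngyy L κL κg logFactor hη hηL hε hε1 hTl hTu hNl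
    hNu hng hngxy hnf hngyy p x xhat xstar loss E₀ S
  have hL : 0 < L := hμ.trans_le hμL
  have hκg : 1 ≤ κg := (one_le_div hμg).2 hμgLg
  have hκL : 1 ≤ κL := (one_le_div hμ).2 hμL
  have hK : 1 ≤ κg * κL := one_le_mul_of_one_le_of_one_le hκg hκL
  have hℓ : 1 ≤ logFactor := by linarith [Real.log_nonneg hK]
  have hγ0 : 0 < p.γ := one_div_pos.2 hL
  -- the variances of the batches
  have vg : σg ^ 2 / ng * (κL * κg ^ 2) ≤ ε / c :=
    AmIGO.variance_le_of_order hc0 (by positivity) hε hng.1 hng.2.1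
  have vf : σf ^ 2 / nf ≤ ε / c := by
    simpa using AmIGO.variance_le_of_order hc0 one_pos hε hnf.1 (by simpa using hnf.2.1)
  have vxy : σgxy ^ 2 / ngxy ≤ ε / c := by
    simpa using AmIGO.variance_le_of_order hc0 one_pos hε hngxy.1 (by simpa using hngxy.2.1)
  have vyy : σgyy ^ 2 / ngyy ≤ ε / c := by
    have h1 : c * (1 * σgyy ^ 2 / ε) ≤ ngyy := by
      refine le_trans ?_ hngyy.2.1
      rw [one_mul, div_eq_mul_one_div]
      gcongr
      exact le_max_left _ _
    simpa using AmIGO.variance_le_of_order hc0 one_pos hε hngyy.1 h1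
  -- The alternative κ_g in |D_gyy| serves the stability of the stochastic linear recursion,
  -- independently of ε.
  have vyy' : σgyy ^ 2 / ngyy * κg ≤ 1 / c := by
    refine AmIGO.variance_le_of_order hc0 (by positivity) one_pos hngyy.1 (le_trans ?_ hngyy.2.1)
    rw [div_one, mul_comm κg]
    gcongr
    exact le_max_right _ _
  have hpow : ∀ n ≤ 8, M ^ n ≤ M ^ 8 := fun n hn => pow_le_pow_right₀ hM hn
  have hstable : 4 * p.β * (σgyy ^ 2 / p.ngyy) ≤ μg := by
    have h1 : 4 * p.β * (σgyy ^ 2 / p.ngyy)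
        = 2 * (1 / Lg * (1 / Lg)) * (σgyy ^ 2 / ngyy * κg) * μg := by
      simp only [p, κg]
      field_simp
      norm_num
    have h2 : 1 / Lg * (1 / Lg) ≤ M * M := mul_le_mul hM2 hM2 (by positivity) (by linarith)
    have h3 : 1 / Lg * (1 / Lg) * (σgyy ^ 2 / ngyy * κg) ≤ M * M * (1 / c) :=
      mul_le_mul h2 vyy' (by positivity) (by positivity)
    have h4 : M * M * (1 / c) ≤ 1 / 2 := by
      rw [mul_one_div, div_le_iff₀ hc0]
      linarith [hpow 2 (by norm_num)]
    rw [h1]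
    exact mul_le_of_le_one_left hμg.le (by linarith)
  have A : AmIGO.Setup f g Lf B Mg Lg' Lg μg P fhat ghat σf σg σgxy σgyy Pr s p :=
    { hLf := hLf, hB := hB, hMg := hMg, hLg' := hLg', hLg := hLg, hμg := hμg, hμgLg := hμgLg
      bilevel := hbil, model := hmodel, noise := hnoise, sampling := ⟨hind, hlaw⟩
      hα := rfl, hβ := rfl, hng := hng.1, hnf := hnf.1, hngxy := hngxy.1, hngyy := hngyy.1
      stable := hstable }
  obtain ⟨Yk, Zk, ee, bb, Δ, R⟩ := A.exists_errorRecursion hμ hμL hsc rfl hη hηL w₀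
  have H := AmIGO.coefficientBounds (c := c) hLf hB hMg hLg' hLg hM hM1 hM2 hM3 hM4 hM5 hM6 hM7
    (by linarith [hpow 7 (by norm_num)]) hμg hμgLg hμ hμL hε hε1 vg vf vxy vyy
  -- the rates of the inner algorithms
  have hκinv : 1 / κg ≤ 1 := by rw [div_le_one (by linarith)]; exact hκg
  have hαμ : p.α * μg = 1 / κg := by simp only [p, κg]; field_simp
  have hβμ : p.β * μg / 2 = 1 / (4 * κg) := by simp only [p, κg]; field_simp; norm_num
  have hβ1 : p.β * μg / 2 ≤ 1 := by
    rw [hβμ, div_le_one (by positivity)]; linarith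
  have hρA : 0 ≤ (1 - p.α * μg) ^ p.T := pow_nonneg (by linarith) _
  have hρA' : (1 - p.α * μg) ^ p.T ≤ 1 :=
    pow_le_one₀ (by linarith) (by rw [hαμ, sub_le_self_iff]; positivity)
  have hρB : 0 ≤ (1 - p.β * μg / 2) ^ p.N := pow_nonneg (by linarith) _
  have hqA : √((1 - p.α * μg) ^ p.T) ≤ Real.exp (-(c * logFactor / 8)) := by
    refine (AmIGO.sqrt_one_sub_pow_le (by linarith) _).trans (Real.exp_le_exp.2 ?_)
    have h1 := mul_le_mul_of_nonneg_left hTl (show 0 ≤ 1 / κg by positivity)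
    have h2 : 1 / κg * (c * (κg * logFactor)) = c * logFactor := by field_simp
    have h3 : 0 ≤ c * logFactor := by positivity
    rw [hαμ]
    change -(1 / κg * (T : ℝ) / 2) ≤ _
    linarith
  -- βμ_g/2 = 1/(4κ_g), halved by the root: this slower of the two rates fixes the 8 in the
  -- exponent.
  have hqB : √((1 - p.β * μg / 2) ^ p.N) ≤ Real.exp (-(c * logFactor / 8)) := by
    refine (AmIGO.sqrt_one_sub_pow_le hβ1 _).trans (Real.exp_le_exp.2 ?_)
    have h1 := mul_le_mul_of_nonneg_left hNl (show 0 ≤ 1 / (4 * κg) by positivity)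
    have h2 : 1 / (4 * κg) * (c * (κg * logFactor)) = c * logFactor / 4 := by field_simp
    rw [hβμ]
    change -(1 / (4 * κg) * (N : ℝ) / 2) ≤ _
    linarith
  have hq : 32 * (1100 * M ^ 8 * (κg * κL) ^ 7) * κL * Real.exp (-(c * logFactor / 8)) ≤ 1 := by
    -- 35200 = 32 · 1100, and the eighth power comes from κ_L ≤ κ_gκ_L.
    have h1 := AmIGO.mul_exp_neg_le_one (c := c) (A := 35200 * M ^ 8) (n := 8) hK
      (by push_cast; linarith) (by linarith)
    refine le_trans (mul_le_mul_of_nonneg_right ?_ (Real.exp_pos _).le) h1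
    have h2 : κL ≤ κg * κL := le_mul_of_one_le_left (by linarith) hκg
    have h3 := mul_le_mul_of_nonneg_left h2
      (show 0 ≤ 35200 * M ^ 8 * (κg * κL) ^ 7 by positivity)
    linarith
  -- the averaging weights
  have hγμ : p.γ * μ = 1 / κL := by simp only [p, κL]; field_simp
  have hγμ1 : p.γ * μ ≤ 1 := by rw [hγμ, div_le_one (by linarith)]; exact hκL
  have hηk := AmIGO.le_eta hγ0.le hγμ1 hη
  have hδ : ∀ k, 1 / κL ≤ p.γ * AmIGO.eta μ p.γ η₀ k := fun k => by
    rw [← hγμ]; exact mul_le_mul_of_nonneg_left (hηk k) hγ0.le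
  have hδ' : ∀ k, p.γ * AmIGO.eta μ p.γ η₀ k ≤ 1 := fun k => by
    have h1 := mul_le_mul_of_nonneg_left ((AmIGO.eta_le hγ0.le hγμ1 hμ hη k).trans hηL) hγ0.le
    have h2 : p.γ * L = 1 := one_div_mul_cancel hL.ne'
    linarith
  have hE := AmIGO.initial_energy_ge (Pr := Pr) (f := f) (g := g) (fhat := fhat) (ghat := ghat)
    (s := s) (μg := μg) (w₀ := w₀) hγ0.le hη
  rw [hγμ] at hE
  have hx2 := fun k => (A.state_measurable_memLp w₀ k).2.1
  obtain ⟨k, hk, hk'⟩ := R.exists_iteration_le H hρA hρA' hρB hμ hqA hqB hq hδ hδ' hε (E := E₀) hE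
  refine ⟨k, A.integrable_outerLoss_gap hμ hsc (A.memLp_avgIterate w₀ _ k),
    AmIGO.integrable_norm_sq ((hx2 k).sub (memLp_const _)), ?_, ?_⟩
  -- V weights the squared distance by η_k/2, which is at least μ/2.
  · refine le_trans (add_le_add le_rfl ?_) hk
    exact mul_le_mul_of_nonneg_right (by linarith [hηk k]) (AmIGO.sqMean_nonneg _)
  · exact AmIGO.complexity_le hc'0.le hκg hκL hℓ hε (by positivity) hTu hNu hng hngxy hnf hngyy hk'
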